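/- **Setting.** Fix constants $M,\tau>0$ and $A,g,\overline\gamma,c\in\mathbb R$. Let $\mathcal H^1_{\rm per}$ be the Sobolev space of real $2\pi$-periodic functions with square integrable weak derivative, and let $X=\mathcal H^1_{\rm per,odd}\times\mathcal H^1_{\rm per,0,even}$ be the space of pairs $(\theta,\gamma_1)$ with $\theta$ odd and $\gamma_1$ even with mean zero. Write $\overline f=\frac1{2\pi}\int_0^{2\pi}f$. For functions $\theta,\gamma$ and a curve $w$ put $$\widetilde Z[\theta](\alpha)=\frac{M}{2\pi\overline{\cos\theta}}\Big\{\int_0^\alpha e^{i\theta(\beta)}d\beta-i\alpha\,\overline{\sin\theta}\Big\},\quad \widetilde T[\theta]=\frac{\partial_\alpha\widetilde Z[\theta]}{|\partial_\alpha\widetilde Z[\theta]|},\quad \widetilde N[\theta]=i\,\widetilde T[\theta],$$ $$B[w]\gamma(\alpha)=\frac1{2\pi i}\,{\rm PV}\!\int_{\mathbb R}\frac{\gamma(\alpha')}{w(\alpha)-w(\alpha')}d\alpha',\quad H\gamma(\alpha)=\frac1{2\pi}{\rm PV}\!\int_0^{2\pi}\gamma(\alpha')\cot\tfrac{\alpha-\alpha'}2\,d\alpha',\quad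 K[w]\gamma=B[w]\gamma-\frac{1}{2i\,w_\alpha}H\gamma,$$ $$\partial_\alpha^{-2}f(\alpha)=\int_0^\alpha\!\!\int_0^a f(s)\,ds\,da-\frac{\alpha}{2\pi}\int_0^{2\pi}\!\!\int_0^a f(s)\,ds\,da,$$ and, with $V=c\cos\theta-\mathrm{Re}\big(B[\widetilde Z[\theta]]\gamma\;\widetilde T[\theta]\big)$, $$\widetilde\Phi(\theta,\gamma;c)=\frac1\tau\partial_\alpha(V\gamma)-\frac A\tau\Big(\frac{\pi\overline{\cos\theta}}{2M}\partial_\alpha(\gamma^2)+\frac{gM}{\pi\overline{\cos\theta}}(\sin\theta-\overline{\sin\theta})+\frac{M}{2\pi\overline{\cos\theta}}\partial_\alpha(V^2)\Big).$$ Define $\Theta(\theta,\gamma_1;c)=-\partial_\alpha^{-2}\widetilde\Phi(\theta,\overline\gamma+\gamma_1;c)$ and, writing $\Theta$ for $\Theta(\theta,\gamma_1;c)$, $$\Gamma(\theta,\gamma_1;c)=2H\Big\{|\partial_\alpha\widetilde Z[\Theta]|\,\mathrm{Re}\big(K[\widetilde Z[\Theta]](\overline\gamma+\gamma_1)\,\widetilde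 N[\Theta]\big)+c\,|\partial_\alpha\widetilde Z[\Theta]|\sin\Theta\Big\}.$$ **Proposition (Spectrum of $L_c$).** For $(\theta,\gamma_1)$ near $0$ in $X$ one has $(\Theta,\Gamma)(\theta,\gamma_1;c)\in X$, and the map $(\theta,\gamma_1)\mapsto(\theta-\Theta,\gamma_1-\Gamma)$ into $X$ is Fréchet differentiable at $(0,0)$. Let $L_c:X\to X$ be its derivative there (its linearization at $(0,0;c)$), and consider spectrum, eigenvalues and eigenspaces of the complexification of $L_c$. Then: 1. The spectrum of $L_c$ is $\{1\}\cup\{\lambda_k(c):k\in\mathbb N\}$, where $\mathbb N=\{1,2,\dots\}$ and $$\lambda_k(c)=1+\frac{2\overline\gamma cAM\pi-M^2c^2-\overline\gamma^2\pi^2}{M\pi\tau}\,k^{-1}+\frac{gAM}{\pi\tau}\,k^{-2},$$ and each $\lambda_k(c)$ is an eigenvalue. 2. For every $\lambda\in\mathbb C$ with $\lambda\neq1$, the geometric and the algebraic multiplicity of $\lambda$ (the dimensions of $\ker(L_c-\lambda)$ and of $\bigcup_n\ker(L_c-\lambda)^n$) both equal $N_\lambda(c)=|\{k\in\mathbb N:\lambda_k(c)=\lambda\}|$.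 3. If $c\ne0$ and $\lambda\neq1$, then the eigenspace of $\lambda$ is $$\mathrm{span}\left\{\begin{bmatrix}-\frac{\pi}{cM}\sin k\alpha\\ \cos k\alpha\end{bmatrix}: k\in\mathbb N,\ \lambda_k(c)=\lambda\right\}.$$ -/

import Mathlib

open Set Filter Topology MeasureTheory
open scoped Real TensorProduct

noncomputable section

namespace VortexSheet

/-! ### Periodic Sobolev spaces of real functions -/

/-- Lebesgue measure on one period. -/
abbrev perMeasure : Measure ℝ := volume.restrict (Ioc 0 (2 * π))

theorem memLp_of_continuousOn {f : ℝ → ℝ} (hf : ContinuousOn f (Icc 0 (2 * π))) :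
    MemLp f 2 perMeasure := by
  obtain ⟨C, hC⟩ := isCompact_Icc.exists_bound_of_continuousOn hf
  refine MemLp.of_bound
    ((hf.mono Ioc_subset_Icc_self).aestronglyMeasurable measurableSet_Ioc) C ?_
  filter_upwards [ae_restrict_mem measurableSet_Ioc] with x hx
  exact hC x (Ioc_subset_Icc_self hx)

/-- `H¹_per` as a space of functions: the `2π`-periodic `f : ℝ → ℝ` that are absolutely continuous
on a period with square integrable derivative. In one variable these are exactly the (continuous
representatives of) periodic functions whose weak derivative is square integrable, and `deriv f`
(which exists almost everywhere) is that weak derivative. -/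
def H1Functions : Submodule ℝ (ℝ → ℝ) where
  carrier := {f | Function.Periodic f (2 * π) ∧ AbsolutelyContinuousOnInterval f 0 (2 * π) ∧
    MemLp (deriv f) 2 perMeasure}
  add_mem' := by
    rintro f f' ⟨hp, ha, hd⟩ ⟨hp', ha', hd'⟩
    refine ⟨hp.add hp', ha.add ha', (hd.add hd').ae_eq ?_⟩
    have h0 : (0 : ℝ) ≤ 2 * π := by positivity
    rw [Filter.EventuallyEq, ae_restrict_iff' measurableSet_Ioc]
    filter_upwards [ha.ae_differentiableAt, ha'.ae_differentiableAt] with x h1 h2 hx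
    have hx' : x ∈ uIcc 0 (2 * π) := by
      rw [uIcc_of_le h0]; exact Ioc_subset_Icc_self hx
    exact (deriv_add (h1 hx') (h2 hx')).symm
  zero_mem' := by
    refine ⟨fun _ => rfl, ?_, ?_⟩
    · exact (contDiff_const (c := (0 : ℝ)) (n := 1)).contDiffOn.absolutelyContinuousOnInterval
    · have : deriv (0 : ℝ → ℝ) = 0 := by ext x; exact deriv_const x 0
      rw [this]; exact MemLp.zero
  smul_mem' := by
    rintro a f ⟨hp, ha, hd⟩
    refine ⟨fun x => by simp [hp x], ha.const_smul a, ?_⟩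
    have : deriv (a • f) = a • deriv f := by
      ext x; exact deriv_const_smul_field a f
    rw [this]; exact hd.const_smul a

/-- The real Hilbert space `H¹_per`. -/
def H1 : Type := H1Functions

instance : AddCommGroup H1 := inferInstanceAs (AddCommGroup H1Functions)

instance : Module ℝ H1 := inferInstanceAs (Module ℝ H1Functions)

instance : CoeFun H1 (fun _ => ℝ → ℝ) := ⟨fun f => Subtype.val f⟩

theorem H1.continuousOn (f : H1) : ContinuousOn f (Icc 0 (2 * π)) := by
  have h0 : (0 : ℝ) ≤ 2 * π := by positivity
  have := f.2.2.1.continuousOn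
  rwa [uIcc_of_le h0] at this

theorem H1.memLp (f : H1) : MemLp f 2 perMeasure :=
  memLp_of_continuousOn f.continuousOn

theorem H1.memLp_deriv (f : H1) : MemLp (deriv f) 2 perMeasure := f.2.2.2

theorem H1.deriv_add_ae (f f' : H1) :
    deriv (f + f' : H1) =ᵐ[perMeasure] deriv f + deriv f' := by
  have h0 : (0 : ℝ) ≤ 2 * π := by positivity
  rw [Filter.EventuallyEq, ae_restrict_iff' measurableSet_Ioc]
  filter_upwards [f.2.2.1.ae_differentiableAt, f'.2.2.1.ae_differentiableAt] with x h1 h2 hx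
  have hx' : x ∈ uIcc 0 (2 * π) := by
    rw [uIcc_of_le h0]; exact Ioc_subset_Icc_self hx
  exact deriv_add (h1 hx') (h2 hx')

/-- The map `f ↦ (f, f')` into `L² × L²` (over one period, with the Hilbert product norm). -/
def H1.toL2 : H1 →ₗ[ℝ] WithLp 2 (Lp ℝ 2 perMeasure × Lp ℝ 2 perMeasure) where
  toFun f := WithLp.toLp 2 (f.memLp.toLp f, f.memLp_deriv.toLp (deriv f))
  map_add' f f' := by
    rw [← WithLp.toLp_add]
    congr 1
    ext1
    · exact MemLp.toLp_add f.memLp f'.memLp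
    · refine Eq.trans ?_ (MemLp.toLp_add f.memLp_deriv f'.memLp_deriv)
      exact (MemLp.toLp_eq_toLp_iff (f + f' : H1).memLp_deriv _).2 (H1.deriv_add_ae f f')
  map_smul' a f := by
    rw [RingHom.id_apply, ← WithLp.toLp_smul]
    congr 1
    ext1
    · exact MemLp.toLp_const_smul a f.memLp
    · refine Eq.trans ?_ (MemLp.toLp_const_smul a f.memLp_deriv)
      refine (MemLp.toLp_eq_toLp_iff (a • f : H1).memLp_deriv _).2 (Filter.EventuallyEq.of_eq ?_)
      ext x
      exact deriv_const_smul_field a (f : ℝ → ℝ)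

theorem H1.toL2_injective : Function.Injective H1.toL2 := by
  rw [injective_iff_map_eq_zero]
  intro f hf
  have h2 : (0 : ℝ) < 2 * π := by positivity
  have h1 : f.memLp.toLp f = 0 := congrArg (fun p => p.fst) hf
  have h3 : (f : ℝ → ℝ) =ᵐ[volume.restrict (Icc 0 (2 * π))] fun _ => (0 : ℝ) := by
    rw [← Measure.restrict_congr_set (Ioc_ae_eq_Icc (μ := volume) (a := (0 : ℝ)) (b := 2 * π))]
    exact f.memLp.coeFn_toLp.symm.trans (h1 ▸ Lp.coeFn_zero ℝ 2 perMeasure)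
  have h4 := Measure.eqOn_Icc_of_ae_eq volume h2.ne h3 f.continuousOn continuousOn_const
  apply Subtype.ext
  funext x
  obtain ⟨y, hy, hxy⟩ := f.2.1.exists_mem_Ico₀ h2 x
  exact hxy.trans (h4 (Ico_subset_Icc_self hy))

/-- The norm of `H¹_per` is `‖f‖² = ∫ |f|² + ∫ |f'|²` over one period. -/
instance : NormedAddCommGroup H1 :=
  NormedAddCommGroup.induced H1 _ H1.toL2 H1.toL2_injective

instance : NormedSpace ℝ H1 := NormedSpace.induced ℝ H1 _ H1.toL2

/-- The mean of a `2π`-periodic function. -/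
def mean (f : ℝ → ℝ) : ℝ := (1 / (2 * π)) * ∫ a in (0 : ℝ)..(2 * π), f a

/-- `H¹_{per,odd}`. -/
def H1Odd : Submodule ℝ H1 where
  carrier := {f | ∀ x, f (-x) = -f x}
  add_mem' := by
    intro f f' h h' x
    change f (-x) + f' (-x) = -(f x + f' x)
    rw [h, h']; ring
  zero_mem' := fun x => by
    change (0 : ℝ) = -0
    simp
  smul_mem' := by
    intro a f h x
    change a * f (-x) = -(a * f x)
    rw [h]; ring

/-- `H¹_{per,0,even}`: the even functions of `H¹_per` with mean zero. -/
def H1ZeroEven : Submodule ℝ H1 where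
  carrier := {f | mean f = 0 ∧ ∀ x, f (-x) = f x}
  add_mem' := by
    rintro f f' ⟨h0, h⟩ ⟨h0', h'⟩
    have h2 : (0 : ℝ) ≤ 2 * π := by positivity
    have hi (u : H1) : IntervalIntegrable u volume 0 (2 * π) :=
      (uIcc_of_le h2 ▸ u.continuousOn).intervalIntegrable
    refine ⟨?_, fun x => ?_⟩
    · have : mean (f + f' : H1) = mean f + mean f' := by
        unfold mean
        rw [← mul_add, ← intervalIntegral.integral_add (hi f) (hi f')]
        rfl
      rw [this, h0, h0', add_zero]
    · change f (-x) + f' (-x) = f x + f' x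
      rw [h, h']
  zero_mem' := by
    refine ⟨?_, fun x => rfl⟩
    change (1 / (2 * π)) * ∫ a in (0 : ℝ)..(2 * π), (0 : ℝ) = 0
    simp
  smul_mem' := by
    rintro a f ⟨h0, h⟩
    refine ⟨?_, fun x => ?_⟩
    · have : mean (a • f : H1) = a * mean f := by
        unfold mean
        rw [mul_left_comm, ← intervalIntegral.integral_const_mul a]
        rfl
      rw [this, h0, mul_zero]
    · change a * f (-x) = a * f x
      rw [h]

/-- The state space `X = H¹_{per,odd} × H¹_{per,0,even}` of pairs `(θ, γ₁)`. -/
abbrev StateSpace : Type := H1Odd × H1ZeroEven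

/-! ### Principal values, Birkhoff-Rott integral, Hilbert transform -/

/-- Principal value over `ℝ` (both at the singularity `a` and at infinity):
`lim_{ε → 0+, R → ∞} ∫_{ε < |α' - a| < R} f(α') dα'`. -/
def pvLine (f : ℝ → ℂ) (a : ℝ) : ℂ :=
  limUnder (𝓝[>] (0 : ℝ) ×ˢ atTop) fun p : ℝ × ℝ => ∫ x in {x | p.1 < |x - a| ∧ |x - a| < p.2}, f x

/-- Principal value over one period of a `2π`-periodic integrand with singularity at `a`; by
periodicity the period is centred at the singularity. -/
def pvPeriod (f : ℝ → ℝ) (a : ℝ) : ℝ :=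
  limUnder (𝓝[>] (0 : ℝ)) fun ε => ∫ x in {x | ε < |x - a| ∧ |x - a| ≤ π}, f x

/-- The Birkhoff-Rott integral `B[w]γ`. -/
def birkhoffRott (w : ℝ → ℂ) (γ : ℝ → ℝ) (α : ℝ) : ℂ :=
  1 / (2 * π * Complex.I) * pvLine (fun α' => (γ α' : ℂ) / (w α - w α')) α

/-- The periodic Hilbert transform `H`. -/
def hilbert (γ : ℝ → ℝ) (α : ℝ) : ℝ :=
  1 / (2 * π) * pvPeriod (fun α' => γ α' * Real.cot (1 / 2 * (α - α'))) α

/-- The remainder `K[w]γ = B[w]γ - Hγ / (2 i w_α)`. -/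
def remainder (w : ℝ → ℂ) (γ : ℝ → ℝ) (α : ℝ) : ℂ :=
  birkhoffRott w γ α - 1 / (2 * Complex.I * deriv w α) * (hilbert γ α : ℂ)

/-! ### The renormalized curve and the maps `Θ`, `Γ` -/

/-- The renormalized curve `Z̃[θ]` with period `M`. -/
def curve (M : ℝ) (θ : ℝ → ℝ) (α : ℝ) : ℂ :=
  (M / (2 * π * mean (fun a => Real.cos (θ a))) : ℝ) *
    ((∫ β in (0 : ℝ)..α, Complex.exp (Complex.I * θ β)) -
      Complex.I * α * (mean (fun a => Real.sin (θ a)) : ℝ))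

/-- The tangent `T̃[θ]`. -/
def tangent (M : ℝ) (θ : ℝ → ℝ) (α : ℝ) : ℂ :=
  deriv (curve M θ) α / (‖deriv (curve M θ) α‖ : ℝ)

/-- The normal `Ñ[θ]`. -/
def normal (M : ℝ) (θ : ℝ → ℝ) (α : ℝ) : ℂ :=
  Complex.I * deriv (curve M θ) α / (‖deriv (curve M θ) α‖ : ℝ)

/-- `c cos θ - Re(B[Z̃[θ]]γ T̃[θ])`. -/
def relTangentialVelocity (M : ℝ) (θ γ : ℝ → ℝ) (c : ℝ) (α : ℝ) : ℝ :=
  c * Real.cos (θ α) - (birkhoffRott (curve M θ) γ α * tangent M θ α).re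

/-- `Φ̃(θ, γ; c)`. -/
def PhiTilde (M τ A g : ℝ) (θ γ : ℝ → ℝ) (c : ℝ) (α : ℝ) : ℝ :=
  1 / τ * deriv (fun a => relTangentialVelocity M θ γ c a * γ a) α -
    A / τ *
      (π * mean (fun a => Real.cos (θ a)) / (2 * M) * deriv (fun a => γ a ^ 2) α +
        g * M / (π * mean (fun a => Real.cos (θ a))) *
          (Real.sin (θ α) - mean (fun a => Real.sin (θ a))) +
        M / (2 * π * mean (fun a => Real.cos (θ a))) *
          deriv (fun a => relTangentialVelocity M θ γ c a ^ 2) α)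

/-- The inverse `∂_α⁻²` of the second derivative on mean-zero functions. -/
def invSecondDeriv (f : ℝ → ℝ) (α : ℝ) : ℝ :=
  (∫ a in (0 : ℝ)..α, ∫ s in (0 : ℝ)..a, f s) -
    α / (2 * π) * ∫ a in (0 : ℝ)..(2 * π), ∫ s in (0 : ℝ)..a, f s

/-- `Θ(θ, γ₁; c)`; `γbar` is the prescribed mean of the vortex sheet strength. -/
def Theta (M τ A g γbar : ℝ) (θ γ₁ : ℝ → ℝ) (c : ℝ) (α : ℝ) : ℝ :=
  -invSecondDeriv (PhiTilde M τ A g θ (fun a => γbar + γ₁ a) c) α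

/-- `Γ(θ, γ₁; c)`. -/
def Gamma (M τ A g γbar : ℝ) (θ γ₁ : ℝ → ℝ) (c : ℝ) : ℝ → ℝ :=
  let Th : ℝ → ℝ := Theta M τ A g γbar θ γ₁ c
  fun α => 2 * hilbert (fun a =>
    ‖deriv (curve M Th) a‖ *
        (remainder (curve M Th) (fun b => γbar + γ₁ b) a * normal M Th a).re +
      c * ‖deriv (curve M Th) a‖ * Real.sin (Th a)) α

/-- `f` is (the function underlying) an element of the subspace `V` of `H¹_per`. -/
def IsIn (V : Submodule ℝ H1) (f : ℝ → ℝ) : Prop := ∃ u : V, (u.1 : ℝ → ℝ) = f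

open Classical in
/-- The element of `V` with underlying function `f` (and `0` when there is none). -/
def toSubspace (V : Submodule ℝ H1) (f : ℝ → ℝ) : V :=
  if h : IsIn V f then h.choose else 0

/-- The map `(θ, γ₁) ↦ (θ - Θ(θ, γ₁; c), γ₁ - Γ(θ, γ₁; c))`. -/
def travelingWaveMap (M τ A g γbar c : ℝ) (ξ : StateSpace) : StateSpace :=
  ξ - (toSubspace H1Odd (Theta M τ A g γbar ξ.1.1 ξ.2.1 c),
    toSubspace H1ZeroEven (Gamma M τ A g γbar ξ.1.1 ξ.2.1 c))

/-! ### Spectral data -/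

/-- `λ_k(c)`. -/
def lam (M τ A g γbar c : ℝ) (k : ℕ+) : ℝ :=
  1 + (2 * γbar * c * A * M * π - M ^ 2 * c ^ 2 - γbar ^ 2 * π ^ 2) / (M * π * τ) * (k : ℝ)⁻¹ +
    g * A * M / (π * τ) * ((k : ℝ) ^ 2)⁻¹

/-- Smooth `2π`-periodic functions belong to `H¹_per`. -/
theorem mem_H1Functions {f : ℝ → ℝ} (hp : Function.Periodic f (2 * π)) (hf : ContDiff ℝ 1 f) :
    f ∈ H1Functions :=
  ⟨hp, hf.contDiffOn.absolutelyContinuousOnInterval,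
    memLp_of_continuousOn (hf.continuous_deriv le_rfl).continuousOn⟩

/-- `α ↦ r sin(kα)` as an element of `H¹_{per,odd}`. -/
def sinMode (r : ℝ) (k : ℕ+) : H1Odd :=
  ⟨(⟨fun α => r * Real.sin (k * α), mem_H1Functions (fun x => by
      rw [mul_add]
      congr 1
      exact_mod_cast Real.sin_add_nat_mul_two_pi (k * x) k) (by fun_prop)⟩ : H1Functions),
    fun x => by
      change r * Real.sin (k * -x) = -(r * Real.sin (k * x))
      rw [mul_neg, Real.sin_neg, mul_neg]⟩

/-- `α ↦ cos(kα)` as an element of `H¹_{per,0,even}`. -/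
def cosMode (k : ℕ+) : H1ZeroEven :=
  ⟨(⟨fun α => Real.cos (k * α), mem_H1Functions (fun x => by
      rw [mul_add]
      exact_mod_cast Real.cos_add_nat_mul_two_pi (k * x) k) (by fun_prop)⟩ : H1Functions), by
    refine ⟨?_, fun x => ?_⟩
    · change (1 / (2 * π)) * ∫ a in (0 : ℝ)..(2 * π), Real.cos (k * a) = 0
      have hk : ((k : ℕ) : ℝ) ≠ 0 := by exact_mod_cast k.ne_zero
      rw [intervalIntegral.integral_comp_mul_left (fun a => Real.cos a) hk, integral_cos]
      have : Real.sin (k * (2 * π)) = 0 := by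
        have := Real.sin_nat_mul_pi (2 * k)
        push_cast at this
        rw [← this]; ring_nf
      simp [this]
    · change Real.cos (k * -x) = Real.cos (k * x)
      rw [mul_neg, Real.cos_neg]⟩

/-- The vector `(-(π / (cM)) sin kα, cos kα)` of the state space. -/
def eigenvector (M c : ℝ) (k : ℕ+) : StateSpace := (sinMode (-(π / (c * M))) k, cosMode k)

/-- The complexification of a bounded real-linear operator on the state space, as an endomorphism
of `ℂ ⊗ X`. As `X` is a Banach space, bijectivity of `λ - L` already gives a bounded inverse, so
the spectrum of this endomorphism is the spectrum of the bounded operator. -/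
def complexify (L : StateSpace →L[ℝ] StateSpace) : Module.End ℂ (ℂ ⊗[ℝ] StateSpace) :=
  (L : StateSpace →ₗ[ℝ] StateSpace).baseChange ℂ

end VortexSheet

end

/-!
The derivative of `(θ, γ₁) ↦ (θ - Θ, γ₁ - Γ)` at the flat sheet is computed first; it has the form
`1 - S T`, and its spectrum away from `1` is read off from the diagonal operator `T S`.

*The velocity as a map on `H¹_per`.* For odd `θ` the mean of `sin θ` vanishes, and the renormalized
curve is a multiple of a curve `ζ` (`unitCurve`) with `ζ' = e^{iθ} / mean (cos θ)` and
`ζ(α + 2π) = ζ(α) + 2π`. The Mittag-Leffler expansion of the cotangent folds the Birkhoff-Rott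
principal value over the line onto one period. The kernel `ζ'(x) cot((ζ(α) - ζ(x))/2)` obtained in
this way differs from that of the flat sheet by a derivative of the logarithm of
`sin((ζ(x) - ζ(α))/2) / sin((x - α)/2)`. Integrating by parts, the singular integral is the Hilbert
transform plus the logarithmic potential `(1/π) ∫ f'(x) log(…) dx`
(`IsCurve.tendsto_birkhoffRott`). Since `H¹_per` embeds into `C^{1/2}`, the kernel of the
derivative of this potential is at most `‖θ‖ |sin((s - x)/2)|^{-1/2}` up to a constant, and Schur's
test bounds the `H¹` norm of the potential by `‖θ‖ ‖f - const‖` (`IsCurve.logPotential_mem`). No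
differentiability in `θ` of the singular integral is needed: at `θ = 0` and constant vortex sheet
strength, the potential is of second order (`hasFDerivAt_potential`). The same analysis shows that
the principal values in `Θ` and `Γ` converge, so that near the origin these are maps between
Sobolev spaces (`Theta_eq`, `Gamma_eq`); parity follows from `ζ(-α) = -conj ζ(α)`.

*The linearization.* By the product rule `Θ` has the derivative
`T (θ, γ₁) = p ∂⁻¹ H θ + q ∂⁻¹ γ₁ + r ∂⁻² θ` with explicit real `p`, `q`, `r`. In `Γ` the terms
linear in the vortex sheet strength cancel, and the derivative is `(cM/π) H T`. With
`S φ = (φ, (cM/π) H φ)` this gives `L_c = 1 - S T` (`hasFDerivAt_travelingWaveMap`).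

*The spectrum.* On odd functions `T S` is the Fourier multiplier that multiplies `sin kα` by
`1 - λ_k(c)`, and these numbers tend to `0` (`isDiagonal_reduced`). Away from `0` the operators
`S T` and `T S` have the same spectrum, and `S` maps the eigenspaces of `T S` bijectively onto
those of `S T`; diagonality excludes generalized eigenvectors (`IsDiagonal.eigenspace_eq`,
`IsDiagonal.maxGenEigenspace_eq`, `IsDiagonal.notMem_spectrum`). Finally `1` is an eigenvalue
because `T` has a nontrivial kernel already on the first mode (`hasEigenvalue_one`).
-/

noncomputable section

namespace VortexSheet

/-! ### Calculus in `H¹_per` -/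

theorem two_pi_nonneg : (0 : ℝ) ≤ 2 * π := by positivity

namespace H1

@[simp] theorem add_apply (f f' : H1) (x : ℝ) : (f + f' : H1) x = f x + f' x := rfl
@[simp] theorem sub_apply (f f' : H1) (x : ℝ) : (f - f' : H1) x = f x - f' x := rfl
@[simp] theorem neg_apply (f : H1) (x : ℝ) : (-f : H1) x = -f x := rfl
@[simp] theorem smul_apply (a : ℝ) (f : H1) (x : ℝ) : (a • f : H1) x = a * f x := rfl
@[simp] theorem zero_apply (x : ℝ) : (0 : H1) x = 0 := rfl

theorem ext {f f' : H1} (h : ∀ x, f x = f' x) : f = f' := Subtype.ext (funext h)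

theorem periodic (f : H1) : Function.Periodic f (2 * π) := f.2.1

theorem absolutelyContinuous (f : H1) : AbsolutelyContinuousOnInterval f 0 (2 * π) := f.2.2.1

theorem deriv_periodic (f : H1) : Function.Periodic (deriv f) (2 * π) := fun x => by
  rw [← deriv_comp_add_const]
  congr 1
  funext y
  exact f.periodic y

theorem intervalIntegrable_deriv (f : H1) (a b : ℝ) : IntervalIntegrable (deriv f) volume a b :=
  f.deriv_periodic.intervalIntegrable₀ Real.two_pi_pos.ne'
    f.absolutelyContinuous.intervalIntegrable_deriv a b

theorem integral_deriv_period (f : H1) : ∫ x in (0 : ℝ)..(2 * π), deriv f x = 0 := by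
  rw [f.absolutelyContinuous.integral_deriv_eq_sub]
  have := f.periodic 0
  simp only [zero_add] at this
  rw [this, sub_self]

/-- The fundamental theorem of calculus, first on one period and then by periodicity everywhere. -/
theorem apply_eq_add_integral (f : H1) (x : ℝ) : f x = f 0 + ∫ t in (0 : ℝ)..x, deriv f t := by
  have h1 (y : ℝ) (hy : y ∈ Icc 0 (2 * π)) : f y = f 0 + ∫ t in (0 : ℝ)..y, deriv f t := by
    have hsub : uIcc 0 y ⊆ uIcc 0 (2 * π) := by
      rw [uIcc_of_le hy.1, uIcc_of_le two_pi_nonneg]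
      exact Icc_subset_Icc_right hy.2
    rw [(f.absolutelyContinuous.mono hsub).integral_deriv_eq_sub]
    ring
  have hper : Function.Periodic (fun y => f y - ∫ t in (0 : ℝ)..y, deriv f t) (2 * π) := fun y => by
    have h3 := f.deriv_periodic.intervalIntegral_add_eq y 0
    rw [zero_add, f.integral_deriv_period] at h3
    have h2 : ∫ t in (0 : ℝ)..(y + 2 * π), deriv f t = ∫ t in (0 : ℝ)..y, deriv f t := by
      rw [← intervalIntegral.integral_add_adjacent_intervals
        (f.intervalIntegrable_deriv 0 y) (f.intervalIntegrable_deriv y (y + 2 * π)), h3, add_zero]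
    simp only [h2, f.periodic y]
  obtain ⟨y, hy, hxy⟩ := hper.exists_mem_Ico₀ Real.two_pi_pos x
  have := h1 y (Ico_subset_Icc_self hy)
  linarith

theorem integral_deriv (f : H1) (a b : ℝ) : ∫ x in a..b, deriv f x = f b - f a := by
  rw [f.apply_eq_add_integral b, f.apply_eq_add_integral a,
    ← intervalIntegral.integral_add_adjacent_intervals
      (f.intervalIntegrable_deriv 0 a) (f.intervalIntegrable_deriv a b)]
  ring

theorem absolutelyContinuousOn (f : H1) (a b : ℝ) : AbsolutelyContinuousOnInterval f a b := by
  have h := (f.intervalIntegrable_deriv a b).absolutelyContinuousOnInterval_intervalIntegral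
    (c := a) left_mem_uIcc
  have h2 : AbsolutelyContinuousOnInterval (fun _ : ℝ => f a) a b :=
    (contDiff_const (n := 1)).contDiffOn.absolutelyContinuousOnInterval
  have h3 : (f : ℝ → ℝ) = (fun _ => f a) + fun x => ∫ v in a..x, deriv f v := by
    funext x
    change f x = f a + ∫ v in a..x, deriv f v
    rw [f.integral_deriv]
    ring
  rw [h3]
  exact h2.add h

theorem continuous (f : H1) : Continuous f := by
  have h : (f : ℝ → ℝ) = fun x => f 0 + ∫ t in (0 : ℝ)..x, deriv f t :=
    funext f.apply_eq_add_integral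
  rw [h]
  exact continuous_const.add
    (intervalIntegral.continuous_primitive (fun a b => f.intervalIntegrable_deriv a b) 0)

theorem ae_differentiableAt (f : H1) : ∀ᵐ x ∂perMeasure, DifferentiableAt ℝ f x := by
  rw [ae_restrict_iff' measurableSet_Ioc]
  filter_upwards [f.absolutelyContinuous.ae_differentiableAt] with x hx hx'
  exact hx (by rw [uIcc_of_le two_pi_nonneg]; exact Ioc_subset_Icc_self hx')

theorem ae_hasDerivAt (f : H1) : ∀ᵐ x ∂perMeasure, HasDerivAt f (deriv f x) x := by
  filter_upwards [f.ae_differentiableAt] with x hx using hx.hasDerivAt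

end H1

/-- A periodic function that is, on a period, a primitive of a square integrable function `φ`
belongs to `H¹_per`, and its derivative is `φ` almost everywhere. -/
theorem mem_H1Functions_of_primitive {f φ : ℝ → ℝ} (hp : Function.Periodic f (2 * π))
    (hφ : MemLp φ 2 perMeasure)
    (h : ∀ x ∈ Icc (0 : ℝ) (2 * π), f x = f 0 + ∫ t in (0 : ℝ)..x, φ t) :
    f ∈ H1Functions ∧ deriv f =ᵐ[perMeasure] φ := by
  have hint : IntervalIntegrable φ volume 0 (2 * π) := by
    rw [intervalIntegrable_iff_integrableOn_Ioc_of_le two_pi_nonneg]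
    exact hφ.integrable one_le_two
  have hac : AbsolutelyContinuousOnInterval f 0 (2 * π) := by
    have h1 := hint.absolutelyContinuousOnInterval_intervalIntegral (c := 0) left_mem_uIcc
    have h2 : AbsolutelyContinuousOnInterval (fun _ : ℝ => f 0) 0 (2 * π) :=
      (contDiff_const (n := 1)).contDiffOn.absolutelyContinuousOnInterval
    have h3 := h2.add h1
    rw [absolutelyContinuousOnInterval_iff] at h3 ⊢
    intro ε hε
    obtain ⟨δ, hδ, H⟩ := h3 ε hε
    refine ⟨δ, hδ, fun E hE hs => ?_⟩
    refine lt_of_eq_of_lt (Finset.sum_congr rfl fun i hi => ?_) (H E hE hs)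
    have hmem := hE.1 i hi
    rw [uIcc_of_le two_pi_nonneg] at hmem
    rw [h _ hmem.1, h _ hmem.2]
    simp
  have hae : deriv f =ᵐ[perMeasure] φ := by
    rw [Filter.EventuallyEq, perMeasure, ← Measure.restrict_congr_set Ioo_ae_eq_Ioc,
      ae_restrict_iff' measurableSet_Ioo]
    filter_upwards [hint.ae_hasDerivAt_integral] with x hx hx'
    have hxI : x ∈ uIcc 0 (2 * π) := by
      rw [uIcc_of_le two_pi_nonneg]; exact Ioo_subset_Icc_self hx'
    have h1 := (hx hxI 0 left_mem_uIcc).const_add (f 0)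
    refine (h1.congr_of_eventuallyEq ?_).deriv
    filter_upwards [isOpen_Ioo.mem_nhds hx'] with y hy
    exact h y (Ioo_subset_Icc_self hy)
  exact ⟨⟨hp, hac, (memLp_congr_ae hae).2 hφ⟩, hae⟩

/-- Absolute continuity is preserved by Lipschitz maps. -/
theorem absolutelyContinuous_lipschitz_comp {g f : ℝ → ℝ} {K : NNReal} (hg : LipschitzWith K g)
    {a b : ℝ} (hf : AbsolutelyContinuousOnInterval f a b) :
    AbsolutelyContinuousOnInterval (fun x => g (f x)) a b := by
  rw [absolutelyContinuousOnInterval_iff] at hf ⊢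
  intro ε hε
  obtain ⟨δ, hδ, H⟩ := hf (ε / (K + 1)) (by positivity)
  refine ⟨δ, hδ, fun E hE hs => ?_⟩
  have h1 := H E hE hs
  calc ∑ i ∈ Finset.range E.1, dist (g (f (E.2 i).1)) (g (f (E.2 i).2))
      ≤ ∑ i ∈ Finset.range E.1, (K + 1) * dist (f (E.2 i).1) (f (E.2 i).2) := by
        refine Finset.sum_le_sum fun i _ => (hg.dist_le_mul _ _).trans ?_
        gcongr
        linarith
    _ = (K + 1) * ∑ i ∈ Finset.range E.1, dist (f (E.2 i).1) (f (E.2 i).2) := by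
        rw [Finset.mul_sum]
    _ < (K + 1) * (ε / (K + 1)) := by gcongr
    _ = ε := by field_simp

namespace H1

/-- The squared `L²` norm of the derivative over one period. -/
def energy (f : H1) : ℝ := ∫ x in (0 : ℝ)..(2 * π), deriv f x ^ 2

theorem energy_nonneg (f : H1) : 0 ≤ f.energy :=
  intervalIntegral.integral_nonneg two_pi_nonneg fun _ _ => sq_nonneg _

theorem norm_toLp_sq {φ : ℝ → ℝ} (h : MemLp φ 2 perMeasure) :
    ‖h.toLp φ‖ ^ 2 = ∫ x in (0 : ℝ)..(2 * π), φ x ^ 2 := by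
  rw [← real_inner_self_eq_norm_sq, L2.inner_def,
    intervalIntegral.integral_of_le two_pi_nonneg]
  refine integral_congr_ae ?_
  filter_upwards [h.coeFn_toLp] with x hx
  rw [hx]
  simp [sq]

theorem norm_sq (f : H1) : ‖f‖ ^ 2 = (∫ x in (0 : ℝ)..(2 * π), f x ^ 2) + f.energy := by
  have h : ‖f‖ = ‖H1.toL2 f‖ := rfl
  rw [h, WithLp.prod_norm_sq_eq_of_L2]
  congr 1
  · exact norm_toLp_sq f.memLp
  · exact norm_toLp_sq f.memLp_deriv

theorem energy_le (f : H1) : f.energy ≤ ‖f‖ ^ 2 := by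
  rw [norm_sq]
  have : 0 ≤ ∫ x in (0 : ℝ)..(2 * π), f x ^ 2 :=
    intervalIntegral.integral_nonneg two_pi_nonneg fun _ _ => sq_nonneg _
  linarith

theorem intervalIntegrable_deriv_sq (f : H1) (a b : ℝ) :
    IntervalIntegrable (fun x => deriv f x ^ 2) volume a b := by
  refine Function.Periodic.intervalIntegrable₀ (T := 2 * π) (fun x => ?_) Real.two_pi_pos.ne' ?_ a b
  · simp only [f.deriv_periodic x]
  · rw [intervalIntegrable_iff_integrableOn_Ioc_of_le two_pi_nonneg]
    exact f.memLp_deriv.integrable_sq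

theorem integral_deriv_sq_le (f : H1) {a b : ℝ} (hab : a ≤ b) (hb : b ≤ a + 2 * π) :
    ∫ x in a..b, deriv f x ^ 2 ≤ f.energy := by
  have hper : Function.Periodic (fun x => deriv f x ^ 2) (2 * π) := fun x => by
    simp only [f.deriv_periodic x]
  have h1 := hper.intervalIntegral_add_eq a 0
  rw [zero_add] at h1
  rw [energy, ← h1]
  exact intervalIntegral.integral_mono_interval le_rfl hab hb
    (Eventually.of_forall fun _ => sq_nonneg _) (f.intervalIntegrable_deriv_sq _ _)

end H1

/-- Cauchy-Schwarz against the constant `1`. -/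
theorem sq_integral_le {φ : ℝ → ℝ} {a b : ℝ} (hab : a ≤ b) (h1 : IntervalIntegrable φ volume a b)
    (h2 : IntervalIntegrable (fun x => φ x ^ 2) volume a b) :
    (∫ x in a..b, φ x) ^ 2 ≤ (b - a) * ∫ x in a..b, φ x ^ 2 := by
  rcases hab.eq_or_lt with rfl | hlt
  · simp
  set I := ∫ x in a..b, φ x
  have hpos : 0 < b - a := sub_pos.2 hlt
  have h0 : 0 ≤ ∫ x in a..b, (φ x - I / (b - a)) ^ 2 :=
    intervalIntegral.integral_nonneg hab fun _ _ => sq_nonneg _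
  have he : ∫ x in a..b, (φ x - I / (b - a)) ^ 2
      = (∫ x in a..b, φ x ^ 2) - 2 * (I / (b - a)) * I + (b - a) * (I / (b - a)) ^ 2 := by
    have : (fun x => (φ x - I / (b - a)) ^ 2) =
        fun x => φ x ^ 2 - 2 * (I / (b - a)) * φ x + (I / (b - a)) ^ 2 := by
      funext x; ring
    rw [this, intervalIntegral.integral_add (h2.sub (h1.const_mul _)) (by simp),
      intervalIntegral.integral_sub h2 (h1.const_mul _), intervalIntegral.integral_const_mul]
    simp [I]
  rw [he] at h0
  have h3 : (b - a) * (I / (b - a)) ^ 2 = I ^ 2 / (b - a) := by field_simp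
  have h4 : 2 * (I / (b - a)) * I = 2 * (I ^ 2 / (b - a)) := by ring
  rw [h3, h4] at h0
  have h5 : I ^ 2 / (b - a) ≤ ∫ x in a..b, φ x ^ 2 := by linarith
  rw [div_le_iff₀ hpos] at h5
  linarith

namespace H1

/-- Hölder continuity of exponent `1/2`. -/
theorem sq_sub_le (f : H1) {a b : ℝ} (hab : |b - a| ≤ 2 * π) :
    (f b - f a) ^ 2 ≤ |b - a| * f.energy := by
  wlog h : a ≤ b generalizing a b
  · have := this (a := b) (b := a) (by rwa [abs_sub_comm]) (le_of_not_ge h)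
    rw [abs_sub_comm, ← neg_sq, neg_sub]
    exact this
  rw [abs_of_nonneg (sub_nonneg.2 h)] at hab ⊢
  rw [← f.integral_deriv a b]
  refine (sq_integral_le h (f.intervalIntegrable_deriv _ _)
    (f.intervalIntegrable_deriv_sq _ _)).trans ?_
  exact mul_le_mul_of_nonneg_left (f.integral_deriv_sq_le h (by linarith)) (by linarith)

theorem exists_Icc (f : H1) (x : ℝ) : ∃ y ∈ Icc (0 : ℝ) (2 * π), f x = f y := by
  obtain ⟨y, hy, h⟩ := f.periodic.exists_mem_Ico₀ Real.two_pi_pos x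
  exact ⟨y, Ico_subset_Icc_self hy, h⟩

/-- The Sobolev embedding `H¹_per ⊂ L^∞`. -/
theorem abs_apply_le (f : H1) (x : ℝ) : |f x| ≤ 4 * ‖f‖ := by
  obtain ⟨y, hy, hxy⟩ := f.exists_Icc x
  rw [hxy]
  have hpi := Real.pi_gt_three
  have hpi4 := Real.pi_lt_four
  have h1 (t : ℝ) (ht : t ∈ Icc (0 : ℝ) (2 * π)) : f y ^ 2 ≤ 2 * f t ^ 2 + 16 * f.energy := by
    have h2 : |y - t| ≤ 2 * π := by
      rw [abs_le]; constructor <;> linarith [hy.1, hy.2, ht.1, ht.2]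
    have h3 := f.sq_sub_le h2
    have h4 : |y - t| * f.energy ≤ 8 * f.energy :=
      mul_le_mul_of_nonneg_right (by linarith) f.energy_nonneg
    nlinarith [sq_nonneg (f y - 2 * f t)]
  have h2 : ∫ t in (0 : ℝ)..(2 * π), f y ^ 2 ≤
      ∫ t in (0 : ℝ)..(2 * π), (2 * f t ^ 2 + 16 * f.energy) :=
    intervalIntegral.integral_mono_on two_pi_nonneg (by simp)
      (Continuous.intervalIntegrable (by have := f.continuous; fun_prop) _ _) h1
  rw [intervalIntegral.integral_add
    (Continuous.intervalIntegrable (by have := f.continuous; fun_prop) _ _) (by simp),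
    intervalIntegral.integral_const_mul] at h2
  simp only [intervalIntegral.integral_const, sub_zero, smul_eq_mul] at h2
  have h3 := f.norm_sq
  have h0 : 0 ≤ ∫ t in (0 : ℝ)..(2 * π), f t ^ 2 :=
    intervalIntegral.integral_nonneg two_pi_nonneg fun _ _ => sq_nonneg _
  have h4 : f y ^ 2 ≤ (4 * ‖f‖) ^ 2 := by
    have h5 := f.energy_nonneg
    have h6 : 6 * f y ^ 2 ≤ 2 * π * f y ^ 2 := by nlinarith [sq_nonneg (f y)]
    have h7 : 2 * π * f y ^ 2 ≤
        2 * (∫ t in (0 : ℝ)..(2 * π), f t ^ 2) + 2 * π * (16 * f.energy) := h2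
    nlinarith [sq_nonneg (f y)]
  exact abs_le_of_sq_le_sq h4 (by positivity)

/-- The `H¹` norm is controlled by the supremum norm and the energy. -/
theorem norm_le_of_bound (f : H1) {A B : ℝ} (hA : 0 ≤ A) (hB : 0 ≤ B) (h : ∀ x, |f x| ≤ A)
    (he : f.energy ≤ B ^ 2) : ‖f‖ ≤ 3 * A + B := by
  have hpi4 := Real.pi_lt_four
  have h1 : ∫ x in (0 : ℝ)..(2 * π), f x ^ 2 ≤ ∫ x in (0 : ℝ)..(2 * π), A ^ 2 :=
    intervalIntegral.integral_mono_on two_pi_nonneg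
      (Continuous.intervalIntegrable (by have := f.continuous; fun_prop) _ _) (by simp)
      fun x _ => sq_le_sq' (abs_le.1 (h x)).1 (abs_le.1 (h x)).2
  simp only [intervalIntegral.integral_const, sub_zero, smul_eq_mul] at h1
  have h2 : ‖f‖ ^ 2 ≤ (3 * A + B) ^ 2 := by
    rw [f.norm_sq]
    nlinarith [mul_nonneg hA hB, sq_nonneg A, mul_nonneg (sub_nonneg.2 hpi4.le) (sq_nonneg A)]
  exact le_of_sq_le_sq h2 (by positivity)

end H1

/-! ### Operations on `H¹_per` -/

namespace H1

/-- The element of `H¹_per` with a given underlying function. -/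
def mk (f : ℝ → ℝ) (hf : f ∈ H1Functions) : H1 := ⟨f, hf⟩

@[simp] theorem mk_apply {f : ℝ → ℝ} (hf : f ∈ H1Functions) (x : ℝ) : mk f hf x = f x := rfl

theorem energy_congr (f : H1) {φ : ℝ → ℝ} (h : deriv f =ᵐ[perMeasure] φ) :
    f.energy = ∫ x in (0 : ℝ)..(2 * π), φ x ^ 2 := by
  rw [energy, intervalIntegral.integral_of_le two_pi_nonneg,
    intervalIntegral.integral_of_le two_pi_nonneg]
  refine integral_congr_ae ?_
  filter_upwards [h] with x hx
  rw [hx]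

theorem memLp_bdd_mul_deriv (f : H1) {b : ℝ → ℝ} (hb : Continuous b) :
    MemLp (fun x => b x * deriv f x) 2 perMeasure := by
  obtain ⟨C, hC⟩ := (isCompact_Icc (a := (0 : ℝ)) (b := 2 * π)).exists_bound_of_continuousOn
    hb.continuousOn
  refine (f.memLp_deriv.const_mul C).mono
    (hb.aestronglyMeasurable.mul f.memLp_deriv.aestronglyMeasurable) ?_
  filter_upwards [ae_restrict_mem measurableSet_Ioc] with x hx
  rw [norm_mul, norm_mul]
  gcongr
  exact (hC x (Ioc_subset_Icc_self hx)).trans (le_abs_self C)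

/-- Energy bound for an element whose derivative is a bounded multiple of another derivative. -/
theorem energy_le_of_deriv_eq_mul (f u : H1) {b : ℝ → ℝ} (hb : Continuous b) {B : ℝ}
    (hB : ∀ x, |b x| ≤ B) (h : deriv u =ᵐ[perMeasure] fun x => b x * deriv f x) :
    u.energy ≤ (B * ‖f‖) ^ 2 := by
  rw [u.energy_congr h]
  have h1 : IntervalIntegrable (fun x => (b x * deriv f x) ^ 2) volume 0 (2 * π) := by
    rw [intervalIntegrable_iff_integrableOn_Ioc_of_le two_pi_nonneg]
    exact (f.memLp_bdd_mul_deriv hb).integrable_sq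
  calc ∫ x in (0 : ℝ)..(2 * π), (b x * deriv f x) ^ 2
      ≤ ∫ x in (0 : ℝ)..(2 * π), B ^ 2 * deriv f x ^ 2 := by
        refine intervalIntegral.integral_mono_on two_pi_nonneg h1
          ((f.intervalIntegrable_deriv_sq _ _).const_mul _) fun x _ => ?_
        rw [mul_pow]
        exact mul_le_mul_of_nonneg_right (sq_le_sq' (abs_le.1 (hB x)).1 (abs_le.1 (hB x)).2)
          (sq_nonneg _)
    _ = B ^ 2 * f.energy := by rw [intervalIntegral.integral_const_mul]; rfl
    _ ≤ (B * ‖f‖) ^ 2 := by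
        rw [mul_pow]
        exact mul_le_mul_of_nonneg_left f.energy_le (sq_nonneg _)

theorem mul_mem (f f' : H1) : (fun x => f x * f' x) ∈ H1Functions ∧
    deriv (fun x => f x * f' x) =ᵐ[perMeasure] fun x => f' x * deriv f x + f x * deriv f' x := by
  have hd : deriv (fun x => f x * f' x) =ᵐ[perMeasure]
      fun x => f' x * deriv f x + f x * deriv f' x := by
    filter_upwards [f.ae_hasDerivAt, f'.ae_hasDerivAt] with x h1 h2
    exact (h1.mul h2).deriv.trans (by ring)
  refine ⟨⟨fun x => by simp only [f.periodic x, f'.periodic x],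
    f.absolutelyContinuous.fun_mul f'.absolutelyContinuous, (memLp_congr_ae hd).2 ?_⟩, hd⟩
  exact (f.memLp_bdd_mul_deriv f'.continuous).add (f'.memLp_bdd_mul_deriv f.continuous)

/-- The pointwise product in `H¹_per`. -/
def mul (f f' : H1) : H1 := mk _ (mul_mem f f').1

theorem mul_apply (f f' : H1) (x : ℝ) : mul f f' x = f x * f' x := rfl

theorem norm_mul_le (f f' : H1) : ‖mul f f'‖ ≤ 56 * ‖f‖ * ‖f'‖ := by
  have hsq (b u : H1) : ∫ x in (0 : ℝ)..(2 * π), (b x * deriv u x) ^ 2 ≤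
      (4 * ‖b‖ * ‖u‖) ^ 2 := by
    calc ∫ x in (0 : ℝ)..(2 * π), (b x * deriv u x) ^ 2
        ≤ ∫ x in (0 : ℝ)..(2 * π), (4 * ‖b‖) ^ 2 * deriv u x ^ 2 := by
          refine intervalIntegral.integral_mono_on two_pi_nonneg ?_
            ((u.intervalIntegrable_deriv_sq _ _).const_mul _) fun x _ => ?_
          · rw [intervalIntegrable_iff_integrableOn_Ioc_of_le two_pi_nonneg]
            exact (u.memLp_bdd_mul_deriv b.continuous).integrable_sq
          · rw [mul_pow]
            have := abs_le.1 (b.abs_apply_le x)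
            exact mul_le_mul_of_nonneg_right (sq_le_sq' this.1 this.2) (sq_nonneg _)
      _ = (4 * ‖b‖) ^ 2 * u.energy := by rw [intervalIntegral.integral_const_mul]; rfl
      _ ≤ (4 * ‖b‖ * ‖u‖) ^ 2 := by
          rw [mul_pow _ ‖u‖]
          exact mul_le_mul_of_nonneg_left u.energy_le (sq_nonneg _)
  have hint (b u : H1) :
      IntervalIntegrable (fun x => 2 * (b x * deriv u x) ^ 2) volume 0 (2 * π) := by
    rw [intervalIntegrable_iff_integrableOn_Ioc_of_le two_pi_nonneg]
    exact (u.memLp_bdd_mul_deriv b.continuous).integrable_sq.const_mul 2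
  have he : (mul f f').energy ≤ (8 * ‖f‖ * ‖f'‖) ^ 2 := by
    rw [(mul f f').energy_congr (mul_mem f f').2]
    calc ∫ x in (0 : ℝ)..(2 * π), (f' x * deriv f x + f x * deriv f' x) ^ 2
        ≤ ∫ x in (0 : ℝ)..(2 * π), (2 * (f' x * deriv f x) ^ 2 + 2 * (f x * deriv f' x) ^ 2) := by
          refine intervalIntegral.integral_mono_on two_pi_nonneg ?_
            ((hint f' f).add (hint f f')) fun x _ => ?_
          · rw [intervalIntegrable_iff_integrableOn_Ioc_of_le two_pi_nonneg]
            exact ((f.memLp_bdd_mul_deriv f'.continuous).add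
              (f'.memLp_bdd_mul_deriv f.continuous)).integrable_sq
          · nlinarith [sq_nonneg (f' x * deriv f x - f x * deriv f' x)]
      _ = 2 * (∫ x in (0 : ℝ)..(2 * π), (f' x * deriv f x) ^ 2) +
          2 * ∫ x in (0 : ℝ)..(2 * π), (f x * deriv f' x) ^ 2 := by
          rw [intervalIntegral.integral_add (hint f' f) (hint f f'),
            intervalIntegral.integral_const_mul, intervalIntegral.integral_const_mul]
      _ ≤ (8 * ‖f‖ * ‖f'‖) ^ 2 := by nlinarith [hsq f' f, hsq f f']
  refine ((mul f f').norm_le_of_bound (A := 16 * ‖f‖ * ‖f'‖) (by positivity) (by positivity)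
    (fun x => ?_) he).trans (le_of_eq (by ring))
  rw [mul_apply, abs_mul]
  calc |f x| * |f' x| ≤ (4 * ‖f‖) * (4 * ‖f'‖) :=
        mul_le_mul (f.abs_apply_le x) (f'.abs_apply_le x) (abs_nonneg _) (by positivity)
    _ = _ := by ring

/-- Multiplication as a bounded bilinear map. -/
def mulL : H1 →L[ℝ] H1 →L[ℝ] H1 :=
  LinearMap.mkContinuous₂ (LinearMap.mk₂ ℝ mul
    (fun a b c => H1.ext fun x => by simp only [mul_apply, add_apply]; ring)
    (fun r a b => H1.ext fun x => by simp only [mul_apply, smul_apply]; ring)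
    (fun a b c => H1.ext fun x => by simp only [mul_apply, add_apply]; ring)
    (fun r a b => H1.ext fun x => by simp only [mul_apply, smul_apply]; ring)) 56 norm_mul_le

@[simp] theorem mulL_apply (f f' : H1) (x : ℝ) : mulL f f' x = f x * f' x := rfl

theorem const_mem (a : ℝ) : (fun _ : ℝ => a) ∈ H1Functions :=
  mem_H1Functions (fun _ => rfl) contDiff_const

/-- The constant functions. -/
def const (a : ℝ) : H1 := mk _ (const_mem a)

@[simp] theorem const_apply (a x : ℝ) : const a x = a := rfl

theorem intervalIntegrable (f : H1) (a b : ℝ) : IntervalIntegrable f volume a b :=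
  f.continuous.intervalIntegrable a b

theorem abs_mean_le (f : H1) : |mean f| ≤ 4 * ‖f‖ := by
  have h := intervalIntegral.norm_integral_le_of_norm_le_const (a := 0) (b := 2 * π)
    (f := f) (C := 4 * ‖f‖) fun x _ => f.abs_apply_le x
  rw [sub_zero, abs_of_pos Real.two_pi_pos, Real.norm_eq_abs] at h
  rw [mean, abs_mul, abs_of_pos (by positivity)]
  calc 1 / (2 * π) * |∫ a in (0 : ℝ)..(2 * π), f a| ≤ 1 / (2 * π) * (4 * ‖f‖ * (2 * π)) := by gcongr
    _ = 4 * ‖f‖ := by field_simp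

theorem mean_add (f f' : H1) : mean (f + f' : H1) = mean f + mean f' := by
  unfold mean
  rw [← mul_add, ← intervalIntegral.integral_add (f.intervalIntegrable _ _)
    (f'.intervalIntegrable _ _)]
  rfl

theorem mean_smul (a : ℝ) (f : H1) : mean (a • f : H1) = a * mean f := by
  unfold mean
  rw [mul_left_comm, ← intervalIntegral.integral_const_mul a]
  rfl

/-- The mean as a bounded functional. -/
def meanL : H1 →L[ℝ] ℝ :=
  LinearMap.mkContinuous ⟨⟨fun f => mean f, mean_add⟩, mean_smul⟩ 4 abs_mean_le

theorem mean_const (a : ℝ) : mean (const a) = a := by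
  change 1 / (2 * π) * ∫ _ in (0 : ℝ)..(2 * π), a = a
  simp
  field_simp

/-! #### The primitive `∫₀^α f - α · mean f` -/

theorem primitive_mem (f : H1) :
    (fun α => (∫ a in (0 : ℝ)..α, f a) - α * mean f) ∈ H1Functions ∧
    deriv (fun α => (∫ a in (0 : ℝ)..α, f a) - α * mean f) = fun α => f α - mean f := by
  have hd (x : ℝ) : HasDerivAt (fun α => (∫ a in (0 : ℝ)..α, f a) - α * mean f)
      (f x - mean f) x := by
    have h1 := (f.continuous.integral_hasStrictDerivAt 0 x).hasDerivAt
    have h2 := (hasDerivAt_id x).mul_const (mean f)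
    rw [one_mul] at h2
    exact h1.sub h2
  have hde := funext fun x => (hd x).deriv
  refine ⟨mem_H1Functions (fun x => ?_) ?_, hde⟩
  · have h3 : ∫ a in x..(x + 2 * π), f a = 2 * π * mean f := by
      rw [f.periodic.intervalIntegral_add_eq x 0, zero_add, mean]
      field_simp
    rw [← intervalIntegral.integral_add_adjacent_intervals (f.intervalIntegrable 0 x)
      (f.intervalIntegrable x (x + 2 * π)), h3]
    ring
  · rw [contDiff_one_iff_deriv, hde]
    exact ⟨fun x => (hd x).differentiableAt, f.continuous.sub continuous_const⟩

/-- The constant is not optimized. -/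
theorem norm_primitive_le (f : H1) : ‖mk _ (primitive_mem f).1‖ ≤ 300 * ‖f‖ := by
  have hpi4 := Real.pi_lt_four
  have hm := f.abs_mean_le
  have h0 := norm_nonneg f
  have h1 : (mk _ (primitive_mem f).1).energy ≤ (24 * ‖f‖) ^ 2 := by
    have : deriv (mk _ (primitive_mem f).1) =ᵐ[perMeasure] fun α => f α - mean f :=
      Eventually.of_forall fun x => congrFun (primitive_mem f).2 x
    rw [energy_congr _ this]
    calc ∫ x in (0 : ℝ)..(2 * π), (f x - mean f) ^ 2
        ≤ ∫ x in (0 : ℝ)..(2 * π), (8 * ‖f‖) ^ 2 := by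
          refine intervalIntegral.integral_mono_on two_pi_nonneg
            (Continuous.intervalIntegrable (by have := f.continuous; fun_prop) _ _) (by simp)
            fun x _ => ?_
          refine sq_le_sq.2 ?_
          rw [abs_of_nonneg (by positivity : 0 ≤ 8 * ‖f‖)]
          exact (abs_sub _ _).trans (by linarith [f.abs_apply_le x])
      _ = 2 * π * (8 * ‖f‖) ^ 2 := by simp
      _ ≤ (24 * ‖f‖) ^ 2 := by nlinarith [sq_nonneg ‖f‖]
  refine (norm_le_of_bound _ (A := 64 * ‖f‖) (by positivity) (by positivity) (fun x => ?_)
    h1).trans (by linarith)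
  obtain ⟨y, hy, hxy⟩ := (mk _ (primitive_mem f).1).exists_Icc x
  rw [hxy]
  change |(∫ a in (0 : ℝ)..y, f a) - y * mean f| ≤ _
  have h2 := intervalIntegral.norm_integral_le_of_norm_le_const (a := 0) (b := y)
    (f := f) (C := 4 * ‖f‖) fun x _ => f.abs_apply_le x
  rw [sub_zero, abs_of_nonneg hy.1, Real.norm_eq_abs] at h2
  have h3 : |y * mean f| ≤ 8 * (4 * ‖f‖) := by
    rw [abs_mul, abs_of_nonneg hy.1]
    exact mul_le_mul (by linarith [hy.2]) hm (abs_nonneg _) (by norm_num)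
  have h4 : 4 * ‖f‖ * y ≤ 4 * ‖f‖ * 8 := by
    gcongr
    linarith [hy.2]
  exact (abs_sub _ _).trans (by linarith)

/-- The operator `f ↦ ∫₀^α f - α · mean f`. -/
def primL : H1 →L[ℝ] H1 :=
  LinearMap.mkContinuous ⟨⟨fun f => mk _ (primitive_mem f).1, fun f f' => H1.ext fun x => by
      simp only [mk_apply, add_apply, mean_add]
      rw [intervalIntegral.integral_add (f.intervalIntegrable _ _) (f'.intervalIntegrable _ _)]
      ring⟩, fun a f => H1.ext fun x => by
      simp only [mk_apply, smul_apply, mean_smul, RingHom.id_apply]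
      rw [intervalIntegral.integral_const_mul]
      ring⟩ 300 norm_primitive_le

theorem primL_apply (f : H1) (x : ℝ) : primL f x = (∫ a in (0 : ℝ)..x, f a) - x * mean f := rfl

theorem primL_const (a : ℝ) : primL (const a) = 0 := H1.ext fun x => by
  rw [primL_apply, mean_const]
  simp

/-! #### Composition with smooth functions -/

theorem comp_mem {g g' : ℝ → ℝ} {K : NNReal} (hg : LipschitzWith K g)
    (hd : ∀ x, HasDerivAt g (g' x) x) (hc : Continuous g') (f : H1) :
    (fun x => g (f x)) ∈ H1Functions ∧
    deriv (fun x => g (f x)) =ᵐ[perMeasure] fun x => g' (f x) * deriv f x := by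
  have hde : deriv (fun x => g (f x)) =ᵐ[perMeasure] fun x => g' (f x) * deriv f x := by
    filter_upwards [f.ae_hasDerivAt] with x h1
    exact ((hd (f x)).comp x h1).deriv
  exact ⟨⟨fun x => by simp only [f.periodic x],
    absolutelyContinuous_lipschitz_comp hg f.absolutelyContinuous,
    (memLp_congr_ae hde).2 (f.memLp_bdd_mul_deriv (hc.comp f.continuous))⟩, hde⟩

theorem cos_mem (f : H1) : (fun x => Real.cos (f x)) ∈ H1Functions ∧
    deriv (fun x => Real.cos (f x)) =ᵐ[perMeasure] fun x => -Real.sin (f x) * deriv f x :=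
  comp_mem Real.lipschitzWith_cos Real.hasDerivAt_cos (by fun_prop) f

theorem sin_mem (f : H1) : (fun x => Real.sin (f x)) ∈ H1Functions ∧
    deriv (fun x => Real.sin (f x)) =ᵐ[perMeasure] fun x => Real.cos (f x) * deriv f x :=
  comp_mem Real.lipschitzWith_sin Real.hasDerivAt_sin (by fun_prop) f

/-- `cos ∘ f`. -/
def cos (f : H1) : H1 := mk _ (cos_mem f).1

/-- `sin ∘ f`. -/
def sin (f : H1) : H1 := mk _ (sin_mem f).1

@[simp] theorem cos_apply (f : H1) (x : ℝ) : cos f x = Real.cos (f x) := rfl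
@[simp] theorem sin_apply (f : H1) (x : ℝ) : sin f x = Real.sin (f x) := rfl

theorem cos_zero : cos 0 = const 1 := H1.ext fun x => by simp
theorem sin_zero : sin 0 = 0 := H1.ext fun x => by simp

end H1

/-- A quadratic remainder bound gives differentiability. -/
theorem hasFDerivAt_zero_of_sq_bound {E F : Type*} [NormedAddCommGroup E] [NormedSpace ℝ E]
    [NormedAddCommGroup F] [NormedSpace ℝ F] {u : E → F} {u' : E →L[ℝ] F} (C : ℝ)
    (h : ∀ᶠ x in 𝓝 (0 : E), ‖u x - u 0 - u' x‖ ≤ C * ‖x‖ ^ 2) : HasFDerivAt u u' 0 := by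
  refine .of_isLittleO ?_
  have h1 : (fun x => u x - u 0 - u' (x - 0)) =O[𝓝 (0 : E)] fun x => ‖x‖ ^ 2 := by
    refine Asymptotics.IsBigO.of_bound C ?_
    filter_upwards [h] with x hx
    simpa using hx
  refine h1.trans_isLittleO ?_
  simpa using Asymptotics.isLittleO_norm_pow_id (E' := E) one_lt_two

theorem abs_one_sub_cos_le (x : ℝ) : |Real.cos x - 1| ≤ x ^ 2 := by
  rw [abs_le]
  constructor
  · nlinarith [Real.one_sub_sq_div_two_le_cos (x := x), sq_nonneg x]
  · nlinarith [Real.cos_le_one x, sq_nonneg x]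

theorem abs_one_sub_cos_le' (x : ℝ) : |Real.cos x - 1| ≤ |x| := by
  have := Real.lipschitzWith_cos.dist_le_mul x 0
  simpa [Real.dist_eq] using this

theorem abs_sin_sub_le (x : ℝ) : |Real.sin x - x| ≤ x ^ 2 := by
  have h := (convex_uIcc 0 x).norm_image_sub_le_of_norm_hasDerivWithin_le
    (f := fun y => Real.sin y - y) (f' := fun y => Real.cos y - 1) (C := |x|)
    (fun y _ => ((Real.hasDerivAt_sin y).sub (hasDerivAt_id y)).hasDerivWithinAt)
    (fun y hy => (abs_one_sub_cos_le' y).trans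
      (by simpa using abs_sub_left_of_mem_uIcc hy)) left_mem_uIcc right_mem_uIcc
  simpa [← sq] using h

namespace H1

theorem deriv_sub_const (f : H1) (a : ℝ) :
    deriv (f - const a : H1) = deriv f := by
  have h : ((f - const a : H1) : ℝ → ℝ) = fun x => f x - a := rfl
  rw [h]
  funext x
  exact _root_.deriv_sub_const a

/-- The cosine is critical at `0`: the map `f ↦ cos ∘ f` differs from the constant `1` by a
quadratic term. -/
theorem hasFDerivAt_cos : HasFDerivAt cos (0 : H1 →L[ℝ] H1) 0 := by
  refine hasFDerivAt_zero_of_sq_bound 52 (Eventually.of_forall fun f => ?_)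
  rw [cos_zero, _root_.zero_apply, sub_zero]
  have hB : (cos f - const 1).energy ≤ (4 * ‖f‖ * ‖f‖) ^ 2 := by
    refine energy_le_of_deriv_eq_mul f _ (b := fun x => -Real.sin (f x))
      (by have := f.continuous; fun_prop) (fun x => ?_) ?_
    · rw [abs_neg]
      exact (Real.abs_sin_le_abs).trans (f.abs_apply_le x)
    · rw [deriv_sub_const]
      exact (cos_mem f).2
  refine (norm_le_of_bound _ (A := 16 * ‖f‖ ^ 2) (by positivity) (by positivity)
    (fun x => ?_) hB).trans (le_of_eq (by ring))
  rw [sub_apply, cos_apply, const_apply]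
  have h1 := f.abs_apply_le x
  have h2 : f x ^ 2 ≤ (4 * ‖f‖) ^ 2 := sq_le_sq' (abs_le.1 h1).1 (abs_le.1 h1).2
  linarith [abs_one_sub_cos_le (f x)]

theorem hasFDerivAt_sin : HasFDerivAt sin (ContinuousLinearMap.id ℝ H1) 0 := by
  refine hasFDerivAt_zero_of_sq_bound 52 (Eventually.of_forall fun f => ?_)
  rw [sin_zero, ContinuousLinearMap.id_apply, sub_zero]
  have hd : deriv (sin f - f : H1) =ᵐ[perMeasure] fun x => (Real.cos (f x) - 1) * deriv f x := by
    filter_upwards [f.ae_hasDerivAt] with x hx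
    have := (((Real.hasDerivAt_sin (f x)).comp x hx).sub hx).deriv
    rw [sub_mul, one_mul]
    exact this
  have hB : (sin f - f).energy ≤ (4 * ‖f‖ * ‖f‖) ^ 2 := by
    refine energy_le_of_deriv_eq_mul f _ (b := fun x => Real.cos (f x) - 1)
      (by have := f.continuous; fun_prop) (fun x => ?_) hd
    exact (abs_one_sub_cos_le' _).trans (f.abs_apply_le x)
  refine (norm_le_of_bound _ (A := 16 * ‖f‖ ^ 2) (by positivity) (by positivity)
    (fun x => ?_) hB).trans (le_of_eq (by ring))
  rw [sub_apply, sin_apply]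
  have h1 := f.abs_apply_le x
  have h2 : f x ^ 2 ≤ (4 * ‖f‖) ^ 2 := sq_le_sq' (abs_le.1 h1).1 (abs_le.1 h1).2
  linarith [abs_sin_sub_le (f x)]

end H1

/-! ### Fourier coefficients -/

theorem intervalIntegrable_ofReal {f : ℝ → ℝ} {a b : ℝ} (h : IntervalIntegrable f volume a b) :
    IntervalIntegrable (fun x => (f x : ℂ)) volume a b := ⟨h.1.ofReal, h.2.ofReal⟩

theorem intervalIntegral_conj (f : ℝ → ℂ) (a b : ℝ) :
    ∫ x in a..b, (starRingEnd ℂ) (f x) = (starRingEnd ℂ) (∫ x in a..b, f x) := by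
  simp only [intervalIntegral, map_sub, integral_conj]

/-- Integration by parts of an element of `H¹_per` against a complex absolutely continuous
function, given as a primitive. -/
theorem H1.integral_deriv_mul (f : H1) {g g' : ℝ → ℂ} {a b : ℝ} (hab : a ≤ b)
    (hg' : IntervalIntegrable g' volume a b)
    (hg : ∀ x ∈ Icc a b, g x = g a + ∫ t in a..x, g' t) :
    ∫ x in a..b, ((deriv f x : ℝ) : ℂ) * g x =
      f b * g b - f a * g a - ∫ x in a..b, (f x : ℂ) * g' x := by
  -- the real version, applied below to the real and to the imaginary part
  have key (u u' : ℝ → ℝ) (hu' : IntervalIntegrable u' volume a b)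
      (hu : ∀ x ∈ Icc a b, u x = u a + ∫ t in a..x, u' t) :
      IntervalIntegrable (fun x => deriv f x * u x) volume a b ∧
      IntervalIntegrable (fun x => f x * u' x) volume a b ∧
      ∫ x in a..b, deriv f x * u x = f b * u b - f a * u a - ∫ x in a..b, f x * u' x := by
    set w : ℝ → ℝ := (fun _ => u a) + fun x => ∫ t in a..x, u' t with hw
    have hwu : ∀ x ∈ Icc a b, u x = w x := hu
    have hac : AbsolutelyContinuousOnInterval w a b :=
      ((contDiff_const (n := 1)).contDiffOn.absolutelyContinuousOnInterval).add
        (hu'.absolutelyContinuousOnInterval_intervalIntegral left_mem_uIcc)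
    have hi2 : IntervalIntegrable (fun x => f x * u' x) volume a b :=
      hu'.continuousOn_mul f.continuous.continuousOn
    have hi1 : IntervalIntegrable (fun x => deriv f x * w x) volume a b :=
      (f.intervalIntegrable_deriv a b).mul_continuousOn hac.continuousOn
    have hcongr : EqOn (fun x => deriv f x * w x) (fun x => deriv f x * u x) (uIoc a b) := by
      intro x hx
      rw [uIoc_of_le hab] at hx
      simp only [hwu x (Ioc_subset_Icc_self hx)]
    refine ⟨hi1.congr hcongr, hi2, ?_⟩
    have h1 := (f.absolutelyContinuousOn a b).integral_mul_deriv_eq_deriv_mul hac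
    have h2 : ∫ x in a..b, f x * deriv w x = ∫ x in a..b, f x * u' x := by
      refine intervalIntegral.integral_congr_ae ?_
      filter_upwards [hu'.ae_hasDerivAt_integral] with x hx hx'
      have := (hx (uIoc_subset_uIcc hx') a left_mem_uIcc).const_add (u a)
      have hd : deriv w x = u' x := HasDerivAt.deriv this
      simp only [hd]
    have h3 : ∫ x in a..b, deriv f x * w x = ∫ x in a..b, deriv f x * u x := by
      refine intervalIntegral.integral_congr fun x hx => ?_
      rw [uIcc_of_le hab] at hx
      simp only [hwu x hx]
    rw [h2, h3, ← hwu b (right_mem_Icc.2 hab), ← hwu a (left_mem_Icc.2 hab)] at h1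
    linarith
  have hint (x : ℝ) (hx : x ∈ Icc a b) : IntervalIntegrable g' volume a x := by
    refine hg'.mono_set ?_
    rw [uIcc_of_le hx.1, uIcc_of_le hab]
    exact Icc_subset_Icc_right hx.2
  obtain ⟨r1, r2, r3⟩ := key (fun x => (g x).re) (fun x => (g' x).re)
    ⟨hg'.1.re, hg'.2.re⟩ fun x hx => by
      simp only [hg x hx, Complex.add_re]
      congr 1
      exact (intervalIntegral.intervalIntegral_re (hint x hx)).symm
  obtain ⟨i1, i2, i3⟩ := key (fun x => (g x).im) (fun x => (g' x).im)
    ⟨hg'.1.im, hg'.2.im⟩ fun x hx => by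
      simp only [hg x hx, Complex.add_im]
      congr 1
      exact (intervalIntegral.intervalIntegral_im (hint x hx)).symm
  have e1 : ∫ x in a..b, ((deriv f x : ℝ) : ℂ) * g x =
      ((∫ x in a..b, deriv f x * (g x).re : ℝ) : ℂ) +
        Complex.I * (∫ x in a..b, deriv f x * (g x).im : ℝ) := by
    rw [← intervalIntegral.integral_ofReal, ← intervalIntegral.integral_ofReal,
      ← intervalIntegral.integral_const_mul,
      ← intervalIntegral.integral_add (intervalIntegrable_ofReal r1)
      ((intervalIntegrable_ofReal i1).const_mul _)]
    refine intervalIntegral.integral_congr fun x _ => ?_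
    apply Complex.ext <;> simp
  have e2 : ∫ x in a..b, (f x : ℂ) * g' x =
      ((∫ x in a..b, f x * (g' x).re : ℝ) : ℂ) +
        Complex.I * (∫ x in a..b, f x * (g' x).im : ℝ) := by
    rw [← intervalIntegral.integral_ofReal, ← intervalIntegral.integral_ofReal,
      ← intervalIntegral.integral_const_mul,
      ← intervalIntegral.integral_add (intervalIntegrable_ofReal r2)
      ((intervalIntegrable_ofReal i2).const_mul _)]
    refine intervalIntegral.integral_congr fun x _ => ?_
    apply Complex.ext <;> simp
  rw [e1, e2, r3, i3]
  apply Complex.ext <;> simp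

/-- The `n`-th Fourier coefficient of a real function on `[0, 2π]`. -/
def coef (f : ℝ → ℝ) (n : ℤ) : ℂ :=
  1 / (2 * π) * ∫ x in (0 : ℝ)..(2 * π), Complex.exp (-(n * x * Complex.I)) * f x

theorem fourierCoeffOn_eq_coef (f : ℝ → ℝ) (n : ℤ) :
    fourierCoeffOn Real.two_pi_pos (fun x => (f x : ℂ)) n = coef f n := by
  rw [fourierCoeffOn_eq_integral, coef]
  simp only [fourier_coe_apply, sub_zero, smul_eq_mul]
  rw [Complex.real_smul]
  push_cast
  congr 1
  refine intervalIntegral.integral_congr fun x _ => ?_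
  have hpi : (π : ℂ) ≠ 0 := by exact_mod_cast Real.pi_ne_zero
  congr 2
  field_simp

theorem hasSum_sq_coef {f : ℝ → ℝ} (hf : MemLp f 2 perMeasure) :
    HasSum (fun n => ‖coef f n‖ ^ 2) ((2 * π)⁻¹ * ∫ x in (0 : ℝ)..(2 * π), f x ^ 2) := by
  have h := hasSum_sq_fourierCoeffOn Real.two_pi_pos (f := fun x => (f x : ℂ)) hf.ofReal
  simp only [fourierCoeffOn_eq_coef, sub_zero, smul_eq_mul, Complex.norm_real, Real.norm_eq_abs,
    sq_abs] at h
  exact h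

theorem coef_congr_ae {f f' : ℝ → ℝ} (h : f =ᵐ[perMeasure] f') : coef f = coef f' := by
  funext n
  rw [coef, coef, intervalIntegral.integral_of_le two_pi_nonneg,
    intervalIntegral.integral_of_le two_pi_nonneg]
  congr 1
  refine integral_congr_ae ?_
  filter_upwards [h] with x hx
  rw [hx]

theorem coef_add {f f' : ℝ → ℝ} (hf : IntervalIntegrable f volume 0 (2 * π))
    (hf' : IntervalIntegrable f' volume 0 (2 * π)) (n : ℤ) :
    coef (fun x => f x + f' x) n = coef f n + coef f' n := by
  have hc : ContinuousOn (fun x : ℝ => Complex.exp (-(n * x * Complex.I))) (uIcc 0 (2 * π)) := by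
    fun_prop
  rw [coef, coef, coef, ← mul_add,
    ← intervalIntegral.integral_add ((intervalIntegrable_ofReal hf).continuousOn_mul hc)
    ((intervalIntegrable_ofReal hf').continuousOn_mul hc)]
  congr 2
  funext x
  push_cast
  ring

theorem coef_smul (a : ℝ) (f : ℝ → ℝ) (n : ℤ) : coef (fun x => a * f x) n = a * coef f n := by
  rw [coef, coef, mul_left_comm (a : ℂ), ← intervalIntegral.integral_const_mul (a : ℂ)]
  congr 2
  funext x
  push_cast
  ring

theorem coef_zero_eq_mean (f : ℝ → ℝ) : coef f 0 = mean f := by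
  rw [coef, mean]
  push_cast
  rw [← intervalIntegral.integral_ofReal]
  simp

theorem exp_int_mul_two_pi (n : ℤ) : Complex.exp (-(n * (2 * π) * Complex.I)) = 1 := by
  rw [Complex.exp_eq_one_iff]
  exact ⟨-n, by push_cast; ring⟩

theorem H1.coef_deriv (f : H1) (n : ℤ) : coef (deriv f) n = n * Complex.I * coef f n := by
  have hd (x : ℝ) : HasDerivAt (fun x : ℝ => Complex.exp (-(n * x * Complex.I)))
      (-(n * Complex.I) * Complex.exp (-(n * x * Complex.I))) x := by
    have h1 : HasDerivAt (fun x : ℝ => -(n * (x : ℂ) * Complex.I)) (-(n * Complex.I)) x := by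
      have := (((hasDerivAt_id x).ofReal_comp.const_mul (n : ℂ)).mul_const Complex.I).neg
      simp only [Complex.ofReal_one, mul_one] at this
      exact this
    convert h1.cexp using 1
    ring
  have hcont : Continuous fun x : ℝ =>
      -(n * Complex.I) * Complex.exp (-(n * x * Complex.I)) := by fun_prop
  have h := f.integral_deriv_mul (a := 0) (b := 2 * π) two_pi_nonneg
    (hcont.intervalIntegrable _ _) (g := fun x : ℝ => Complex.exp (-(n * x * Complex.I)))
    fun x _ => by
      rw [intervalIntegral.integral_eq_sub_of_hasDerivAt (fun y _ => hd y)
        (hcont.intervalIntegrable _ _)]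
      ring
  have hp := f.periodic 0
  rw [zero_add] at hp
  have e : Complex.exp (-(n * ((2 * π : ℝ) : ℂ) * Complex.I)) = 1 := by
    push_cast
    exact exp_int_mul_two_pi n
  rw [hp, e] at h
  simp only [Complex.ofReal_zero, mul_zero, zero_mul, neg_zero, Complex.exp_zero, mul_one, sub_self,
    zero_sub] at h
  rw [coef, coef]
  have h2 : ∫ x in (0 : ℝ)..(2 * π), Complex.exp (-(n * x * Complex.I)) * ((deriv f x : ℝ) : ℂ) =
      ∫ x in (0 : ℝ)..(2 * π), ((deriv f x : ℝ) : ℂ) * Complex.exp (-(n * x * Complex.I)) := by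
    simp only [mul_comm]
  rw [h2, h, mul_left_comm, ← intervalIntegral.integral_const_mul,
    ← intervalIntegral.integral_neg]
  congr 2
  funext x
  ring

theorem H1.coef_add (f f' : H1) (n : ℤ) : coef (f + f' : H1) n = coef f n + coef f' n :=
  VortexSheet.coef_add (f.intervalIntegrable _ _) (f'.intervalIntegrable _ _) n

theorem H1.coef_smul (a : ℝ) (f : H1) (n : ℤ) : coef (a • f : H1) n = a * coef f n :=
  VortexSheet.coef_smul a f n

theorem H1.coef_sub (f f' : H1) (n : ℤ) : coef (f - f' : H1) n = coef f n - coef f' n := by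
  have : f - f' = f + (-1 : ℝ) • f' := by rw [neg_one_smul, sub_eq_add_neg]
  rw [this, H1.coef_add, H1.coef_smul]
  push_cast
  ring

/-- Parseval's identity for the `H¹` norm. -/
theorem H1.hasSum_coef (f : H1) :
    HasSum (fun n : ℤ => (1 + (n : ℝ) ^ 2) * ‖coef f n‖ ^ 2) ((2 * π)⁻¹ * ‖f‖ ^ 2) := by
  have h := (hasSum_sq_coef f.memLp).add (hasSum_sq_coef f.memLp_deriv)
  rw [← mul_add] at h
  rw [f.norm_sq, H1.energy]
  convert h using 2 with n
  rw [f.coef_deriv, norm_mul, norm_mul, Complex.norm_I, mul_one, mul_pow, Complex.norm_intCast,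
    sq_abs]
  ring

theorem H1.eq_of_coef {f f' : H1} (h : ∀ n, coef f n = coef f' n) : f = f' := by
  have h1 := (f - f').hasSum_coef
  have h0 : (fun n : ℤ => (1 + (n : ℝ) ^ 2) * ‖coef (f - f' : H1) n‖ ^ 2) = fun _ => 0 := by
    funext n
    rw [H1.coef_sub, h n, sub_self]
    simp
  rw [h0] at h1
  have h2 := hasSum_zero.unique h1
  have h3 : ‖f - f'‖ ^ 2 = 0 := by
    have := Real.pi_pos
    rcases mul_eq_zero.1 h2.symm with h | h
    · exact absurd h (by positivity)
    · exact h
  exact sub_eq_zero.1 (norm_eq_zero.1 (pow_eq_zero_iff two_ne_zero |>.1 h3))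

/-- The coefficients of a real function form a Hermitian sequence. -/
theorem coef_neg_index (f : ℝ → ℝ) (n : ℤ) : coef f (-n) = (starRingEnd ℂ) (coef f n) := by
  rw [coef, coef, map_mul, ← intervalIntegral_conj]
  congr 1
  · exact_mod_cast (Complex.conj_ofReal (1 / (2 * π))).symm
  · refine intervalIntegral.integral_congr fun x _ => ?_
    simp only [map_mul, ← Complex.exp_conj, Complex.conj_ofReal, map_neg, map_intCast,
      Complex.conj_I]
    congr 2
    push_cast
    ring

/-- A Hermitian sequence `a` with `(n aₙ) ∈ ℓ²` is the sequence of Fourier coefficients of an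
element of `H¹_per`. -/
theorem H1.exists_coef_eq {a : ℤ → ℂ} (hs : Summable fun n : ℤ => (n : ℝ) ^ 2 * ‖a n‖ ^ 2)
    (hc : ∀ n, a (-n) = (starRingEnd ℂ) (a n)) : ∃ g : H1, ∀ n, coef g n = a n := by
  have : Fact (0 < 2 * π) := ⟨Real.two_pi_pos⟩
  have hmem : Memℓp (fun n : ℤ => (n : ℂ) * Complex.I * a n) 2 := by
    refine memℓp_gen ?_
    convert hs using 2 with n
    simp [mul_pow]
  -- the function with coefficients `i n aₙ`, whose real part is the derivative of the one wanted
  set φ : Lp ℂ 2 (@AddCircle.haarAddCircle (2 * π) _) := fourierBasis.repr.symm ⟨_, hmem⟩ with hφ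
  have hco (n : ℤ) : fourierCoeff φ n = n * Complex.I * a n := by
    rw [← fourierBasis_repr, hφ, LinearIsometryEquiv.apply_symm_apply]
  set ψ : ℝ → ℂ := fun x => φ (x : AddCircle (2 * π)) with hψ
  have hψL : MemLp ψ 2 perMeasure := by
    have h1 : MemLp φ 2 (volume : Measure (AddCircle (2 * π))) :=
      memLp_haarAddCircle_iff.1 (Lp.memLp φ)
    have h2 := h1.comp_measurePreserving (AddCircle.measurePreserving_mk (2 * π) 0)
    rw [zero_add] at h2
    exact h2
  have hψi : IntervalIntegrable ψ volume 0 (2 * π) := by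
    rw [intervalIntegrable_iff_integrableOn_Ioc_of_le two_pi_nonneg]
    exact hψL.integrable one_le_two
  have hψper : Function.Periodic ψ (2 * π) := fun x => by
    simp only [hψ]
    rw [AddCircle.coe_add_period]
  -- the coefficients of `ψ` as integrals over the period
  have hψc (n : ℤ) : 1 / (2 * π) * ∫ x in (0 : ℝ)..(2 * π),
      Complex.exp (-(n * x * Complex.I)) * ψ x = n * Complex.I * a n := by
    rw [← hco, fourierCoeff_eq_intervalIntegral _ _ 0, zero_add, Complex.real_smul]
    push_cast
    congr 1
    refine intervalIntegral.integral_congr fun x _ => ?_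
    simp only [fourier_coe_apply, smul_eq_mul, hψ]
    have hpi : (π : ℂ) ≠ 0 := by exact_mod_cast Real.pi_ne_zero
    congr 2
    push_cast
    field_simp
  set u : ℝ → ℝ := fun x => (ψ x).re with hu
  have huL : MemLp u 2 perMeasure := hψL.re
  have hui : IntervalIntegrable u volume 0 (2 * π) := ⟨hψi.1.re, hψi.2.re⟩
  have huper : Function.Periodic u (2 * π) := fun x => by simp only [hu, hψper x]
  have huc (n : ℤ) : coef u n = n * Complex.I * a n := by
    have hcn : ContinuousOn (fun x : ℝ => Complex.exp (-(n * x * Complex.I))) (uIcc 0 (2 * π)) := by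
      fun_prop
    have hconji : IntervalIntegrable (fun x => (starRingEnd ℂ) (ψ x)) volume 0 (2 * π) := by
      have := (Complex.conjCLE : ℂ →L[ℝ] ℂ).integrable_comp hψi.1
      exact ⟨this, by simp [Ioc_eq_empty_of_le two_pi_nonneg]⟩
    have h1 : coef u n = 1 / 2 * (1 / (2 * π) * ∫ x in (0 : ℝ)..(2 * π),
        Complex.exp (-(n * x * Complex.I)) * ψ x) + 1 / 2 * (1 / (2 * π) * ∫ x in (0 : ℝ)..(2 * π),
        Complex.exp (-(n * x * Complex.I)) * (starRingEnd ℂ) (ψ x)) := by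
      rw [← mul_add, ← mul_add, ← intervalIntegral.integral_add
        (hψi.continuousOn_mul hcn) (hconji.continuousOn_mul hcn),
        mul_left_comm (1 / 2 : ℂ), ← intervalIntegral.integral_const_mul (1 / 2 : ℂ), coef]
      congr 1
      refine intervalIntegral.integral_congr fun x _ => ?_
      simp only [hu]
      rw [Complex.re_eq_add_conj]
      ring
    have h2 : (1 / (2 * π) * ∫ x in (0 : ℝ)..(2 * π),
        Complex.exp (-(n * x * Complex.I)) * (starRingEnd ℂ) (ψ x)) =
        (starRingEnd ℂ) (1 / (2 * π) * ∫ x in (0 : ℝ)..(2 * π),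
        Complex.exp (-((-n : ℤ) * x * Complex.I)) * ψ x) := by
      rw [map_mul, ← intervalIntegral_conj]
      congr 1
      · exact_mod_cast (Complex.conj_ofReal (1 / (2 * π))).symm
      · refine intervalIntegral.integral_congr fun x _ => ?_
        simp only [map_mul, ← Complex.exp_conj, Complex.conj_ofReal, map_neg, map_intCast,
          Complex.conj_I]
        congr 2
        push_cast
        ring
    rw [h1, h2, hψc, hψc, hc]
    simp
    ring
  have hmean : ∫ x in (0 : ℝ)..(2 * π), u x = 0 := by
    have h1 := huc 0
    rw [coef_zero_eq_mean, mean] at h1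
    simp only [Int.cast_zero, zero_mul] at h1
    have h2 : (1 / (2 * π)) * ∫ x in (0 : ℝ)..(2 * π), u x = 0 := by exact_mod_cast h1
    rcases mul_eq_zero.1 h2 with h | h
    · have := Real.pi_pos
      exact absurd h (by positivity)
    · exact h
  have huI (p q : ℝ) : IntervalIntegrable u volume p q :=
    huper.intervalIntegrable₀ Real.two_pi_pos.ne' hui p q
  set G : ℝ → ℝ := fun x => ∫ t in (0 : ℝ)..x, u t with hG
  have hGper : Function.Periodic G (2 * π) := fun x => by
    have h3 := huper.intervalIntegral_add_eq x 0
    rw [zero_add, hmean] at h3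
    simp only [hG]
    rw [← intervalIntegral.integral_add_adjacent_intervals (huI 0 x) (huI x (x + 2 * π)), h3,
      add_zero]
  obtain ⟨hGm, hGd⟩ := mem_H1Functions_of_primitive hGper huL fun x _ => by simp [hG]
  set g0 : H1 := H1.mk G hGm with hg0
  have hg0c (n : ℤ) (hn : n ≠ 0) : coef g0 n = a n := by
    have h1 := g0.coef_deriv n
    have h2 : coef (deriv g0) n = coef u n := congrFun (coef_congr_ae hGd) n
    rw [h2, huc] at h1
    have h3 : (n : ℂ) * Complex.I ≠ 0 := mul_ne_zero (by exact_mod_cast hn) Complex.I_ne_zero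
    exact (mul_left_cancel₀ h3 h1).symm
  have ha0 : ((a 0).re : ℂ) = a 0 := by
    have := hc 0
    rw [neg_zero] at this
    exact Complex.conj_eq_iff_re.1 this.symm
  refine ⟨g0 + H1.const ((a 0).re - mean g0), fun n => ?_⟩
  rw [H1.coef_add]
  have hconst : coef (H1.const ((a 0).re - mean g0)) n =
      if n = 0 then (((a 0).re - mean g0 : ℝ) : ℂ) else 0 := by
    split_ifs with hn
    · rw [hn, coef_zero_eq_mean, H1.mean_const]
    · have h1 := (H1.const ((a 0).re - mean g0)).coef_deriv n
      have h2 : deriv (H1.const ((a 0).re - mean g0)) = fun _ => 0 := by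
        funext x
        exact deriv_const x _
      have h3 : coef (fun _ => 0) n = 0 := by simp [coef]
      rw [h2, h3] at h1
      have h4 : (n : ℂ) * Complex.I ≠ 0 := mul_ne_zero (by exact_mod_cast hn) Complex.I_ne_zero
      exact (mul_eq_zero.1 h1.symm).resolve_left h4
  rw [hconst]
  split_ifs with hn
  · rw [hn, coef_zero_eq_mean]
    push_cast
    rw [ha0]
    ring
  · rw [hg0c n hn, add_zero]

/-- Bounded Hermitian sequences: the symbols of bounded Fourier multipliers that preserve real
functions. -/
structure IsSymbol (m : ℤ → ℂ) (B : ℝ) : Prop where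
  conj : ∀ n, m (-n) = (starRingEnd ℂ) (m n)
  bound : ∀ n, ‖m n‖ ≤ B

/-- Bounded symbols act on `H¹_per`, by Parseval's identity. -/
theorem IsSymbol.exists_coef {m : ℤ → ℂ} {B : ℝ} (hm : IsSymbol m B) (f : H1) :
    ∃ g : H1, ∀ n, coef g n = m n * coef f n := by
  refine H1.exists_coef_eq ?_ fun n => by rw [hm.conj, coef_neg_index, map_mul]
  refine Summable.of_nonneg_of_le (fun n => by positivity) (fun n => ?_)
    (f.hasSum_coef.summable.mul_left (B ^ 2))
  rw [norm_mul, mul_pow]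
  have h1 : ‖m n‖ ^ 2 ≤ B ^ 2 := pow_le_pow_left₀ (norm_nonneg _) (hm.bound n) 2
  have h2 : (n : ℝ) ^ 2 * (‖m n‖ ^ 2 * ‖coef f n‖ ^ 2) =
      ‖m n‖ ^ 2 * ((n : ℝ) ^ 2 * ‖coef f n‖ ^ 2) := by
    ring
  rw [h2]
  refine mul_le_mul h1 ?_ (by positivity) (by positivity)
  exact mul_le_mul_of_nonneg_right (by linarith) (by positivity)

/-- The Fourier multiplier with symbol `m` on `H¹_per`. -/
def multiplier {m : ℤ → ℂ} {B : ℝ} (hm : IsSymbol m B) : H1 →L[ℝ] H1 :=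
  LinearMap.mkContinuous
    ⟨⟨fun f => (hm.exists_coef f).choose, fun f f' => H1.eq_of_coef fun n => by
        rw [(hm.exists_coef _).choose_spec, H1.coef_add, H1.coef_add,
          (hm.exists_coef _).choose_spec, (hm.exists_coef _).choose_spec, mul_add]⟩,
      fun a f => H1.eq_of_coef fun n => by
        rw [(hm.exists_coef _).choose_spec, H1.coef_smul, RingHom.id_apply, H1.coef_smul,
          (hm.exists_coef _).choose_spec]
        ring⟩ B fun f => by
      have hB : 0 ≤ B := (norm_nonneg _).trans (hm.bound 0)
      refine le_of_sq_le_sq ?_ (by positivity)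
      set g := (hm.exists_coef f).choose with hg
      have hgc : ∀ n, coef g n = m n * coef f n := (hm.exists_coef f).choose_spec
      have h := hasSum_le (fun n => ?_) g.hasSum_coef (f.hasSum_coef.mul_left (B ^ 2))
      · have hp : (0 : ℝ) < (2 * π)⁻¹ := by positivity
        rw [mul_left_comm, mul_le_mul_iff_right₀ hp] at h
        rw [mul_pow]
        exact h
      · rw [hgc, norm_mul, mul_pow]
        have h1 : ‖m n‖ ^ 2 ≤ B ^ 2 := pow_le_pow_left₀ (norm_nonneg _) (hm.bound n) 2
        calc (1 + (n : ℝ) ^ 2) * (‖m n‖ ^ 2 * ‖coef f n‖ ^ 2)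
            = ‖m n‖ ^ 2 * ((1 + (n : ℝ) ^ 2) * ‖coef f n‖ ^ 2) := by ring
          _ ≤ _ := by gcongr

theorem coef_multiplier {m : ℤ → ℂ} {B : ℝ} (hm : IsSymbol m B) (f : H1) (n : ℤ) :
    coef (multiplier hm f) n = m n * coef f n :=
  (hm.exists_coef f).choose_spec n

/-! ### The periodic Hilbert transform -/

theorem annulus_eq (a ε R : ℝ) (hε : 0 ≤ ε) :
    {x | ε < |x - a| ∧ |x - a| < R} = Ioo (a - R) (a - ε) ∪ Ioo (a + ε) (a + R) := by
  ext x
  simp only [mem_ofPred_eq, mem_union, mem_Ioo, lt_abs, abs_lt]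
  constructor
  · rintro ⟨h1 | h1, h2, h3⟩
    · right; constructor <;> linarith
    · left; constructor <;> linarith
  · rintro (⟨h1, h2⟩ | ⟨h1, h2⟩)
    · refine ⟨Or.inr (by linarith), ?_, ?_⟩ <;> linarith
    · refine ⟨Or.inl (by linarith), ?_, ?_⟩ <;> linarith

/-- An integral over the symmetric annulus `ε < |x - a| < R`, folded at the centre. -/
theorem integral_annulus {E : Type*} [NormedAddCommGroup E] [NormedSpace ℝ E] {F : ℝ → E}
    {a ε R : ℝ} (hε : 0 ≤ ε) (hR : ε ≤ R)
    (h1 : IntervalIntegrable (fun t => F (a - t)) volume ε R)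
    (h2 : IntervalIntegrable (fun t => F (a + t)) volume ε R) :
    ∫ x in {x | ε < |x - a| ∧ |x - a| < R}, F x = ∫ t in ε..R, (F (a - t) + F (a + t)) := by
  have i1 : IntervalIntegrable F volume (a - R) (a - ε) := by
    have := (h1.comp_sub_left a).symm
    simpa using this
  have i2 : IntervalIntegrable F volume (a + ε) (a + R) := by
    have := h2.comp_sub_right a
    simpa [add_comm] using this
  have j1 : IntegrableOn F (Ioo (a - R) (a - ε)) := by
    rw [← integrableOn_Ioc_iff_integrableOn_Ioo]
    exact (intervalIntegrable_iff_integrableOn_Ioc_of_le (by linarith)).1 i1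
  have j2 : IntegrableOn F (Ioo (a + ε) (a + R)) := by
    rw [← integrableOn_Ioc_iff_integrableOn_Ioo]
    exact (intervalIntegrable_iff_integrableOn_Ioc_of_le (by linarith)).1 i2
  have hdis : Disjoint (Ioo (a - R) (a - ε)) (Ioo (a + ε) (a + R)) := by
    rw [Set.disjoint_left]
    rintro x ⟨_, h⟩ ⟨h', _⟩
    linarith
  rw [annulus_eq a ε R hε, setIntegral_union hdis measurableSet_Ioo j1 j2,
    ← integral_Ioc_eq_integral_Ioo, ← integral_Ioc_eq_integral_Ioo,
    ← intervalIntegral.integral_of_le (by linarith),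
    ← intervalIntegral.integral_of_le (by linarith),
    intervalIntegral.integral_add h1 h2, intervalIntegral.integral_comp_sub_left,
    intervalIntegral.integral_comp_add_left]

theorem setIntegral_annulus_closed {E : Type*} [NormedAddCommGroup E] [NormedSpace ℝ E]
    (F : ℝ → E) (a ε R : ℝ) :
    ∫ x in {x | ε < |x - a| ∧ |x - a| ≤ R}, F x = ∫ x in {x | ε < |x - a| ∧ |x - a| < R}, F x := by
  refine setIntegral_congr_set ?_
  have hnull : volume ({a + R, a - R} : Set ℝ) = 0 := (Set.toFinite _).measure_zero _
  have h : ∀ᵐ x : ℝ, x ∉ ({a + R, a - R} : Set ℝ) := measure_eq_zero_iff_ae_notMem.1 hnull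
  filter_upwards [h] with x hx
  refine propext ⟨fun h => ⟨h.1, lt_of_le_of_ne h.2 fun h' => hx ?_⟩, fun h => ⟨h.1, h.2.le⟩⟩
  rcases abs_choice (x - a) with h3 | h3
  · left; linarith
  · right
    rw [mem_singleton_iff]
    linarith

theorem abs_cot_half_le {t : ℝ} (ht : t ∈ Ioc 0 π) : |Real.cot (t / 2)| ≤ π / t := by
  have h1 := Real.mul_le_sin (x := t / 2) (by linarith [ht.1]) (by linarith [ht.2])
  have h2 : 2 / π * (t / 2) = t / π := by ring
  rw [h2] at h1
  have hpos : 0 < t / π := div_pos ht.1 Real.pi_pos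
  rw [Real.cot_eq_cos_div_sin, abs_div, abs_of_pos (hpos.trans_le h1)]
  calc |Real.cos (t / 2)| / Real.sin (t / 2) ≤ 1 / (t / π) :=
        div_le_div₀ zero_le_one (Real.abs_cos_le_one _) hpos h1
    _ = π / t := by rw [one_div_div]

/-- Integrand of the folded Hilbert transform. -/
def hilbertIntegrand (f : ℝ → ℝ) (α t : ℝ) : ℝ := (f (α - t) - f (α + t)) * Real.cot (t / 2)

/-- The Hilbert transform as an absolutely convergent integral. -/
def foldedHilbert (f : ℝ → ℝ) (α : ℝ) : ℝ :=
  1 / (2 * π) * ∫ t in (0 : ℝ)..π, hilbertIntegrand f α t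

theorem H1.abs_hilbertIntegrand_le (f : H1) (α : ℝ) {t : ℝ} (ht : t ∈ Ioc 0 π) :
    |hilbertIntegrand f α t| ≤ 8 * ‖f‖ * t ^ (-(1 / 2) : ℝ) := by
  have hpi4 := Real.pi_lt_four
  have h1 : |α - t - (α + t)| = 2 * t := by
    rw [show α - t - (α + t) = -(2 * t) by ring, abs_neg, abs_of_pos (by linarith [ht.1])]
  have h2 := f.sq_sub_le (a := α + t) (b := α - t) (by rw [h1]; linarith [ht.2])
  rw [h1] at h2
  have ht0 := ht.1
  have h3 : (f (α - t) - f (α + t)) ^ 2 ≤ (2 * (t ^ (1 / 2 : ℝ)) * ‖f‖) ^ 2 := by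
    have h4 : (t ^ (1 / 2 : ℝ)) ^ 2 = t := by
      rw [← Real.rpow_natCast, ← Real.rpow_mul ht0.le]
      norm_num
    rw [mul_pow, mul_pow, h4]
    have := f.energy_le
    nlinarith [sq_nonneg ‖f‖]
  have h4 := abs_le_of_sq_le_sq h3 (by positivity)
  rw [hilbertIntegrand, abs_mul]
  calc |f (α - t) - f (α + t)| * |Real.cot (t / 2)|
      ≤ (2 * (t ^ (1 / 2 : ℝ)) * ‖f‖) * (4 / t) := by
        refine mul_le_mul h4 ((abs_cot_half_le ht).trans ?_) (abs_nonneg _) (by positivity)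
        gcongr
    _ = 8 * ‖f‖ * (t ^ (1 / 2 : ℝ) / t) := by ring
    _ = 8 * ‖f‖ * t ^ (-(1 / 2) : ℝ) := by
        congr 1
        rw [← Real.rpow_sub_one ht0.ne']
        norm_num

theorem measurable_cot_half : Measurable fun t : ℝ => Real.cot (t / 2) := by
  have : (fun t : ℝ => Real.cot (t / 2)) = fun t => Real.cos (t / 2) / Real.sin (t / 2) :=
    funext fun t => Real.cot_eq_cos_div_sin _
  rw [this]
  fun_prop

theorem H1.measurable_hilbertIntegrand (f : H1) :
    Measurable fun p : ℝ × ℝ => hilbertIntegrand f p.1 p.2 := by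
  have h := f.continuous.measurable
  have h2 := measurable_cot_half.comp (measurable_snd : Measurable fun p : ℝ × ℝ => p.2)
  unfold hilbertIntegrand
  exact ((h.comp (measurable_fst.sub measurable_snd)).sub
    (h.comp (measurable_fst.add measurable_snd))).mul h2

theorem intervalIntegrable_weight (C : ℝ) (a b : ℝ) :
    IntervalIntegrable (fun t : ℝ => C * t ^ (-(1 / 2) : ℝ)) volume a b :=
  (intervalIntegral.intervalIntegrable_rpow' (by norm_num)).const_mul C

theorem H1.intervalIntegrable_hilbertIntegrand (f : H1) (α : ℝ) :
    IntervalIntegrable (hilbertIntegrand f α) volume 0 π := by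
  refine (intervalIntegrable_weight (8 * ‖f‖) 0 π).mono_fun
    (f.measurable_hilbertIntegrand.comp
      (measurable_const.prodMk measurable_id)).aestronglyMeasurable
    ?_
  filter_upwards [ae_restrict_mem measurableSet_uIoc] with t ht
  rw [uIoc_of_le Real.pi_pos.le] at ht
  refine (f.abs_hilbertIntegrand_le α ht).trans (le_abs_self _)

theorem tendsto_integral_left_endpoint {E : Type*} [NormedAddCommGroup E] [NormedSpace ℝ E]
    {F : ℝ → E} {R : ℝ} (hR : 0 < R) (h : IntervalIntegrable F volume 0 R) :
    Tendsto (fun ε => ∫ t in ε..R, F t) (𝓝[>] 0) (𝓝 (∫ t in (0 : ℝ)..R, F t)) := by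
  have h1 := intervalIntegral.continuousOn_primitive_interval_left (μ := volume)
    (f := F) (a := 0) (b := R)
    (by rw [uIcc_comm]; exact ((intervalIntegrable_iff' (by simp)).1 h.symm))
  have h2 := h1 0 left_mem_uIcc
  rw [uIcc_of_le hR.le] at h2
  exact h2.mono_left (nhdsWithin_le_of_mem (by
    filter_upwards [Ioc_mem_nhdsGT hR] with x hx using Ioc_subset_Icc_self hx))

/-- The principal value integral defining the Hilbert transform of an `H¹` function converges. -/
theorem H1.tendsto_pvPeriod (f : H1) (α : ℝ) :
    Tendsto (fun ε => ∫ x in {x | ε < |x - α| ∧ |x - α| ≤ π}, f x * Real.cot (1 / 2 * (α - x)))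
      (𝓝[>] (0 : ℝ)) (𝓝 (2 * π * foldedHilbert f α)) := by
  have h1 := tendsto_integral_left_endpoint Real.pi_pos (f.intervalIntegrable_hilbertIntegrand α)
  have h2 : 2 * π * foldedHilbert f α = ∫ t in (0 : ℝ)..π, hilbertIntegrand f α t := by
    rw [foldedHilbert]
    field_simp
  rw [h2]
  refine h1.congr' ?_
  filter_upwards [Ioc_mem_nhdsGT Real.pi_pos] with ε hε
  have hcot : ContinuousOn (fun t : ℝ => Real.cot (t / 2)) (uIcc ε π) := by
    have : (fun t : ℝ => Real.cot (t / 2)) = fun t => Real.cos (t / 2) / Real.sin (t / 2) :=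
      funext fun t => Real.cot_eq_cos_div_sin _
    rw [this]
    refine ContinuousOn.div (by fun_prop) (by fun_prop) fun t ht => ?_
    rw [uIcc_of_le hε.2] at ht
    exact (Real.sin_pos_of_pos_of_lt_pi (by linarith [hε.1, ht.1])
      (by linarith [ht.2, Real.pi_pos])).ne'
  have e1 (t : ℝ) : Real.cot (1 / 2 * (α - (α - t))) = Real.cot (t / 2) := by
    congr 1; ring
  have e2 (t : ℝ) : Real.cot (1 / 2 * (α - (α + t))) = -Real.cot (t / 2) := by
    rw [show 1 / 2 * (α - (α + t)) = -(t / 2) by ring, Real.cot_eq_cos_div_sin,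
      Real.cot_eq_cos_div_sin, Real.cos_neg, Real.sin_neg, div_neg]
  have hfc := f.continuous
  rw [setIntegral_annulus_closed, integral_annulus hε.1.le hε.2]
  · refine intervalIntegral.integral_congr fun t _ => ?_
    simp only [hilbertIntegrand, e1, e2]
    ring
  · simp only [e1]
    exact (ContinuousOn.mul (by fun_prop) hcot).intervalIntegrable
  · simp only [e2]
    exact (ContinuousOn.mul (by fun_prop) hcot.neg).intervalIntegrable

theorem H1.hilbert_eq_folded (f : H1) (α : ℝ) : hilbert f α = foldedHilbert f α := by
  rw [hilbert, pvPeriod, (f.tendsto_pvPeriod α).limUnder_eq]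
  field_simp

/-- By induction on `n`: consecutive values differ by the integral of a sum of two cosines. -/
theorem integral_sin_mul_cot (n : ℕ) :
    IntervalIntegrable (fun t => Real.sin (n * t) * Real.cot (t / 2)) volume 0 π ∧
    ∫ t in (0 : ℝ)..π, Real.sin (n * t) * Real.cot (t / 2) = if n = 0 then 0 else π := by
  induction n with
  | zero => simp
  | succ n ih =>
    have h1 : EqOn (fun t : ℝ => Real.sin (n * t) * Real.cot (t / 2) +
        (Real.cos ((n + 1 : ℕ) * t) + Real.cos (n * t)))
        (fun t => Real.sin ((n + 1 : ℕ) * t) * Real.cot (t / 2)) (uIoc 0 π) := by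
      intro t ht
      rw [uIoc_of_le Real.pi_pos.le] at ht
      have hs : Real.sin (t / 2) ≠ 0 := (Real.sin_pos_of_pos_of_lt_pi (by linarith [ht.1])
        (by linarith [ht.2, Real.pi_pos])).ne'
      have e1 : ((n + 1 : ℕ) : ℝ) * t = n * t + 2 * (t / 2) := by push_cast; ring
      have e2 : Real.cos (t / 2) ^ 2 = 1 - Real.sin (t / 2) ^ 2 := by
        linarith [Real.sin_sq_add_cos_sq (t / 2)]
      simp only
      rw [Real.cot_eq_cos_div_sin, e1, Real.sin_add, Real.cos_add, Real.sin_two_mul,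
        Real.cos_two_mul]
      field_simp
      ring_nf
      rw [show Real.cos (t * (1 / 2)) ^ 3 =
        Real.cos (t * (1 / 2)) * Real.cos (t * (1 / 2)) ^ 2 by ring]
      rw [show t * (1 / 2) = t / 2 by ring, e2]
      ring
    have hc (m : ℕ) : IntervalIntegrable (fun t : ℝ => Real.cos (m * t)) volume 0 π :=
      Continuous.intervalIntegrable (by fun_prop) _ _
    have hci (m : ℕ) : ∫ t in (0 : ℝ)..π, Real.cos (m * t) = if m = 0 then π else 0 := by
      split_ifs with hm
      · simp [hm]
      · have hm' : (m : ℝ) ≠ 0 := by exact_mod_cast hm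
        rw [intervalIntegral.integral_comp_mul_left (fun a => Real.cos a) hm', integral_cos]
        simp [Real.sin_nat_mul_pi]
    refine ⟨(ih.1.add ((hc (n + 1)).add (hc n))).congr h1, ?_⟩
    rw [← intervalIntegral.integral_congr_ae (ae_of_all _ h1), intervalIntegral.integral_add ih.1
      ((hc (n + 1)).add (hc n)), intervalIntegral.integral_add (hc (n + 1)) (hc n), ih.2, hci, hci]
    by_cases hn : n = 0 <;> simp [hn]

theorem intervalIntegral_comp_add_period {F : ℝ → ℂ} (hF : Function.Periodic F (2 * π)) (s : ℝ) :
    ∫ x in (0 : ℝ)..(2 * π), F (x + s) = ∫ x in (0 : ℝ)..(2 * π), F x := by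
  rw [intervalIntegral.integral_comp_add_right, zero_add, add_comm (2 * π) s,
    hF.intervalIntegral_add_eq s 0, zero_add]

/-- The Fourier coefficients of a translate. -/
theorem H1.integral_exp_mul_translate (f : H1) (n : ℤ) (s : ℝ) :
    ∫ x in (0 : ℝ)..(2 * π), Complex.exp (-(n * x * Complex.I)) * (f (x + s) : ℂ) =
      Complex.exp (n * s * Complex.I) * (2 * π * coef f n) := by
  have hper : Function.Periodic (fun x : ℝ => Complex.exp (-(n * x * Complex.I)) * (f x : ℂ))
      (2 * π) := fun x => by
    have e : Complex.exp (-(n * ((x + 2 * π : ℝ) : ℂ) * Complex.I)) =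
        Complex.exp (-(n * x * Complex.I)) := by
      push_cast
      rw [show -((n : ℂ) * (x + 2 * π) * Complex.I) =
        -(n * x * Complex.I) + -(n * (2 * π) * Complex.I) by ring, Complex.exp_add,
        exp_int_mul_two_pi, mul_one]
    simp only [e, f.periodic x]
  have hpi : (π : ℂ) ≠ 0 := by exact_mod_cast Real.pi_ne_zero
  have h2 : 2 * π * coef f n =
      ∫ x in (0 : ℝ)..(2 * π), Complex.exp (-(n * x * Complex.I)) * (f x : ℂ) := by
    rw [coef, ← mul_assoc, mul_one_div_cancel (by simp), one_mul]
  rw [h2, ← intervalIntegral_comp_add_period hper s, ← intervalIntegral.integral_const_mul]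
  refine intervalIntegral.integral_congr fun x _ => ?_
  rw [← mul_assoc, ← Complex.exp_add]
  congr 2
  push_cast
  ring

/-- The action of the folded Hilbert transform on exponentials: the symbol is the sign of the
frequency. -/
theorem integral_exp_sub_exp_mul_cot (n : ℤ) :
    ∫ t in (0 : ℝ)..π, (Complex.exp (-(n * t * Complex.I)) - Complex.exp (n * t * Complex.I)) *
      (Real.cot (t / 2) : ℂ) = -(2 * π * Complex.I * n.sign) := by
  have h1 (t : ℝ) : (Complex.exp (-(n * t * Complex.I)) - Complex.exp (n * t * Complex.I)) *
      (Real.cot (t / 2) : ℂ) = -(2 * Complex.I * n.sign) *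
        ((Real.sin (n.natAbs * t) * Real.cot (t / 2) : ℝ) : ℂ) := by
    have h2 : Real.sin (n * t) = n.sign * Real.sin (n.natAbs * t) := by
      conv_lhs => rw [← Int.sign_mul_natAbs n]
      rcases lt_trichotomy n 0 with h | h | h
      · rw [Int.sign_eq_neg_one_of_neg h]
        push_cast
        rw [show -1 * (|(n : ℝ)|) * t = -(|(n : ℝ)| * t) by ring, Real.sin_neg]
        simp
      · simp [h]
      · rw [Int.sign_eq_one_of_pos h]
        push_cast
        simp
    have h3 : Complex.exp (-(n * t * Complex.I)) - Complex.exp (n * t * Complex.I) =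
        -(2 * Complex.I) * (Real.sin (n * t) : ℂ) := by
      push_cast
      rw [Complex.sin, neg_mul ((n : ℂ) * t)]
      linear_combination (Complex.exp (-(n * t * Complex.I)) - Complex.exp (n * t * Complex.I)) *
        Complex.I_sq
    rw [h3, h2]
    push_cast
    ring
  simp only [h1]
  rw [intervalIntegral.integral_const_mul, intervalIntegral.integral_ofReal,
    (integral_sin_mul_cot _).2]
  by_cases hn : n = 0
  · simp [hn]
  · simp [hn]
    ring

/-- The Fourier coefficients of the Hilbert transform. -/
theorem H1.coef_foldedHilbert (f : H1) (n : ℤ) :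
    coef (foldedHilbert f) n = -(Complex.I * n.sign) * coef f n := by
  set F : ℝ → ℝ → ℂ := fun x t =>
    Complex.exp (-(n * x * Complex.I)) * (hilbertIntegrand f x t : ℂ) with hF
  have hint : IntegrableOn F.uncurry (uIoc 0 (2 * π) ×ˢ uIoc 0 π) := by
    rw [uIoc_of_le two_pi_nonneg, uIoc_of_le Real.pi_pos.le, IntegrableOn,
      Measure.volume_eq_prod, ← Measure.prod_restrict]
    have hw : Integrable (fun t : ℝ => 8 * ‖f‖ * t ^ (-(1 / 2) : ℝ)) (volume.restrict (Ioc 0 π)) :=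
      (intervalIntegrable_iff_integrableOn_Ioc_of_le Real.pi_pos.le).1
        (intervalIntegrable_weight (8 * ‖f‖) 0 π)
    refine (hw.comp_snd (volume.restrict (Ioc 0 (2 * π)))).mono' ?_ ?_
    · refine Measurable.aestronglyMeasurable ?_
      have h1 := f.measurable_hilbertIntegrand
      simp only [hF, Function.uncurry_def]
      fun_prop
    · rw [Measure.prod_restrict]
      filter_upwards [ae_restrict_mem (measurableSet_Ioc.prod measurableSet_Ioc)] with p hp
      simp only [hF, Function.uncurry_def, norm_mul, Complex.norm_real, Real.norm_eq_abs]
      have h1 : ‖Complex.exp (-(n * p.1 * Complex.I))‖ = 1 := by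
        have := Complex.norm_exp_ofReal_mul_I (-(n * p.1))
        push_cast at this
        rwa [neg_mul] at this
      rw [h1, one_mul]
      exact f.abs_hilbertIntegrand_le _ hp.2
  have hcf : (2 * π : ℂ) * coef (foldedHilbert f) n =
      1 / (2 * π) * ∫ x in (0 : ℝ)..(2 * π), ∫ t in (0 : ℝ)..π, F x t := by
    have hpi : (π : ℂ) ≠ 0 := by exact_mod_cast Real.pi_ne_zero
    rw [coef, ← mul_assoc, mul_one_div_cancel (by simp), one_mul,
      ← intervalIntegral.integral_const_mul]
    refine intervalIntegral.integral_congr fun x _ => ?_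
    simp only [hF, foldedHilbert]
    rw [intervalIntegral.integral_const_mul, intervalIntegral.integral_ofReal]
    push_cast
    ring
  rw [intervalIntegral_intervalIntegral_swap hint] at hcf
  have hin (t : ℝ) : ∫ x in (0 : ℝ)..(2 * π), F x t = (2 * π * coef f n) *
      ((Complex.exp (-(n * t * Complex.I)) - Complex.exp (n * t * Complex.I)) *
        (Real.cot (t / 2) : ℂ)) := by
    have hfc := f.continuous
    have e1 : ∀ x : ℝ, F x t = (Complex.exp (-(n * x * Complex.I)) * (f (x + -t) : ℂ)) *
        (Real.cot (t / 2) : ℂ) - (Complex.exp (-(n * x * Complex.I)) * (f (x + t) : ℂ)) *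
        (Real.cot (t / 2) : ℂ) := fun x => by
      simp only [hF, hilbertIntegrand, sub_eq_add_neg x t]
      push_cast
      ring
    simp only [e1]
    rw [intervalIntegral.integral_sub (Continuous.intervalIntegrable (by fun_prop) _ _)
      (Continuous.intervalIntegrable (by fun_prop) _ _), intervalIntegral.integral_mul_const,
      intervalIntegral.integral_mul_const, f.integral_exp_mul_translate,
      f.integral_exp_mul_translate]
    push_cast
    rw [show (n : ℂ) * -t * Complex.I = -(n * t * Complex.I) by ring]
    ring
  simp only [hin] at hcf
  rw [intervalIntegral.integral_const_mul, integral_exp_sub_exp_mul_cot] at hcf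
  have hpi : (2 * π : ℂ) ≠ 0 := by exact_mod_cast Real.two_pi_pos.ne'
  refine mul_left_cancel₀ hpi ?_
  rw [hcf]
  field_simp

theorem H1.continuous_foldedHilbert (f : H1) : Continuous (foldedHilbert f) := by
  have hfc := f.continuous
  refine continuous_const.mul ?_
  refine intervalIntegral.continuous_of_dominated_interval
    (bound := fun t => 8 * ‖f‖ * t ^ (-(1 / 2) : ℝ))
    (fun x => (f.measurable_hilbertIntegrand.comp
      (measurable_const.prodMk measurable_id)).aestronglyMeasurable)
    (fun x => ae_of_all _ fun t ht => ?_) (intervalIntegrable_weight _ _ _)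
    (ae_of_all _ fun t _ => ?_)
  · rw [uIoc_of_le Real.pi_pos.le] at ht
    exact f.abs_hilbertIntegrand_le x ht
  · unfold hilbertIntegrand
    fun_prop

/-- Continuous periodic functions are determined by their Fourier coefficients. -/
theorem eq_of_coef_of_continuous {f f' : ℝ → ℝ} (hf : Continuous f) (hf' : Continuous f')
    (hp : Function.Periodic f (2 * π)) (hp' : Function.Periodic f' (2 * π))
    (h : ∀ n, coef f n = coef f' n) : f = f' := by
  have h1 := hasSum_sq_coef (f := fun x => f x + (-1) * f' x)
    (memLp_of_continuousOn (by fun_prop))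
  have h0 : (fun n : ℤ => ‖coef (fun x => f x + (-1) * f' x) n‖ ^ 2) = fun _ => 0 := by
    funext n
    rw [coef_add (hf.intervalIntegrable _ _) (Continuous.intervalIntegrable (by fun_prop) _ _),
      coef_smul, h n]
    push_cast
    simp
  rw [h0] at h1
  have h2 := hasSum_zero.unique h1
  have h3 : ∫ x in (0 : ℝ)..(2 * π), (f x + (-1) * f' x) ^ 2 = 0 := by
    have := Real.pi_pos
    rcases mul_eq_zero.1 h2.symm with h | h
    · exact absurd h (by positivity)
    · exact h
  rw [intervalIntegral.integral_of_le two_pi_nonneg, integral_Ioc_eq_integral_Ioo,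
    setIntegral_eq_zero_iff_of_nonneg_ae (ae_of_all _ fun _ => sq_nonneg _)] at h3
  · have h4 : EqOn (fun x => (f x + (-1) * f' x) ^ 2) (fun _ => 0) (Ioo 0 (2 * π)) := by
      refine Measure.eqOn_Ioo_of_ae_eq volume h3 (by fun_prop) (by fun_prop)
    have h5 : EqOn (fun x => (f x + (-1) * f' x) ^ 2) (fun _ => 0) (Icc 0 (2 * π)) := by
      have := h4.closure (by fun_prop) continuous_const
      rwa [closure_Ioo Real.two_pi_pos.ne] at this
    have hpp : Function.Periodic (fun x => f x + (-1) * f' x) (2 * π) := fun x => by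
      simp only [hp x, hp' x]
    funext x
    obtain ⟨y, hy, hxy⟩ := hpp.exists_mem_Ico₀ Real.two_pi_pos x
    have h6 := h5 (Ico_subset_Icc_self hy)
    simp only at h6 hxy
    have h7 := pow_eq_zero_iff two_ne_zero |>.1 h6
    linarith
  · exact (Continuous.integrableOn_Icc (by fun_prop)).mono_set Ioo_subset_Icc_self

theorem foldedHilbert_periodic {f : ℝ → ℝ} (hf : Function.Periodic f (2 * π)) :
    Function.Periodic (foldedHilbert f) (2 * π) := fun x => by
  unfold foldedHilbert hilbertIntegrand
  congr 2
  funext t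
  rw [show x + 2 * π - t = x - t + 2 * π by ring, show x + 2 * π + t = x + t + 2 * π by ring,
    hf, hf]

/-- The symbol `-i sgn n` of the Hilbert transform. -/
theorem isSymbol_hilbert : IsSymbol (fun n => -(Complex.I * n.sign)) 1 where
  conj n := by simp
  bound n := by
    rcases lt_trichotomy n 0 with h | h | h
    · simp [Int.sign_eq_neg_one_of_neg h]
    · simp [h]
    · simp [Int.sign_eq_one_of_pos h]

/-- The Hilbert transform as a bounded operator on `H¹_per`. -/
def hilbertL : H1 →L[ℝ] H1 := multiplier isSymbol_hilbert

theorem coef_hilbertL (f : H1) (n : ℤ) : coef (hilbertL f) n = -(Complex.I * n.sign) * coef f n :=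
  coef_multiplier _ f n

theorem hilbertL_eq_folded (f : H1) : (hilbertL f : ℝ → ℝ) = foldedHilbert f :=
  eq_of_coef_of_continuous (hilbertL f).continuous f.continuous_foldedHilbert
    (hilbertL f).periodic (foldedHilbert_periodic f.periodic) fun n => by
      rw [coef_hilbertL, f.coef_foldedHilbert]

/-- The principal value Hilbert transform of an `H¹` function is the Fourier multiplier with
symbol `-i sgn n`. -/
theorem H1.hilbert_eq (f : H1) : hilbert f = hilbertL f := by
  rw [hilbertL_eq_folded]
  exact funext f.hilbert_eq_folded

theorem mean_hilbertL (f : H1) : mean (hilbertL f) = 0 := by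
  have h := coef_hilbertL f 0
  rw [coef_zero_eq_mean] at h
  simpa using h

theorem hilbertL_const (a : ℝ) : hilbertL (H1.const a) = 0 := H1.ext fun x => by
  rw [hilbertL_eq_folded]
  simp [foldedHilbert, hilbertIntegrand]

theorem hilbertL_even_of_odd {f : H1} (hf : ∀ x, f (-x) = -f x) (x : ℝ) :
    hilbertL f (-x) = hilbertL f x := by
  simp only [hilbertL_eq_folded, foldedHilbert, hilbertIntegrand]
  congr 2
  funext t
  rw [show -x - t = -(x + t) by ring, show -x + t = -(x - t) by ring, hf, hf]
  ring

/-! ### The logarithmic kernel of a periodic curve -/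

/-- A `2π`-periodic perturbation `ζ` of the real line, of class `C^{1,1/2}`, with derivative `v`;
the constant `δ` measures the size of the perturbation. -/
structure IsCurve (ζ v : ℝ → ℂ) (δ : ℝ) : Prop where
  nonneg : 0 ≤ δ
  small : δ ≤ 1 / 16
  hasDerivAt : ∀ x, HasDerivAt ζ (v x) x
  shift : ∀ x, ζ (x + 2 * π) = ζ x + 2 * π
  near : ∀ x, ‖v x - 1‖ ≤ δ
  holder : ∀ a b, |a - b| ≤ 2 * π → ‖v a - v b‖ ≤ δ * √|a - b|
  continuous : Continuous v

theorem norm_sin_sub_self_le {h : ℂ} (hh : ‖h‖ ≤ 1) : ‖Complex.sin h - h‖ ≤ ‖h‖ ^ 2 := by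
  have h1 := Complex.norm_exp_sub_one_sub_id_le (x := h * Complex.I) (by simpa using hh)
  have h2 := Complex.norm_exp_sub_one_sub_id_le (x := -h * Complex.I) (by simpa using hh)
  have e : Complex.sin h - h = ((Complex.exp (-h * Complex.I) - 1 - -h * Complex.I) -
      (Complex.exp (h * Complex.I) - 1 - h * Complex.I)) * (Complex.I / 2) := by
    rw [Complex.sin]
    linear_combination (-h) * Complex.I_sq
  rw [e, norm_mul]
  simp only [norm_mul, norm_neg, Complex.norm_I, mul_one] at h1 h2
  have h3 : ‖Complex.I / 2‖ = 1 / 2 := by simp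
  rw [h3]
  have := norm_sub_le (Complex.exp (-h * Complex.I) - 1 - -h * Complex.I)
    (Complex.exp (h * Complex.I) - 1 - h * Complex.I)
  linarith

theorem norm_cos_sub_one_le {h : ℂ} (hh : ‖h‖ ≤ 1) : ‖Complex.cos h - 1‖ ≤ ‖h‖ ^ 2 := by
  have h1 := Complex.norm_exp_sub_one_sub_id_le (x := h * Complex.I) (by simpa using hh)
  have h2 := Complex.norm_exp_sub_one_sub_id_le (x := -h * Complex.I) (by simpa using hh)
  have e : Complex.cos h - 1 = ((Complex.exp (-h * Complex.I) - 1 - -h * Complex.I) +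
      (Complex.exp (h * Complex.I) - 1 - h * Complex.I)) * (1 / 2) := by
    rw [Complex.cos]
    ring
  rw [e, norm_mul]
  simp only [norm_mul, norm_neg, Complex.norm_I, mul_one] at h1 h2
  have h3 : ‖(1 / 2 : ℂ)‖ = 1 / 2 := by simp
  rw [h3]
  have := norm_add_le (Complex.exp (-h * Complex.I) - 1 - -h * Complex.I)
    (Complex.exp (h * Complex.I) - 1 - h * Complex.I)
  linarith

theorem abs_sin_half_ge {t : ℝ} (ht : |t| ≤ π) : |t| / π ≤ |Real.sin (t / 2)| := by
  have h := Real.mul_abs_le_abs_sin (x := t / 2) (by rw [abs_div, abs_two]; linarith)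
  rw [abs_div, abs_two] at h
  calc |t| / π = 2 / π * (|t| / 2) := by ring
    _ ≤ _ := h

theorem sin_half_eq_zero_iff {t : ℝ} (ht : |t| ≤ π) : Real.sin (t / 2) = 0 ↔ t = 0 := by
  constructor
  · intro h
    have h1 := abs_sin_half_ge ht
    rw [h, abs_zero] at h1
    have h2 : |t| / π * π ≤ 0 * π := mul_le_mul_of_nonneg_right h1 Real.pi_pos.le
    rw [div_mul_cancel₀ _ Real.pi_ne_zero, zero_mul] at h2
    exact abs_nonpos_iff.1 h2
  · rintro rfl
    simp

/-- The ratio `sin((ζ(s) - ζ(x))/2) / sin((s - x)/2)`, continuously extended to the diagonal. -/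
def ratio (ζ v : ℝ → ℂ) (s x : ℝ) : ℂ :=
  if Real.sin ((s - x) / 2) = 0 then v s
  else Complex.sin ((ζ s - ζ x) / 2) / (Real.sin ((s - x) / 2) : ℝ)

/-- The kernel `ζ'(s) cot((ζ(s) - ζ(x))/2) - cot((s - x)/2)`. -/
def cotKernel (ζ v : ℝ → ℂ) (s x : ℝ) : ℂ :=
  v s * Complex.cot ((ζ s - ζ x) / 2) - (Real.cot ((s - x) / 2) : ℝ)

/-- The integrable singular weight `|sin(t/2)|^{-1/2}`. -/
def weight (t : ℝ) : ℝ := |Real.sin (t / 2)| ^ (-(1 / 2) : ℝ)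

theorem weight_nonneg (t : ℝ) : 0 ≤ weight t := Real.rpow_nonneg (abs_nonneg _) _

theorem weight_periodic : Function.Periodic weight (2 * π) := fun t => by
  rw [weight, weight, show (t + 2 * π) / 2 = t / 2 + π by ring, Real.sin_add_pi, abs_neg]

theorem weight_neg (t : ℝ) : weight (-t) = weight t := by
  rw [weight, weight, neg_div, Real.sin_neg, abs_neg]

theorem measurable_weight : Measurable weight := by
  unfold weight
  fun_prop

theorem intervalIntegrable_weight' (a b : ℝ) : IntervalIntegrable weight volume a b := by
  -- on `[0, π]` the weight is at most `2 t^{-1/2}`; the rest follows by symmetry and periodicity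
  have h1 : IntervalIntegrable weight volume 0 π := by
    refine (intervalIntegrable_weight 2 0 π).mono_fun measurable_weight.aestronglyMeasurable ?_
    filter_upwards [ae_restrict_mem measurableSet_uIoc] with t ht
    rw [uIoc_of_le Real.pi_pos.le] at ht
    have h2 := abs_sin_half_ge (t := t) (by rw [abs_of_pos ht.1]; exact ht.2)
    rw [abs_of_pos ht.1] at h2
    have ht0 := ht.1
    rw [Real.norm_of_nonneg (weight_nonneg _), Real.norm_of_nonneg (by positivity), weight]
    calc |Real.sin (t / 2)| ^ (-(1 / 2) : ℝ) ≤ (t / π) ^ (-(1 / 2) : ℝ) :=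
          Real.rpow_le_rpow_of_nonpos (by positivity) h2 (by norm_num)
      _ = π ^ (1 / 2 : ℝ) * t ^ (-(1 / 2) : ℝ) := by
          rw [Real.div_rpow ht0.le Real.pi_pos.le, Real.rpow_neg Real.pi_pos.le]
          field_simp
      _ ≤ 2 * t ^ (-(1 / 2) : ℝ) := by
          refine mul_le_mul_of_nonneg_right ?_ (by positivity)
          rw [← Real.sqrt_eq_rpow]
          refine Real.sqrt_le_iff.2 ⟨by norm_num, ?_⟩
          linarith [Real.pi_lt_four]
  have h2 : IntervalIntegrable weight volume (-π) 0 := by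
    have := ((IntervalIntegrable.iff_comp_neg (f := weight) (a := 0) (b := π) (by simp)).1 h1).symm
    simpa [weight_neg] using this
  have h3 : IntervalIntegrable weight volume (-π) (-π + 2 * π) := by
    rw [show -π + 2 * π = π by ring]
    exact h2.trans h1
  exact weight_periodic.intervalIntegrable Real.two_pi_pos.ne' h3 a b

namespace IsCurve

variable {ζ v : ℝ → ℂ} {δ : ℝ}

/-- Chords of the curve are close to chords of the line, to first order in their length. -/
theorem chord_near (hc : IsCurve ζ v δ) (a b : ℝ) :
    ‖(ζ a - ζ b) - ((a - b : ℝ) : ℂ)‖ ≤ δ * |a - b| := by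
  have h := convex_univ.norm_image_sub_le_of_norm_hasDerivWithin_le
    (f := fun x : ℝ => ζ x - (x : ℂ)) (f' := fun x => v x - 1) (C := δ)
    (fun x _ => ((hc.hasDerivAt x).sub (hasDerivAt_id x).ofReal_comp).hasDerivWithinAt)
    (fun x _ => hc.near x) (mem_univ b) (mem_univ a)
  rw [Real.norm_eq_abs] at h
  have e : (ζ a - ζ b) - ((a - b : ℝ) : ℂ) = ζ a - a - (ζ b - b) := by
    push_cast
    ring
  rw [e]
  exact h

/-- The Hölder condition on the derivative gives the tangent line approximation an error of order
`3/2` in the length. -/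
theorem chord_taylor (hc : IsCurve ζ v δ) {a b : ℝ} (hab : |a - b| ≤ 2 * π) :
    ‖v a * ((a - b : ℝ) : ℂ) - (ζ a - ζ b)‖ ≤ δ * √|a - b| * |a - b| := by
  have h := (convex_uIcc a b).norm_image_sub_le_of_norm_hasDerivWithin_le
    (f := fun x : ℝ => v a * (x : ℂ) - ζ x) (f' := fun x => v a * 1 - v x) (C := δ * √|a - b|)
    (fun x _ => (((hasDerivAt_id x).ofReal_comp.const_mul (v a)).sub
      (hc.hasDerivAt x)).hasDerivWithinAt)
    (fun x hx => ?_) right_mem_uIcc left_mem_uIcc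
  · rw [Real.norm_eq_abs] at h
    have e : v a * ((a - b : ℝ) : ℂ) - (ζ a - ζ b) = v a * a - ζ a - (v a * b - ζ b) := by
      push_cast
      ring
    rw [e]
    exact h
  · have h1 : |a - x| ≤ |a - b| := by
      rw [abs_sub_comm a x, abs_sub_comm a b]
      exact abs_sub_left_of_mem_uIcc hx
    rw [mul_one]
    refine (hc.holder a x (h1.trans hab)).trans ?_
    exact mul_le_mul_of_nonneg_left (Real.sqrt_le_sqrt h1) hc.nonneg

theorem v_periodic (hc : IsCurve ζ v δ) : Function.Periodic v (2 * π) := fun x => by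
  have h1 := (hc.hasDerivAt (x + 2 * π)).comp_add_const x (2 * π)
  have h2 : (fun y => ζ (y + 2 * π)) = fun y => ζ y + 2 * π := funext hc.shift
  rw [h2] at h1
  exact h1.unique ((hc.hasDerivAt x).add_const _)

theorem continuous_curve (hc : IsCurve ζ v δ) : Continuous ζ :=
  continuous_iff_continuousAt.2 fun x => (hc.hasDerivAt x).continuousAt

theorem ratio_symm (hc : IsCurve ζ v δ) (s x : ℝ) : ratio ζ v s x = ratio ζ v x s := by
  have e : Real.sin ((x - s) / 2) = -Real.sin ((s - x) / 2) := by
    rw [← Real.sin_neg]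
    congr 1
    ring
  unfold ratio
  by_cases h : Real.sin ((s - x) / 2) = 0
  · rw [if_pos h, if_pos (by rw [e, h, neg_zero])]
    obtain ⟨n, hn⟩ := Real.sin_eq_zero_iff.1 h
    have : s = x + n * (2 * π) := by linarith
    rw [this]
    exact hc.v_periodic.int_mul n x
  · rw [if_neg h, if_neg (by rw [e]; exact neg_ne_zero.2 h), e,
      show (ζ x - ζ s) / 2 = -((ζ s - ζ x) / 2) by ring, Complex.sin_neg]
    push_cast
    rw [neg_div_neg_eq]

theorem ratio_periodic (hc : IsCurve ζ v δ) (x : ℝ) :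
    Function.Periodic (fun s => ratio ζ v s x) (2 * π) := fun s => by
  have e : Real.sin ((s + 2 * π - x) / 2) = -Real.sin ((s - x) / 2) := by
    rw [show (s + 2 * π - x) / 2 = (s - x) / 2 + π by ring, Real.sin_add_pi]
  have e2 : Complex.sin ((ζ (s + 2 * π) - ζ x) / 2) = -Complex.sin ((ζ s - ζ x) / 2) := by
    rw [hc.shift, show (ζ s + 2 * π - ζ x) / 2 = (ζ s - ζ x) / 2 + π by ring, Complex.sin_add_pi]
  simp only [ratio, e, e2, neg_eq_zero, hc.v_periodic s]
  push_cast
  rw [neg_div_neg_eq]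

theorem cotKernel_periodic (hc : IsCurve ζ v δ) (x : ℝ) :
    Function.Periodic (fun s => cotKernel ζ v s x) (2 * π) := fun s => by
  simp only [cotKernel, Complex.cot_eq_cos_div_sin, Real.cot_eq_cos_div_sin, hc.shift,
    hc.v_periodic s]
  rw [show (ζ s + 2 * π - ζ x) / 2 = (ζ s - ζ x) / 2 + π by ring, Complex.sin_add_pi,
    Complex.cos_add_pi, show (s + 2 * π - x) / 2 = (s - x) / 2 + π by ring, Real.sin_add_pi,
    Real.cos_add_pi, neg_div_neg_eq, neg_div_neg_eq]

/-- Half the deviation of a chord of the curve from the corresponding chord of the line. -/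
theorem exists_dev (hc : IsCurve ζ v δ) {s x : ℝ} (ht : |s - x| ≤ π) :
    ∃ h : ℂ, (ζ s - ζ x) / 2 = (((s - x) / 2 : ℝ) : ℂ) + h ∧ ‖h‖ ≤ δ * |s - x| / 2 ∧ ‖h‖ ≤ 1 / 8 ∧
      ‖(v s - 1) * (((s - x) / 2 : ℝ) : ℂ) - h‖ ≤ δ * √|s - x| * |s - x| / 2 := by
  have h1 := hc.chord_near s x
  have h2 := hc.chord_taylor (a := s) (b := x) (by linarith [Real.pi_pos])
  set d : ℂ := (ζ s - ζ x) - ((s - x : ℝ) : ℂ) with hd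
  have hn : ‖d / 2‖ = ‖d‖ / 2 := by simp
  refine ⟨d / 2, ?_, ?_, ?_, ?_⟩
  · rw [hd]
    push_cast
    ring
  · rw [hn]
    linarith
  · rw [hn]
    have : δ * |s - x| ≤ 1 / 16 * 4 :=
      mul_le_mul hc.small (ht.trans Real.pi_lt_four.le) (abs_nonneg _) (by norm_num)
    linarith
  · have e : (v s - 1) * (((s - x) / 2 : ℝ) : ℂ) - d / 2 =
        (v s * ((s - x : ℝ) : ℂ) - (ζ s - ζ x)) / 2 := by
      rw [hd]
      push_cast
      ring
    rw [e]
    have hn2 : ‖(v s * ((s - x : ℝ) : ℂ) - (ζ s - ζ x)) / 2‖ =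
      ‖v s * ((s - x : ℝ) : ℂ) - (ζ s - ζ x)‖ / 2 := by simp
    rw [hn2]
    linarith

theorem sin_chord_near (hc : IsCurve ζ v δ) {s x : ℝ} (ht : |s - x| ≤ π) :
    ‖Complex.sin ((ζ s - ζ x) / 2) - (Real.sin ((s - x) / 2) : ℝ)‖ ≤
      5 * δ * |Real.sin ((s - x) / 2)| := by
  obtain ⟨h, he, hh, h1, -⟩ := hc.exists_dev ht
  set S : ℝ := Real.sin ((s - x) / 2)
  set C : ℝ := Real.cos ((s - x) / 2)
  have e1 : Complex.sin ((ζ s - ζ x) / 2) - (S : ℂ) =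
      S * (Complex.cos h - 1) + C * ((Complex.sin h - h) + h) := by
    rw [he, Complex.sin_add, ← Complex.ofReal_sin, ← Complex.ofReal_cos]
    ring
  have hS : |S| ≤ 1 := Real.abs_sin_le_one _
  have hC : |C| ≤ 1 := Real.abs_cos_le_one _
  have b1 := norm_cos_sub_one_le (h := h) (by linarith)
  have b2 := norm_sin_sub_self_le (h := h) (by linarith)
  have h0 := norm_nonneg h
  have hsq : ‖h‖ ^ 2 ≤ ‖h‖ * (1 / 8) := by nlinarith
  have hle : ‖Complex.sin ((ζ s - ζ x) / 2) - (S : ℂ)‖ ≤ 3 * ‖h‖ := by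
    rw [e1]
    refine (norm_add_le _ _).trans ?_
    rw [norm_mul, norm_mul, Complex.norm_real, Complex.norm_real]
    have c1 : ‖S‖ * ‖Complex.cos h - 1‖ ≤ 1 * ‖h‖ ^ 2 := by gcongr; exact hS
    have c2 : ‖C‖ * ‖Complex.sin h - h + h‖ ≤ 1 * (‖h‖ ^ 2 + ‖h‖) := by
      gcongr
      · exact hC
      · exact (norm_add_le _ _).trans (by linarith)
    linarith
  have hlow := abs_sin_half_ge ht
  rw [div_le_iff₀ Real.pi_pos] at hlow
  have h3 : |s - x| ≤ 3.2 * |S| := by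
    have := Real.pi_lt_d2
    nlinarith [abs_nonneg S]
  have h4 : δ * |s - x| ≤ δ * (3.2 * |S|) := mul_le_mul_of_nonneg_left h3 hc.nonneg
  have h5 : 0 ≤ δ * |S| := mul_nonneg hc.nonneg (abs_nonneg _)
  nlinarith

theorem ratio_near (hc : IsCurve ζ v δ) (s x : ℝ) : ‖ratio ζ v s x - 1‖ ≤ 5 * δ := by
  obtain ⟨y, hy, hxy⟩ := (hc.ratio_periodic x).exists_mem_Ico Real.two_pi_pos s (x - π)
  rw [hxy]
  have ht : |y - x| ≤ π := by
    rw [abs_le]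
    constructor <;> linarith [hy.1, hy.2]
  unfold ratio
  split_ifs with h
  · exact (hc.near y).trans (by linarith [hc.nonneg])
  · have hS : (Real.sin ((y - x) / 2) : ℂ) ≠ 0 := by exact_mod_cast h
    rw [div_sub_one hS, norm_div, Complex.norm_real, Real.norm_eq_abs, div_le_iff₀ (abs_pos.2 h)]
    exact hc.sin_chord_near ht

theorem sin_chord_ge (hc : IsCurve ζ v δ) {s x : ℝ} (ht : |s - x| ≤ π) :
    |Real.sin ((s - x) / 2)| / 2 ≤ ‖Complex.sin ((ζ s - ζ x) / 2)‖ := by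
  have h1 := hc.sin_chord_near ht
  have h2 := norm_sub_norm_le ((Real.sin ((s - x) / 2) : ℝ) : ℂ) (Complex.sin ((ζ s - ζ x) / 2))
  rw [norm_sub_rev, Complex.norm_real, Real.norm_eq_abs] at h2
  have h3 : 5 * δ * |Real.sin ((s - x) / 2)| ≤ 1 / 2 * |Real.sin ((s - x) / 2)| :=
    mul_le_mul_of_nonneg_right (by linarith [hc.small]) (abs_nonneg _)
  linarith

theorem sin_chord_ne_zero (hc : IsCurve ζ v δ) {s x : ℝ} (h : Real.sin ((s - x) / 2) ≠ 0) :
    Complex.sin ((ζ s - ζ x) / 2) ≠ 0 := by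
  intro h0
  have h1 := hc.ratio_near s x
  rw [ratio, if_neg h, h0, zero_div, zero_sub, norm_neg, norm_one] at h1
  linarith [hc.small]

/-- The singularities of the two cotangents cancel up to an integrable error. -/
theorem norm_cotKernel_le (hc : IsCurve ζ v δ) (s x : ℝ) :
    ‖cotKernel ζ v s x‖ ≤ 80 * δ * weight (s - x) := by
  -- both sides are periodic, so `|s - x| ≤ π` may be assumed
  have hper : Function.Periodic (fun s => ‖cotKernel ζ v s x‖ - 80 * δ * weight (s - x)) (2 * π) :=
    fun s => by
      have h1 := hc.cotKernel_periodic x s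
      have h2 := weight_periodic (s - x)
      simp only at h1 ⊢
      rw [h1, show s + 2 * π - x = s - x + 2 * π by ring, h2]
  obtain ⟨y, hy, hxy⟩ := hper.exists_mem_Ico Real.two_pi_pos s (x - π)
  rw [← sub_nonpos, hxy, sub_nonpos]
  have ht : |y - x| ≤ π := by
    rw [abs_le]
    constructor <;> linarith [hy.1, hy.2]
  clear hxy hper
  have hδ := hc.nonneg
  rcases eq_or_ne y x with rfl | hne
  · have : cotKernel ζ v y y = 0 := by
      simp [cotKernel, Complex.cot_eq_cos_div_sin, Real.cot_eq_cos_div_sin]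
    rw [this, norm_zero]
    exact mul_nonneg (by positivity) (weight_nonneg _)
  have hS0 : Real.sin ((y - x) / 2) ≠ 0 := fun h0 =>
    hne (sub_eq_zero.1 ((sin_half_eq_zero_iff ht).1 h0))
  have hge := hc.sin_chord_ge ht
  have hlow := abs_sin_half_ge ht
  have hZ0 := hc.sin_chord_ne_zero hS0
  have hnear := hc.near y
  obtain ⟨h, he, hh, h1, htay⟩ := hc.exists_dev ht
  set t : ℝ := y - x with ht_def
  have htpos : 0 < |t| := abs_pos.2 (sub_ne_zero.2 hne)
  set e : ℂ := v y - 1 with he_def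
  have hv : v y = 1 + e := by rw [he_def]; ring
  set S : ℝ := Real.sin (t / 2) with hSd
  set C : ℝ := Real.cos (t / 2) with hCd
  set Z : ℂ := Complex.sin ((ζ y - ζ x) / 2) with hZd
  have eS : Z = S * Complex.cos h + C * Complex.sin h := by
    rw [hZd, he, Complex.sin_add, ← Complex.ofReal_sin, ← Complex.ofReal_cos]
  have eC : Complex.cos ((ζ y - ζ x) / 2) = C * Complex.cos h - S * Complex.sin h := by
    rw [he, Complex.cos_add, ← Complex.ofReal_sin, ← Complex.ofReal_cos]
  have hSC : (S : ℂ) ^ 2 + (C : ℂ) ^ 2 = 1 := by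
    exact_mod_cast Real.sin_sq_add_cos_sq (t / 2)
  have hSC2 : (C : ℂ) * S = ((Real.sin t / 2 : ℝ) : ℂ) := by
    have : Real.sin t = 2 * S * C := by
      rw [hSd, hCd, ← Real.sin_two_mul]
      congr 1
      ring
    rw [this]
    push_cast
    ring
  -- common denominator, and an expansion of the numerator into quantities of order `|t|^{3/2}`
  have hSc : (S : ℂ) ≠ 0 := by exact_mod_cast hS0
  have key : cotKernel ζ v y x = ((e * ((t / 2 : ℝ) : ℂ) - h) +
      e * (((Real.sin t / 2 : ℝ) : ℂ) * (Complex.cos h - 1) + (((Real.sin t - t) / 2 : ℝ) : ℂ)) -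
      (Complex.sin h - h) - e * S ^ 2 * Complex.sin h) / (Z * S) := by
    rw [cotKernel, Complex.cot_eq_cos_div_sin, Real.cot_eq_cos_div_sin, eC, hv, ← hZd,
      eq_div_iff (mul_ne_zero hZ0 hSc), ← ht_def, ← hSd, ← hCd]
    have e3 : ((1 + e) * ((C * Complex.cos h - S * Complex.sin h) / Z) -
        ((C / S : ℝ) : ℂ)) * (Z * S) =
        (1 + e) * (C * Complex.cos h - S * Complex.sin h) * S - C * Z := by
      push_cast
      field_simp
    rw [e3, eS]
    have e4 : (((Real.sin t - t) / 2 : ℝ) : ℂ) = (C : ℂ) * S - ((t / 2 : ℝ) : ℂ) := by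
      rw [hSC2]
      push_cast
      ring
    rw [e4, ← hSC2]
    linear_combination (-Complex.sin h) * hSC
  have hcos := norm_cos_sub_one_le (h := h) (by linarith)
  have hsin := norm_sin_sub_self_le (h := h) (by linarith)
  have h0 := norm_nonneg h
  have hS1 : |S| ≤ 1 := Real.abs_sin_le_one _
  have hS2 : |S| ≤ |t| / 2 := by
    have := Real.abs_sin_le_abs (x := t / 2)
    rwa [abs_div, abs_two] at this
  set q : ℝ := √|t| with hq
  have hq2 : q ^ 2 = |t| := Real.sq_sqrt (abs_nonneg _)
  have hq0 : 0 < q := Real.sqrt_pos.2 htpos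
  have hq3 : q ≤ 2 := by
    rw [hq]
    exact Real.sqrt_le_iff.2 ⟨by norm_num, by linarith [Real.pi_lt_four]⟩
  have hhq : ‖h‖ ≤ δ * q ^ 2 / 2 := by rw [hq2]; exact hh
  have hhsq : ‖h‖ ^ 2 ≤ δ * q ^ 2 / 2 * (1 / 8) := by nlinarith
  have hδ1 := hc.small
  have hq34 : q ^ 4 ≤ 2 * q ^ 3 := by nlinarith [pow_pos hq0 3]
  have hhsq' : ‖h‖ ^ 2 ≤ δ * q ^ 4 / 64 := by
    calc ‖h‖ ^ 2 ≤ (δ * q ^ 2 / 2) ^ 2 := pow_le_pow_left₀ h0 hhq 2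
      _ = δ * (δ * q ^ 4 / 4) := by ring
      _ ≤ 1 / 16 * (δ * q ^ 4 / 4) := by gcongr
      _ = _ := by ring
  have n1 : ‖e * ((t / 2 : ℝ) : ℂ) - h‖ ≤ δ * q ^ 3 / 2 := by
    calc _ ≤ δ * √|t| * |t| / 2 := htay
      _ = δ * q ^ 3 / 2 := by rw [← hq, ← hq2]; ring
  have n2 : ‖e * (((Real.sin t / 2 : ℝ) : ℂ) * (Complex.cos h - 1) +
      (((Real.sin t - t) / 2 : ℝ) : ℂ))‖ ≤ δ * q ^ 4 := by
    rw [norm_mul]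
    refine mul_le_mul hnear ?_ (norm_nonneg _) hδ
    refine (norm_add_le _ _).trans ?_
    rw [norm_mul, Complex.norm_real, Complex.norm_real, Real.norm_eq_abs, Real.norm_eq_abs,
      abs_div, abs_div, abs_two]
    have c1 : |Real.sin t| / 2 * ‖Complex.cos h - 1‖ ≤ 1 / 2 * ‖h‖ ^ 2 := by
      gcongr
      exact Real.abs_sin_le_one t
    have c2 := abs_sin_sub_le t
    have c3 : t ^ 2 = q ^ 4 := by
      rw [← sq_abs, ← hq2]
      ring
    have c4 : δ * q ^ 4 ≤ 1 / 16 * q ^ 4 := by gcongr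
    rw [c3] at c2
    have c5 : 0 ≤ q ^ 4 := by positivity
    linarith
  have n3 : ‖Complex.sin h - h‖ ≤ δ * q ^ 4 / 64 := hsin.trans hhsq'
  have n4 : ‖e * S ^ 2 * Complex.sin h‖ ≤ δ * q ^ 4 / 4 := by
    rw [norm_mul, norm_mul, norm_pow, Complex.norm_real, Real.norm_eq_abs]
    have c1 : ‖Complex.sin h‖ ≤ 1 := by
      have : Complex.sin h = (Complex.sin h - h) + h := by ring
      rw [this]
      refine (norm_add_le _ _).trans ?_
      nlinarith
    have c2 : |S| ^ 2 ≤ q ^ 4 / 4 := by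
      calc |S| ^ 2 ≤ (|t| / 2) ^ 2 := pow_le_pow_left₀ (abs_nonneg _) hS2 2
        _ = q ^ 4 / 4 := by rw [← hq2]; ring
    calc ‖e‖ * |S| ^ 2 * ‖Complex.sin h‖ ≤ δ * (q ^ 4 / 4) * 1 := by gcongr
      _ = _ := by ring
  have hnum : ‖(e * ((t / 2 : ℝ) : ℂ) - h) +
      e * (((Real.sin t / 2 : ℝ) : ℂ) * (Complex.cos h - 1) + (((Real.sin t - t) / 2 : ℝ) : ℂ)) -
      (Complex.sin h - h) - e * S ^ 2 * Complex.sin h‖ ≤ 4 * δ * q ^ 3 := by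
    refine (norm_sub_le _ _).trans ?_
    have d1 := norm_sub_le ((e * ((t / 2 : ℝ) : ℂ) - h) +
      e * (((Real.sin t / 2 : ℝ) : ℂ) * (Complex.cos h - 1) + (((Real.sin t - t) / 2 : ℝ) : ℂ)))
      (Complex.sin h - h)
    have d2 := norm_add_le (e * ((t / 2 : ℝ) : ℂ) - h)
      (e * (((Real.sin t / 2 : ℝ) : ℂ) * (Complex.cos h - 1) + (((Real.sin t - t) / 2 : ℝ) : ℂ)))
    have d3 : δ * q ^ 4 ≤ δ * (2 * q ^ 3) := mul_le_mul_of_nonneg_left hq34 hδ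
    have d4 : 0 ≤ δ * q ^ 3 := by positivity
    linarith
  have hden : q ^ 4 / 20 ≤ ‖Z * S‖ := by
    rw [norm_mul, Complex.norm_real, Real.norm_eq_abs]
    have hS3 : q ^ 2 / 3.15 ≤ |S| := by
      refine le_trans ?_ hlow
      rw [hq2]
      exact div_le_div_of_nonneg_left (abs_nonneg _) Real.pi_pos Real.pi_lt_d2.le
    have hS4 : 0 ≤ q ^ 2 / 3.15 := by positivity
    calc q ^ 4 / 20 ≤ (q ^ 2 / 3.15) / 2 * (q ^ 2 / 3.15) := by
          rw [show (q ^ 2 / 3.15) / 2 * (q ^ 2 / 3.15) = q ^ 4 / (2 * 3.15 ^ 2) by ring]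
          exact div_le_div_of_nonneg_left (by positivity) (by norm_num) (by norm_num)
      _ ≤ |S| / 2 * |S| := by gcongr
      _ ≤ ‖Z‖ * |S| := by gcongr
  have hw : 1 / q ≤ weight t := by
    rw [weight, ← hSd]
    have h3 : 1 / q = |t| ^ (-(1 / 2) : ℝ) := by
      rw [Real.rpow_neg (abs_nonneg _), ← Real.sqrt_eq_rpow, one_div]
    rw [h3]
    exact Real.rpow_le_rpow_of_nonpos (abs_pos.2 hS0) (by linarith) (by norm_num)
  rw [key, norm_div]
  calc _ ≤ 4 * δ * q ^ 3 / (q ^ 4 / 20) :=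
        div_le_div₀ (by positivity) hnum (by positivity) hden
    _ = 80 * δ * (1 / q) := by field_simp; ring
    _ ≤ 80 * δ * weight t := by gcongr

end IsCurve

/-! ### The logarithm of the chord ratio -/

/-- The logarithm of `ratio`. -/
def logRatio (ζ v : ℝ → ℂ) (s x : ℝ) : ℂ := Complex.log (ratio ζ v s x)

theorem countable_sin_half_eq_zero (x : ℝ) : {s : ℝ | Real.sin ((s - x) / 2) = 0}.Countable := by
  refine (countable_range fun n : ℤ => x + n * (2 * π)).mono fun s hs => ?_
  obtain ⟨n, hn⟩ := Real.sin_eq_zero_iff.1 hs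
  exact ⟨n, by simp only; linarith⟩

namespace IsCurve

variable {ζ v : ℝ → ℂ} {δ : ℝ}

theorem hasDerivAt_sin_chord (hc : IsCurve ζ v δ) (s x : ℝ) :
    HasDerivAt (fun s => Complex.sin ((ζ s - ζ x) / 2))
      (Complex.cos ((ζ s - ζ x) / 2) * (v s / 2)) s :=
  (Complex.hasDerivAt_sin _).comp s (((hc.hasDerivAt s).sub_const (ζ x)).div_const 2)

theorem hasDerivAt_sin_half (s x : ℝ) :
    HasDerivAt (fun s => ((Real.sin ((s - x) / 2) : ℝ) : ℂ))
      ((Real.cos ((s - x) / 2) * (1 / 2) : ℝ) : ℂ) s :=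
  ((((hasDerivAt_id s).sub_const x).div_const 2).sin).ofReal_comp

theorem continuous_ratio (hc : IsCurve ζ v δ) (x : ℝ) : Continuous fun s => ratio ζ v s x := by
  rw [continuous_iff_continuousAt]
  intro s
  by_cases h : Real.sin ((s - x) / 2) = 0
  · -- at the diagonal: a quotient of two difference quotients
    obtain ⟨n, hn⟩ := Real.sin_eq_zero_iff.1 h
    have hcurve : ζ s = ζ x + n * (2 * π) := by
      have hs : s = x + n * (2 * π) := by linarith
      have hp : Function.Periodic (fun y => ζ y - y) (2 * π) := fun y => by
        simp only [hc.shift y]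
        push_cast
        ring
      have := hp.int_mul n x
      rw [← hs] at this
      rw [hs] at this ⊢
      push_cast at this
      linear_combination this
    have hchord : (ζ s - ζ x) / 2 = (((s - x) / 2 : ℝ) : ℂ) := by
      rw [hcurve, ← hn]
      push_cast
      ring
    have h1 := hc.hasDerivAt_sin_chord s x
    have h2 := hasDerivAt_sin_half s x
    rw [hasDerivAt_iff_tendsto_slope] at h1 h2
    have hC : ((Real.cos ((s - x) / 2) * (1 / 2) : ℝ) : ℂ) ≠ 0 := by
      have h3 := Real.sin_sq_add_cos_sq ((s - x) / 2)
      rw [h] at h3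
      have h4 : Real.cos ((s - x) / 2) ≠ 0 := fun h0 => by
        rw [h0] at h3
        norm_num at h3
      exact_mod_cast mul_ne_zero h4 (by norm_num)
    have h3 := h1.div h2 hC
    have e3 : Complex.cos ((ζ s - ζ x) / 2) * (v s / 2) /
        ((Real.cos ((s - x) / 2) * (1 / 2) : ℝ) : ℂ) = ratio ζ v s x := by
      rw [ratio, if_pos h, div_eq_iff hC, hchord, ← Complex.ofReal_cos]
      push_cast
      ring
    rw [e3] at h3
    rw [continuousAt_iff_punctured_nhds]
    refine h3.congr' ?_
    have hev : ∀ᶠ y in 𝓝[≠] s, Real.sin ((y - x) / 2) ≠ 0 := by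
      have h4 := (hasDerivAt_sin_half s x).eventually_ne (c := 0) hC
      filter_upwards [h4] with y hy h0
      exact hy (by rw [h0]; simp)
    filter_upwards [hev, self_mem_nhdsWithin] with y hy hys
    have hys' : (y : ℝ) - s ≠ 0 := sub_ne_zero.2 hys
    have z1 : Complex.sin ((ζ s - ζ x) / 2) = 0 := by
      rw [hchord, ← Complex.ofReal_sin, h, Complex.ofReal_zero]
    simp only [Pi.div_apply, slope_def_module, h, z1, ratio, if_neg hy, Complex.ofReal_zero,
      sub_zero, Complex.real_smul]
    rw [mul_div_mul_left]
    exact_mod_cast inv_ne_zero hys'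
  · have h1 : ∀ᶠ y in 𝓝 s, Real.sin ((y - x) / 2) ≠ 0 :=
      ContinuousAt.eventually_ne (by fun_prop) h
    have h2 : ContinuousAt
        (fun y => Complex.sin ((ζ y - ζ x) / 2) / (Real.sin ((y - x) / 2) : ℝ)) s :=
      (hc.hasDerivAt_sin_chord s x).continuousAt.div (hasDerivAt_sin_half s x).continuousAt
        (by exact_mod_cast h)
    refine h2.congr ?_
    filter_upwards [h1] with y hy
    rw [ratio, if_neg hy]

theorem ratio_mem_slitPlane (hc : IsCurve ζ v δ) (s x : ℝ) : ratio ζ v s x ∈ Complex.slitPlane := by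
  have h := Complex.mem_slitPlane_of_norm_lt_one (z := ratio ζ v s x - 1)
    ((hc.ratio_near s x).trans_lt (by linarith [hc.small]))
  simpa using h

/-- The logarithm is the principal one: the ratio stays near `1`, hence off the branch cut. -/
theorem continuous_logRatio (hc : IsCurve ζ v δ) (x : ℝ) : Continuous fun s => logRatio ζ v s x :=
  (hc.continuous_ratio x).clog fun s => hc.ratio_mem_slitPlane s x

theorem logRatio_symm (hc : IsCurve ζ v δ) (s x : ℝ) : logRatio ζ v s x = logRatio ζ v x s := by
  rw [logRatio, hc.ratio_symm, logRatio]

theorem logRatio_periodic (hc : IsCurve ζ v δ) (x : ℝ) :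
    Function.Periodic (fun s => logRatio ζ v s x) (2 * π) := fun s => by
  have := hc.ratio_periodic x s
  simp only at this
  simp only [logRatio, this]

theorem continuous_logRatio' (hc : IsCurve ζ v δ) (s : ℝ) :
    Continuous fun x => logRatio ζ v s x := by
  simp only [hc.logRatio_symm s]
  exact hc.continuous_logRatio s

theorem logRatio_periodic' (hc : IsCurve ζ v δ) (s : ℝ) :
    Function.Periodic (fun x => logRatio ζ v s x) (2 * π) := by
  simp only [hc.logRatio_symm s]
  exact hc.logRatio_periodic s

theorem norm_logRatio_le (hc : IsCurve ζ v δ) (s x : ℝ) : ‖logRatio ζ v s x‖ ≤ 8 * δ := by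
  have h0 := hc.ratio_near s x
  have h := Complex.norm_log_one_add_half_le_self (z := ratio ζ v s x - 1)
    (h0.trans (by linarith [hc.small]))
  rw [add_sub_cancel] at h
  rw [logRatio]
  linarith [hc.nonneg]

/-- Off the diagonal the logarithmic kernel has half the cotangent kernel as its derivative. -/
theorem hasDerivAt_logRatio (hc : IsCurve ζ v δ) {s x : ℝ} (h : Real.sin ((s - x) / 2) ≠ 0) :
    HasDerivAt (fun s => logRatio ζ v s x) (cotKernel ζ v s x / 2) s := by
  have hS : ((Real.sin ((s - x) / 2) : ℝ) : ℂ) ≠ 0 := by exact_mod_cast h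
  have hZ := hc.sin_chord_ne_zero h
  have h1 : ∀ᶠ y in 𝓝 s, Real.sin ((y - x) / 2) ≠ 0 :=
    ContinuousAt.eventually_ne (by fun_prop) h
  have h2 := (hc.hasDerivAt_sin_chord s x).div (hasDerivAt_sin_half s x) hS
  have h3 : HasDerivAt (fun s => ratio ζ v s x)
      ((Complex.cos ((ζ s - ζ x) / 2) * (v s / 2) * (Real.sin ((s - x) / 2) : ℝ) -
        Complex.sin ((ζ s - ζ x) / 2) * ((Real.cos ((s - x) / 2) * (1 / 2) : ℝ) : ℂ)) /
        ((Real.sin ((s - x) / 2) : ℝ) : ℂ) ^ 2) s := by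
    refine h2.congr_of_eventuallyEq ?_
    filter_upwards [h1] with y hy
    rw [ratio, if_neg hy]
    rfl
  have h4 := h3.clog_real (hc.ratio_mem_slitPlane s x)
  refine h4.congr_deriv ?_
  rw [cotKernel, ratio, if_neg h, Complex.cot_eq_cos_div_sin, Real.cot_eq_cos_div_sin]
  push_cast at hS ⊢
  field_simp

theorem measurable_cotKernel (hc : IsCurve ζ v δ) :
    Measurable fun p : ℝ × ℝ => cotKernel ζ v p.1 p.2 := by
  have h1 := hc.continuous_curve.measurable
  have h2 := hc.continuous.measurable
  have e : (fun p : ℝ × ℝ => cotKernel ζ v p.1 p.2) = fun p : ℝ × ℝ =>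
      v p.1 * (Complex.cos ((ζ p.1 - ζ p.2) / 2) / Complex.sin ((ζ p.1 - ζ p.2) / 2)) -
      ((Real.cos ((p.1 - p.2) / 2) / Real.sin ((p.1 - p.2) / 2) : ℝ) : ℂ) := by
    funext p
    simp only [cotKernel, Complex.cot_eq_cos_div_sin, Real.cot_eq_cos_div_sin]
  rw [e]
  fun_prop

theorem intervalIntegrable_cotKernel (hc : IsCurve ζ v δ) (x a b : ℝ) :
    IntervalIntegrable (fun s => cotKernel ζ v s x) volume a b := by
  have hw : IntervalIntegrable (fun s => 80 * δ * weight (s - x)) volume a b := by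
    have := (intervalIntegrable_weight' (a - x) (b - x)).comp_sub_right x
    simp only [sub_add_cancel] at this
    exact this.const_mul _
  refine hw.mono_fun (hc.measurable_cotKernel.comp
    (measurable_id.prodMk measurable_const)).aestronglyMeasurable (Eventually.of_forall fun s => ?_)
  exact (hc.norm_cotKernel_le s x).trans (le_abs_self _)

/-- The logarithmic kernel is a primitive of the cotangent kernel, across the diagonal too. -/
theorem integral_cotKernel (hc : IsCurve ζ v δ) (x a b : ℝ) :
    ∫ s in a..b, cotKernel ζ v s x / 2 = logRatio ζ v b x - logRatio ζ v a x :=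
  MeasureTheory.integral_eq_of_hasDerivAt_off_countable (fun s => logRatio ζ v s x)
    (fun s => cotKernel ζ v s x / 2) (countable_sin_half_eq_zero x)
    (hc.continuous_logRatio x).continuousOn (fun _ hs => hc.hasDerivAt_logRatio hs.2)
    ((hc.intervalIntegrable_cotKernel x a b).div_const 2)

end IsCurve

/-- The total mass of the weight over a period. -/
def weightMass : ℝ := ∫ t in (0 : ℝ)..(2 * π), weight t

theorem weightMass_nonneg : 0 ≤ weightMass :=
  intervalIntegral.integral_nonneg two_pi_nonneg fun _ _ => weight_nonneg _

theorem integral_weight_sub (s : ℝ) : ∫ x in (0 : ℝ)..(2 * π), weight (s - x) = weightMass := by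
  rw [intervalIntegral.integral_comp_sub_left, sub_zero]
  have := weight_periodic.intervalIntegral_add_eq (s - 2 * π) 0
  rwa [sub_add_cancel, zero_add] at this

/-! ### The logarithmic potential of a derivative -/

namespace H1

theorem integrable_deriv_sq (f : H1) : Integrable (fun x => deriv f x ^ 2) perMeasure :=
  f.memLp_deriv.integrable_sq

theorem integrable_deriv (f : H1) : Integrable (deriv f) perMeasure :=
  f.memLp_deriv.integrable one_le_two

theorem integral_abs_deriv_le (f : H1) : ∫ x in (0 : ℝ)..(2 * π), |deriv f x| ≤ 3 * ‖f‖ := by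
  have h := sq_integral_le two_pi_nonneg (f.intervalIntegrable_deriv 0 (2 * π)).abs
    (by simpa only [sq_abs] using f.intervalIntegrable_deriv_sq 0 (2 * π))
  simp only [sq_abs, sub_zero] at h
  have h1 : ∫ x in (0 : ℝ)..(2 * π), deriv f x ^ 2 ≤ ‖f‖ ^ 2 := f.energy_le
  refine le_of_sq_le_sq (h.trans ?_) (by positivity)
  have := Real.pi_lt_four
  nlinarith [sq_nonneg ‖f‖, mul_le_mul_of_nonneg_left h1 two_pi_nonneg]

end H1

/-- A function of one variable against the translated weight is integrable on the square. -/
theorem integrable_mul_weight {φ : ℝ → ℝ} (hφ : Integrable φ perMeasure) :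
    Integrable (fun p : ℝ × ℝ => φ p.2 * weight (p.1 - p.2)) (perMeasure.prod perMeasure) := by
  have hm : AEStronglyMeasurable (fun p : ℝ × ℝ => φ p.2 * weight (p.1 - p.2))
      (perMeasure.prod perMeasure) :=
    hφ.aestronglyMeasurable.comp_snd.mul
      (measurable_weight.comp (measurable_fst.sub measurable_snd)).aestronglyMeasurable
  have hw (x : ℝ) : ∫ s in (0 : ℝ)..(2 * π), weight (s - x) = weightMass := by
    rw [← integral_weight_sub x]
    refine intervalIntegral.integral_congr fun s _ => ?_
    rw [← weight_neg, neg_sub]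
  have hwi (x : ℝ) : Integrable (fun s => weight (s - x)) perMeasure := by
    have := (intervalIntegrable_weight' (0 - x) (2 * π - x)).comp_sub_right x
    simp only [sub_add_cancel] at this
    exact (intervalIntegrable_iff_integrableOn_Ioc_of_le two_pi_nonneg).1 this
  rw [integrable_prod_iff' hm]
  refine ⟨ae_of_all _ fun x => (hwi x).const_mul (φ x), ?_⟩
  have e : (fun x => ∫ s, ‖φ x * weight (s - x)‖ ∂perMeasure) = fun x => ‖φ x‖ * weightMass := by
    funext x
    simp only [norm_mul, Real.norm_of_nonneg (weight_nonneg _)]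
    rw [integral_const_mul, ← hw x, intervalIntegral.integral_of_le two_pi_nonneg]
  rw [e]
  exact hφ.norm.mul_const _

theorem integral_integral_mul_weight {φ : ℝ → ℝ} (hφ : Integrable φ perMeasure) :
    ∫ s, ∫ x, φ x * weight (s - x) ∂perMeasure ∂perMeasure =
      weightMass * ∫ x in (0 : ℝ)..(2 * π), φ x := by
  rw [integral_integral_swap (f := fun s x => φ x * weight (s - x)) (integrable_mul_weight hφ),
    intervalIntegral.integral_of_le two_pi_nonneg, ← integral_const_mul]
  refine integral_congr_ae (ae_of_all _ fun x => ?_)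
  simp only
  rw [integral_const_mul, mul_comm, ← integral_weight_sub x,
    intervalIntegral.integral_of_le two_pi_nonneg]
  congr 2
  funext s
  rw [← weight_neg, neg_sub]

/-- Schur's test: Cauchy-Schwarz against the weight. -/
theorem sq_integral_mul_weight_le {φ : ℝ → ℝ} {s : ℝ}
    (h1 : Integrable (fun x => φ x * weight (s - x)) perMeasure)
    (h2 : Integrable (fun x => φ x ^ 2 * weight (s - x)) perMeasure) :
    (∫ x, φ x * weight (s - x) ∂perMeasure) ^ 2 ≤
      weightMass * ∫ x, φ x ^ 2 * weight (s - x) ∂perMeasure := by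
  have hw : Integrable (fun x => weight (s - x)) perMeasure := by
    have := ((intervalIntegrable_weight' (s - 0) (s - 2 * π)).comp_sub_left s)
    simp only [sub_sub_cancel] at this
    exact (intervalIntegrable_iff_integrableOn_Ioc_of_le two_pi_nonneg).1 this
  have hm : ∫ x, weight (s - x) ∂perMeasure = weightMass := by
    rw [← integral_weight_sub s, intervalIntegral.integral_of_le two_pi_nonneg]
  have key (c : ℝ) : 0 ≤ weightMass * (c * c) + (-2 * ∫ x, φ x * weight (s - x) ∂perMeasure) * c +
      ∫ x, φ x ^ 2 * weight (s - x) ∂perMeasure := by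
    have h0 : 0 ≤ ∫ x, (φ x - c) ^ 2 * weight (s - x) ∂perMeasure :=
      integral_nonneg fun x => mul_nonneg (sq_nonneg _) (weight_nonneg _)
    have e : ∀ x, (φ x - c) ^ 2 * weight (s - x) = (φ x ^ 2 * weight (s - x) -
        2 * c * (φ x * weight (s - x))) + c * c * weight (s - x) := fun x => by ring
    have hsub : Integrable (fun x => φ x ^ 2 * weight (s - x) -
        2 * c * (φ x * weight (s - x))) perMeasure := h2.sub (h1.const_mul _)
    simp only [e] at h0
    rw [integral_add hsub (hw.const_mul _), integral_sub h2 (h1.const_mul _),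
      integral_const_mul, integral_const_mul, hm] at h0
    linarith
  have := discrim_le_zero key
  rw [discrim] at this
  nlinarith

/-- The logarithmic potential `(1/π) ∫ f'(x) log(ratio(α, x)) dx`. -/
def logPotential (ζ v : ℝ → ℂ) (f : ℝ → ℝ) (α : ℝ) : ℂ :=
  1 / π * ∫ x in (0 : ℝ)..(2 * π), ((deriv f x : ℝ) : ℂ) * logRatio ζ v α x

/-- The derivative of `logPotential`. -/
def cotPotential (ζ v : ℝ → ℂ) (f : ℝ → ℝ) (s : ℝ) : ℂ :=
  1 / π * ∫ x in (0 : ℝ)..(2 * π), ((deriv f x : ℝ) : ℂ) * (cotKernel ζ v s x / 2)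

/-- The constant in the bound for the logarithmic potential. -/
def potentialConst : ℝ := 24 + 40 * weightMass

namespace IsCurve

variable {ζ v : ℝ → ℂ} {δ : ℝ}

theorem logPotential_periodic (hc : IsCurve ζ v δ) (f : ℝ → ℝ) :
    Function.Periodic (logPotential ζ v f) (2 * π) := fun α => by
  unfold logPotential
  congr 2
  funext x
  have := hc.logRatio_periodic x α
  simp only at this
  rw [this]

/-- The supremum bound for the logarithmic potential. -/
theorem norm_logPotential_le (hc : IsCurve ζ v δ) (f : H1) (α : ℝ) :
    ‖logPotential ζ v f α‖ ≤ 8 * δ * ‖f‖ := by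
  have h1 : ‖∫ x in (0 : ℝ)..(2 * π), ((deriv f x : ℝ) : ℂ) * logRatio ζ v α x‖ ≤
      ∫ x in (0 : ℝ)..(2 * π), |deriv f x| * (8 * δ) := by
    refine intervalIntegral.norm_integral_le_of_norm_le two_pi_nonneg (ae_of_all _ fun x _ => ?_)
      ((f.intervalIntegrable_deriv _ _).abs.mul_const _)
    rw [norm_mul, Complex.norm_real, Real.norm_eq_abs]
    exact mul_le_mul_of_nonneg_left (hc.norm_logRatio_le α x) (abs_nonneg _)
  rw [intervalIntegral.integral_mul_const] at h1
  have h2 := mul_le_mul_of_nonneg_right f.integral_abs_deriv_le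
    (mul_nonneg (by norm_num : (0 : ℝ) ≤ 8) hc.nonneg)
  rw [logPotential, norm_mul]
  have h3 : ‖(1 / π : ℂ)‖ = 1 / π := by
    rw [norm_div, norm_one, Complex.norm_real, Real.norm_of_nonneg Real.pi_pos.le]
  rw [h3]
  calc 1 / π * ‖∫ x in (0 : ℝ)..(2 * π), ((deriv f x : ℝ) : ℂ) * logRatio ζ v α x‖
      ≤ 1 / 3 * (3 * ‖f‖ * (8 * δ)) := by
        refine mul_le_mul ?_ (h1.trans h2) (norm_nonneg _) (by norm_num)
        exact one_div_le_one_div_of_le (by norm_num) Real.pi_gt_three.le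
    _ = 8 * δ * ‖f‖ := by ring

theorem integrable_deriv_mul_cotKernel (hc : IsCurve ζ v δ) (f : H1) :
    Integrable (fun p : ℝ × ℝ => ((deriv f p.2 : ℝ) : ℂ) * (cotKernel ζ v p.1 p.2 / 2))
      (perMeasure.prod perMeasure) := by
  refine ((integrable_mul_weight f.integrable_deriv.norm).const_mul (40 * δ)).mono' ?_ ?_
  · exact (Complex.continuous_ofReal.comp_aestronglyMeasurable
      f.integrable_deriv.aestronglyMeasurable.comp_snd).mul
      (hc.measurable_cotKernel.div_const 2).aestronglyMeasurable
  · refine ae_of_all _ fun p => ?_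
    have h := hc.norm_cotKernel_le p.1 p.2
    rw [norm_mul, Complex.norm_real, norm_div]
    have h2 : ‖(2 : ℂ)‖ = 2 := by simp
    rw [h2]
    calc ‖deriv f p.2‖ * (‖cotKernel ζ v p.1 p.2‖ / 2)
        ≤ ‖deriv f p.2‖ * (80 * δ * weight (p.1 - p.2) / 2) := by gcongr
      _ = _ := by ring

/-- The logarithmic potential is a primitive of `cotPotential`, by Fubini's theorem. -/
theorem logPotential_eq (hc : IsCurve ζ v δ) (f : H1) {α : ℝ} (hα : α ∈ Icc (0 : ℝ) (2 * π)) :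
    logPotential ζ v f α = logPotential ζ v f 0 + ∫ s in (0 : ℝ)..α, cotPotential ζ v f s := by
  have hint : IntegrableOn (Function.uncurry fun s x =>
      ((deriv f x : ℝ) : ℂ) * (cotKernel ζ v s x / 2)) (uIoc 0 α ×ˢ uIoc 0 (2 * π)) := by
    have h := hc.integrable_deriv_mul_cotKernel f
    rw [Measure.prod_restrict, ← Measure.volume_eq_prod] at h
    rw [uIoc_of_le hα.1, uIoc_of_le two_pi_nonneg]
    exact IntegrableOn.mono_set h (prod_mono (Ioc_subset_Ioc_right hα.2) subset_rfl)
  have hi (s : ℝ) : IntervalIntegrable (fun x => ((deriv f x : ℝ) : ℂ) * logRatio ζ v s x)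
      volume 0 (2 * π) :=
    (intervalIntegrable_ofReal (f.intervalIntegrable_deriv _ _)).mul_continuousOn
      (hc.continuous_logRatio' s).continuousOn
  unfold cotPotential
  rw [intervalIntegral.integral_const_mul, intervalIntegral_intervalIntegral_swap hint,
    logPotential, logPotential, ← mul_add]
  congr 1
  have e (x : ℝ) : ∫ s in (0 : ℝ)..α, ((deriv f x : ℝ) : ℂ) * (cotKernel ζ v s x / 2) =
      ((deriv f x : ℝ) : ℂ) * logRatio ζ v α x - ((deriv f x : ℝ) : ℂ) * logRatio ζ v 0 x := by
    rw [intervalIntegral.integral_const_mul, hc.integral_cotKernel, mul_sub]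
  simp only [e]
  rw [intervalIntegral.integral_sub (hi α) (hi 0), add_sub_cancel]

theorem norm_cotPotential_le (hc : IsCurve ζ v δ) (f : H1) {s : ℝ}
    (h : Integrable (fun x => |deriv f x| * weight (s - x)) perMeasure) :
    ‖cotPotential ζ v f s‖ ≤ 40 * δ * ∫ x, |deriv f x| * weight (s - x) ∂perMeasure := by
  have h1 : ‖∫ x, ((deriv f x : ℝ) : ℂ) * (cotKernel ζ v s x / 2) ∂perMeasure‖ ≤
      ∫ x, 40 * δ * (|deriv f x| * weight (s - x)) ∂perMeasure := by
    refine norm_integral_le_of_norm_le (h.const_mul _) (ae_of_all _ fun x => ?_)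
    have h := hc.norm_cotKernel_le s x
    rw [norm_mul, Complex.norm_real, norm_div, Real.norm_eq_abs]
    have h2 : ‖(2 : ℂ)‖ = 2 := by simp
    rw [h2]
    calc |deriv f x| * (‖cotKernel ζ v s x‖ / 2)
        ≤ |deriv f x| * (80 * δ * weight (s - x) / 2) := by gcongr
      _ = _ := by ring
  rw [integral_const_mul] at h1
  rw [cotPotential, intervalIntegral.integral_of_le two_pi_nonneg, norm_mul]
  have h3 : ‖(1 / π : ℂ)‖ = 1 / π := by
    rw [norm_div, norm_one, Complex.norm_real, Real.norm_of_nonneg Real.pi_pos.le]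
  have h4 : 1 / π ≤ 1 := by
    rw [div_le_one Real.pi_pos]
    linarith [Real.pi_gt_three]
  rw [h3]
  calc _ ≤ 1 * ‖∫ x, ((deriv f x : ℝ) : ℂ) * (cotKernel ζ v s x / 2) ∂perMeasure‖ := by gcongr
    _ ≤ _ := by rw [one_mul]; exact h1

/-- The `L²` bound for the derivative of the logarithmic potential. -/
theorem cotPotential_memLp (hc : IsCurve ζ v δ) (f : H1) (l : ℂ →L[ℝ] ℝ) (hl : ∀ z, |l z| ≤ ‖z‖) :
    MemLp (fun s => l (cotPotential ζ v f s)) 2 perMeasure ∧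
    ∫ s in (0 : ℝ)..(2 * π), l (cotPotential ζ v f s) ^ 2 ≤ (40 * weightMass * δ * ‖f‖) ^ 2 := by
  have hmeas : AEStronglyMeasurable (fun s => l (cotPotential ζ v f s)) perMeasure := by
    refine l.continuous.comp_aestronglyMeasurable ?_
    have h := (hc.integrable_deriv_mul_cotKernel f).aestronglyMeasurable.integral_prod_right'
    refine (h.const_mul (1 / π : ℂ)).congr (ae_of_all _ fun s => ?_)
    simp only [cotPotential]
    rw [intervalIntegral.integral_of_le two_pi_nonneg]
  have hi1 := integrable_mul_weight f.integrable_deriv.abs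
  have hi2 := integrable_mul_weight f.integrable_deriv_sq
  have hbound : ∀ᵐ s ∂perMeasure, l (cotPotential ζ v f s) ^ 2 ≤
      (40 * δ) ^ 2 * (weightMass * ∫ x, deriv f x ^ 2 * weight (s - x) ∂perMeasure) := by
    filter_upwards [hi1.prod_right_ae, hi2.prod_right_ae] with s h1 h2
    have h3 := sq_integral_mul_weight_le (φ := fun x => |deriv f x|) (s := s) h1
      (by simpa only [sq_abs] using h2)
    simp only [sq_abs] at h3
    have h4 := (hl (cotPotential ζ v f s)).trans (hc.norm_cotPotential_le f h1)
    rw [← sq_abs]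
    calc _ ≤ (40 * δ * ∫ x, |deriv f x| * weight (s - x) ∂perMeasure) ^ 2 :=
          pow_le_pow_left₀ (abs_nonneg _) h4 2
      _ = (40 * δ) ^ 2 * (∫ x, |deriv f x| * weight (s - x) ∂perMeasure) ^ 2 := by rw [mul_pow]
      _ ≤ _ := mul_le_mul_of_nonneg_left h3 (sq_nonneg _)
  have hQ : Integrable (fun s => (40 * δ) ^ 2 * (weightMass *
      ∫ x, deriv f x ^ 2 * weight (s - x) ∂perMeasure)) perMeasure :=
    (hi2.integral_prod_left.const_mul _).const_mul _
  have hsq : Integrable (fun s => l (cotPotential ζ v f s) ^ 2) perMeasure := by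
    refine hQ.mono' (hmeas.pow 2) ?_
    filter_upwards [hbound] with s hs
    rwa [Real.norm_of_nonneg (sq_nonneg _)]
  refine ⟨(memLp_two_iff_integrable_sq hmeas).2 hsq, ?_⟩
  rw [intervalIntegral.integral_of_le two_pi_nonneg]
  calc _ ≤ ∫ s, (40 * δ) ^ 2 * (weightMass *
      ∫ x, deriv f x ^ 2 * weight (s - x) ∂perMeasure) ∂perMeasure :=
        integral_mono_ae hsq hQ hbound
    _ = (40 * δ) ^ 2 * (weightMass * (weightMass * f.energy)) := by
        rw [integral_const_mul, integral_const_mul,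
          integral_integral_mul_weight f.integrable_deriv_sq]
        rfl
    _ ≤ (40 * δ) ^ 2 * (weightMass * (weightMass * ‖f‖ ^ 2)) := by
        have := weightMass_nonneg
        have := f.energy_le
        gcongr
    _ = _ := by ring

/-- The logarithmic potential belongs to `H¹_per`, with norm `O(δ ‖f‖)`. -/
theorem logPotential_mem (hc : IsCurve ζ v δ) (f : H1) (l : ℂ →L[ℝ] ℝ) (hl : ∀ z, |l z| ≤ ‖z‖) :
    ∃ u : H1, (∀ α, u α = l (logPotential ζ v f α)) ∧ ‖u‖ ≤ potentialConst * δ * ‖f‖ := by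
  obtain ⟨hL, hB⟩ := hc.cotPotential_memLp f l hl
  have hper : Function.Periodic (fun α => l (logPotential ζ v f α)) (2 * π) := fun α => by
    simp only [hc.logPotential_periodic f α]
  have hI : IntervalIntegrable (cotPotential ζ v f) volume 0 (2 * π) := by
    have h := (hc.integrable_deriv_mul_cotKernel f).integral_prod_left.const_mul (1 / π : ℂ)
    rw [intervalIntegrable_iff_integrableOn_Ioc_of_le two_pi_nonneg]
    refine h.congr (ae_of_all _ fun s => ?_)
    simp only [cotPotential]
    rw [intervalIntegral.integral_of_le two_pi_nonneg]
  obtain ⟨hm, hd⟩ := mem_H1Functions_of_primitive hper hL fun α hα => by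
    have hIα : IntervalIntegrable (cotPotential ζ v f) volume 0 α := by
      refine hI.mono_set ?_
      rw [uIcc_of_le hα.1, uIcc_of_le two_pi_nonneg]
      exact Icc_subset_Icc_right hα.2
    simp only [hc.logPotential_eq f hα, map_add]
    rw [l.intervalIntegral_comp_comm hIα]
  refine ⟨H1.mk _ hm, fun α => rfl, ?_⟩
  have hδ := hc.nonneg
  have hW := weightMass_nonneg
  have he : (H1.mk _ hm).energy ≤ (40 * weightMass * δ * ‖f‖) ^ 2 := by
    rw [(H1.mk _ hm).energy_congr hd]
    exact hB
  refine ((H1.mk _ hm).norm_le_of_bound (A := 8 * δ * ‖f‖) (by positivity) (by positivity)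
    (fun α => (hl _).trans (hc.norm_logPotential_le f α)) he).trans (le_of_eq ?_)
  rw [potentialConst]
  ring

end IsCurve

/-! ### The principal value of the cotangent kernel of a curve -/

theorem integral_annulus_add {F G : ℝ → ℂ} {a ε R : ℝ}
    (hF : IntegrableOn F {x | ε < |x - a| ∧ |x - a| < R})
    (hG : IntegrableOn G {x | ε < |x - a| ∧ |x - a| < R}) :
    ∫ x in {x | ε < |x - a| ∧ |x - a| < R}, (F x + G x) =
      (∫ x in {x | ε < |x - a| ∧ |x - a| < R}, F x) +
        ∫ x in {x | ε < |x - a| ∧ |x - a| < R}, G x := integral_add hF hG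

/-- The annuli around `a` exhaust the interval for an integrable function. -/
theorem tendsto_integral_annulus {F : ℝ → ℂ} {a R : ℝ} (hR : 0 < R)
    (h : IntervalIntegrable F volume (a - R) (a + R)) :
    Tendsto (fun ε => ∫ x in {x | ε < |x - a| ∧ |x - a| < R}, F x) (𝓝[>] 0)
      (𝓝 (∫ x in (a - R)..(a + R), F x)) := by
  have i1 : IntervalIntegrable (fun t => F (a - t)) volume 0 R := by
    have := (h.mono_set (c := a - R) (d := a) (by
      rw [uIcc_of_le (by linarith), uIcc_of_le (by linarith)]
      exact Icc_subset_Icc_right (by linarith))).comp_sub_left a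
    simpa using this.symm
  have i2 : IntervalIntegrable (fun t => F (a + t)) volume 0 R := by
    have := (h.mono_set (c := a) (d := a + R) (by
      rw [uIcc_of_le (by linarith), uIcc_of_le (by linarith)]
      exact Icc_subset_Icc_left (by linarith))).comp_add_left a
    simpa using this
  have h1 := tendsto_integral_left_endpoint hR (i1.add i2)
  have h2 : ∫ t in (0 : ℝ)..R, (F (a - t) + F (a + t)) = ∫ x in (a - R)..(a + R), F x := by
    rw [intervalIntegral.integral_add i1 i2, intervalIntegral.integral_comp_sub_left,
      intervalIntegral.integral_comp_add_left, sub_zero, add_zero,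
      intervalIntegral.integral_add_adjacent_intervals]
    · exact h.mono_set (by
        rw [uIcc_of_le (by linarith), uIcc_of_le (by linarith)]
        exact Icc_subset_Icc_right (by linarith))
    · exact h.mono_set (by
        rw [uIcc_of_le (by linarith), uIcc_of_le (by linarith)]
        exact Icc_subset_Icc_left (by linarith))
  rw [← h2]
  refine h1.congr' ?_
  filter_upwards [Ioc_mem_nhdsGT hR] with ε hε
  have hs : uIcc ε R ⊆ uIcc 0 R := by
    rw [uIcc_of_le hε.2, uIcc_of_le hR.le]
    exact Icc_subset_Icc_left hε.1.le
  exact (integral_annulus hε.1.le hε.2 (i1.mono_set hs) (i2.mono_set hs)).symm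

theorem integrableOn_annulus_of_intervalIntegrable {F : ℝ → ℂ} {a ε R : ℝ}
    (h : IntervalIntegrable F volume (a - R) (a + R)) (hR : 0 < R) :
    IntegrableOn F {x | ε < |x - a| ∧ |x - a| < R} := by
  refine ((intervalIntegrable_iff_integrableOn_Ioc_of_le (by linarith)).1 h).mono_set fun x hx => ?_
  have := abs_lt.1 hx.2
  constructor <;> linarith

theorem continuousOn_cot_half (α : ℝ) {ε : ℝ} (hε : 0 < ε) :
    ContinuousOn (fun x => Real.cot (1 / 2 * (α - x))) {x | ε ≤ |x - α| ∧ |x - α| ≤ π} := by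
  have : (fun x => Real.cot (1 / 2 * (α - x))) =
      fun x => Real.cos (1 / 2 * (α - x)) / Real.sin (1 / 2 * (α - x)) :=
    funext fun x => Real.cot_eq_cos_div_sin _
  rw [this]
  refine ContinuousOn.div (by fun_prop) (by fun_prop) fun x hx h0 => ?_
  have := (sin_half_eq_zero_iff (t := α - x) (by rw [abs_sub_comm]; exact hx.2)).1 (by
    rw [← h0]; congr 1; ring)
  have h1 := hx.1
  rw [abs_sub_comm, this, abs_zero] at h1
  linarith

theorem isCompact_annulus (a ε R : ℝ) : IsCompact {x : ℝ | ε ≤ |x - a| ∧ |x - a| ≤ R} := by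
  refine (isCompact_Icc (a := a - R) (b := a + R)).of_isClosed_subset ?_ fun x hx => ?_
  · have h : Continuous fun x : ℝ => |x - a| := by fun_prop
    exact (isClosed_le continuous_const h).inter (isClosed_le h continuous_const)
  · have := abs_le.1 hx.2
    constructor <;> linarith

namespace IsCurve

variable {ζ v : ℝ → ℂ} {δ : ℝ}

/-- The cotangent kernel of the curve, centred at `α` and integrated in `x`, is that of the line up
to the weakly singular kernel `cotKernel`. -/
theorem cot_chord_eq (x α : ℝ) : v x * Complex.cot ((ζ α - ζ x) / 2) =
    (Real.cot (1 / 2 * (α - x)) : ℝ) + -cotKernel ζ v x α := by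
  have e1 : Complex.cot ((ζ α - ζ x) / 2) = -Complex.cot ((ζ x - ζ α) / 2) := by
    rw [show (ζ α - ζ x) / 2 = -((ζ x - ζ α) / 2) by ring, Complex.cot_eq_cos_div_sin,
      Complex.cot_eq_cos_div_sin, Complex.cos_neg, Complex.sin_neg, div_neg]
  have e2 : Real.cot (1 / 2 * (α - x)) = -Real.cot ((x - α) / 2) := by
    rw [show 1 / 2 * (α - x) = -((x - α) / 2) by ring, Real.cot_eq_cos_div_sin,
      Real.cot_eq_cos_div_sin, Real.cos_neg, Real.sin_neg, div_neg]
  rw [cotKernel, e1, e2]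
  push_cast
  ring

theorem intervalIntegrable_mul_cotKernel (hc : IsCurve ζ v δ) (f : H1) (α a b : ℝ) :
    IntervalIntegrable (fun x => (f x : ℂ) * cotKernel ζ v x α) volume a b :=
  (hc.intervalIntegrable_cotKernel α a b).continuousOn_mul
    (Complex.continuous_ofReal.comp f.continuous).continuousOn

/-- Integration by parts over a full period: there are no boundary terms. -/
theorem integral_mul_cotKernel (hc : IsCurve ζ v δ) (f : H1) (α : ℝ) :
    ∫ x in (α - π)..(α + π), (f x : ℂ) * -cotKernel ζ v x α = 2 * π * logPotential ζ v f α := by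
  have h := f.integral_deriv_mul (a := α - π) (b := α + π) (by linarith [Real.pi_pos])
    ((hc.intervalIntegrable_cotKernel α _ _).div_const 2) (g := fun x => logRatio ζ v x α)
    fun x _ => by rw [hc.integral_cotKernel]; ring
  have p1 := f.periodic (α - π)
  have p2 := hc.logRatio_periodic α (α - π)
  rw [show α - π + 2 * π = α + π by ring] at p1
  simp only [show α - π + 2 * π = α + π by ring] at p2
  rw [p1, p2, sub_self, zero_sub] at h
  have hper : Function.Periodic (fun x => ((deriv f x : ℝ) : ℂ) * logRatio ζ v x α) (2 * π) :=
    fun x => by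
      have h1 := f.deriv_periodic x
      have h2 := hc.logRatio_periodic α x
      simp only at h2
      simp only [h1, h2]
  have h2 := hper.intervalIntegral_add_eq (α - π) 0
  rw [show α - π + 2 * π = α + π by ring, zero_add] at h2
  have h3 : ∫ x in (α - π)..(α + π), (f x : ℂ) * -cotKernel ζ v x α =
      -(2 * ∫ x in (α - π)..(α + π), (f x : ℂ) * (cotKernel ζ v x α / 2)) := by
    rw [← intervalIntegral.integral_const_mul, ← intervalIntegral.integral_neg]
    refine intervalIntegral.integral_congr fun x _ => ?_
    ring
  have h4 : ∫ x in (0 : ℝ)..(2 * π), ((deriv f x : ℝ) : ℂ) * logRatio ζ v x α =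
      ∫ x in (0 : ℝ)..(2 * π), ((deriv f x : ℝ) : ℂ) * logRatio ζ v α x := by
    refine intervalIntegral.integral_congr fun x _ => ?_
    simp only [hc.logRatio_symm x α]
  have hpi : (π : ℂ) ≠ 0 := by exact_mod_cast Real.pi_ne_zero
  rw [h3, logPotential, ← h4, ← h2, h]
  field_simp

/-- The principal value integral of `f` against the cotangent kernel of the curve is the Hilbert
transform of `f`, up to a logarithmic potential. -/
theorem tendsto_cot_chord (hc : IsCurve ζ v δ) (f : H1) (α : ℝ) :
    Tendsto (fun ε => ∫ x in {x | ε < |x - α| ∧ |x - α| < π},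
        (f x : ℂ) * (v x * Complex.cot ((ζ α - ζ x) / 2)))
      (𝓝[>] (0 : ℝ)) (𝓝 (2 * π * (hilbertL f α + logPotential ζ v f α))) := by
  have h1 := f.tendsto_pvPeriod α
  rw [← hilbertL_eq_folded] at h1
  have h2 := ((Complex.continuous_ofReal.tendsto _).comp h1)
  have hi := (hc.intervalIntegrable_mul_cotKernel f α (α - π) (α + π)).neg
  have h3 := tendsto_integral_annulus Real.pi_pos hi
  have e3 : ∫ x in (α - π)..(α + π), (-fun x => (f x : ℂ) * cotKernel ζ v x α) x =
      2 * π * logPotential ζ v f α := by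
    rw [← hc.integral_mul_cotKernel f α]
    refine intervalIntegral.integral_congr fun x _ => ?_
    simp
  rw [e3] at h3
  have h4 := h2.add h3
  rw [show ((2 * π * hilbertL f α : ℝ) : ℂ) + 2 * π * logPotential ζ v f α =
    2 * π * (hilbertL f α + logPotential ζ v f α) by push_cast; ring] at h4
  refine h4.congr' ?_
  filter_upwards [self_mem_nhdsWithin] with ε hε
  have hε0 : 0 < ε := hε
  simp only [Function.comp_apply]
  rw [setIntegral_annulus_closed]
  refine (congrArg (· + _) (integral_ofReal (𝕜 := ℂ)).symm).trans ?_
  refine (integral_annulus_add ?_ ?_).symm.trans ?_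
  rotate_left 2
  · refine integral_congr_ae (ae_of_all _ fun x => ?_)
    simp only [cot_chord_eq, Pi.neg_apply, RCLike.ofReal_mul, Complex.coe_algebraMap]
    change (f x : ℂ) * _ + _ = _
    ring
  · refine IntegrableOn.mono_set (t := {x : ℝ | ε ≤ |x - α| ∧ |x - α| ≤ π}) ?_
      fun x hx => ⟨hx.1.le, hx.2.le⟩
    refine ContinuousOn.integrableOn_compact (isCompact_annulus _ _ _) ?_
    exact Complex.continuous_ofReal.comp_continuousOn
      (f.continuous.continuousOn.mul (continuousOn_cot_half α hε0))
  · exact integrableOn_annulus_of_intervalIntegrable hi Real.pi_pos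

end IsCurve

/-! ### Folding the Birkhoff-Rott integral onto one period -/

/-- The terms of the Mittag-Leffler expansion of the cotangent, with period `2π`. -/
def cotPair (z : ℂ) (n : ℕ) : ℂ := 1 / (z - 2 * π * (n + 1)) + 1 / (z + 2 * π * (n + 1))

theorem le_norm_sub_period {z : ℂ} (hz : ‖z‖ ≤ 4) (n : ℕ) :
    2 * ((n : ℝ) + 1) ≤ ‖z - 2 * π * (n + 1)‖ ∧ 2 * ((n : ℝ) + 1) ≤ ‖z + 2 * π * (n + 1)‖ := by
  have hpi := Real.pi_gt_three
  have e : ‖(2 * π * (n + 1) : ℂ)‖ = 2 * π * (n + 1) := by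
    rw [show (2 * π * (n + 1) : ℂ) = ((2 * π * (n + 1) : ℝ) : ℂ) by push_cast; ring,
      Complex.norm_real, Real.norm_of_nonneg (by positivity)]
  have h1 := norm_sub_norm_le (2 * π * (n + 1) : ℂ) z
  have h2 := norm_sub_norm_le (2 * π * (n + 1) : ℂ) (-z)
  rw [norm_sub_rev, e] at h1
  rw [norm_neg, e, sub_neg_eq_add, add_comm _ z] at h2
  have hn : (0 : ℝ) ≤ n := n.cast_nonneg
  constructor <;> nlinarith

theorem norm_cotPair_le {z : ℂ} (hz : ‖z‖ ≤ 4) (n : ℕ) :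
    ‖cotPair z n‖ ≤ 2 * (1 / ((n : ℝ) + 1) ^ 2) := by
  obtain ⟨h1, h2⟩ := le_norm_sub_period hz n
  have hn : (0 : ℝ) < (n : ℝ) + 1 := by positivity
  have n1 : z - 2 * π * (n + 1) ≠ 0 := norm_pos_iff.1 (by linarith)
  have n2 : z + 2 * π * (n + 1) ≠ 0 := norm_pos_iff.1 (by linarith)
  have e : cotPair z n = 2 * z / ((z - 2 * π * (n + 1)) * (z + 2 * π * (n + 1))) := by
    rw [cotPair]
    field_simp
    ring
  rw [e, norm_div, norm_mul, norm_mul, Complex.norm_ofNat]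
  calc 2 * ‖z‖ / (‖z - 2 * π * (n + 1)‖ * ‖z + 2 * π * (n + 1)‖) ≤
        2 * 4 / ((2 * (n + 1)) * (2 * (n + 1))) := by gcongr
    _ = 2 * (1 / ((n : ℝ) + 1) ^ 2) := by field_simp; norm_num

theorem summable_cotPair_bound : Summable fun n : ℕ => 2 * (1 / ((n : ℝ) + 1) ^ 2) := by
  have h := (summable_nat_add_iff 1).2 (Real.summable_one_div_nat_pow.2 (one_lt_two))
  push_cast at h
  exact h.mul_left 2

/-- A bound for the partial sums of the Mittag-Leffler expansion near the period `0`. -/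
def cotPairBound : ℝ := ∑' n : ℕ, 2 * (1 / ((n : ℝ) + 1) ^ 2)

theorem norm_sum_cotPair_le {z : ℂ} (hz : ‖z‖ ≤ 4) (N : ℕ) :
    ‖∑ n ∈ Finset.range N, cotPair z n‖ ≤ cotPairBound :=
  (norm_sum_le_of_le _ fun n _ => norm_cotPair_le hz n).trans
    (summable_cotPair_bound.sum_le_tsum _ fun n _ => by positivity)

/-- The remainder of `½ cot(z/2)` after its pole at the origin is subtracted. -/
def cotRem (z : ℂ) : ℂ := 1 / 2 * Complex.cot (z / 2) - 1 / z

/-- The Mittag-Leffler expansion of the cotangent. The value `z = 0` is allowed because the junk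
values `cot 0 = 0` and `1 / 0 = 0` agree with it. -/
theorem tendsto_sum_cotPair {z : ℂ} (hz : ‖z‖ ≤ 4) (h0 : z = 0 ∨ Complex.sin (z / 2) ≠ 0) :
    Tendsto (fun N => ∑ n ∈ Finset.range N, cotPair z n) atTop (𝓝 (cotRem z)) := by
  have hpi : (π : ℂ) ≠ 0 := by exact_mod_cast Real.pi_ne_zero
  rcases h0 with rfl | h0
  · have e (n : ℕ) : cotPair 0 n = 0 := by
      rw [cotPair, zero_sub, zero_add, one_div_neg_eq_neg_one_div, neg_add_cancel]
    have e2 : cotRem 0 = 0 := by simp [cotRem, Complex.cot_eq_cos_div_sin]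
    simp only [e, Finset.sum_const_zero, e2]
    exact tendsto_const_nhds
  · have hx : z / (2 * π) ∈ Complex.integerComplement := by
      rintro ⟨m, hm⟩
      apply h0
      rw [show z / 2 = m * π by rw [hm]; field_simp]
      exact Complex.sin_int_mul_pi m
    have hs : Summable (cotPair z) :=
      .of_norm_bounded summable_cotPair_bound (norm_cotPair_le hz)
    have h1 := cot_series_rep' hx
    have e (n : ℕ) : 1 / (z / (2 * π) - ((n : ℂ) + 1)) + 1 / (z / (2 * π) + ((n : ℂ) + 1)) =
        (2 * π) * cotPair z n := by
      rw [show z / (2 * π) - ((n : ℂ) + 1) = (z - 2 * π * (n + 1)) / (2 * π) by field_simp,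
        show z / (2 * π) + ((n : ℂ) + 1) = (z + 2 * π * (n + 1)) / (2 * π) by field_simp,
        one_div_div, one_div_div, cotPair]
      ring
    simp only [e] at h1
    rw [tsum_mul_left, show π * (z / (2 * π)) = z / 2 by field_simp, one_div_div] at h1
    have h2 : ∑' n, cotPair z n = cotRem z := by
      apply mul_left_cancel₀ (b := ∑' n, cotPair z n) (mul_ne_zero two_ne_zero hpi)
      rw [← h1, cotRem]
      ring
    rw [← h2]
    exact hs.hasSum.tendsto_sum_nat

theorem measurable_cotRem : Measurable cotRem := by
  have : cotRem = fun z => 1 / 2 * (Complex.cos (z / 2) / Complex.sin (z / 2)) - 1 / z := by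
    funext z
    rw [cotRem, Complex.cot_eq_cos_div_sin]
  rw [this]
  fun_prop

namespace IsCurve

variable {ζ v : ℝ → ℂ} {δ : ℝ}

theorem shift_nat (hc : IsCurve ζ v δ) (x : ℝ) (n : ℕ) :
    ζ (x + 2 * π * n) = ζ x + 2 * π * n := by
  induction n with
  | zero => simp
  | succ n ih =>
    push_cast
    rw [show x + 2 * π * (n + 1) = x + 2 * π * n + 2 * π by ring, hc.shift, ih]
    ring

theorem le_norm_chord (hc : IsCurve ζ v δ) (a b : ℝ) : |a - b| / 2 ≤ ‖ζ a - ζ b‖ := by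
  have h1 := hc.chord_near a b
  have h2 := norm_sub_norm_le ((a - b : ℝ) : ℂ) (ζ a - ζ b)
  rw [norm_sub_rev _ (ζ a - ζ b), Complex.norm_real, Real.norm_eq_abs] at h2
  have h3 : δ * |a - b| ≤ 1 / 16 * |a - b| := by gcongr; exact hc.small
  linarith [abs_nonneg (a - b)]

theorem norm_chord_le (hc : IsCurve ζ v δ) {a b : ℝ} (h : |a - b| ≤ π) : ‖ζ a - ζ b‖ ≤ 4 := by
  have h1 := hc.chord_near a b
  have h2 := norm_sub_norm_le (ζ a - ζ b) ((a - b : ℝ) : ℂ)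
  rw [Complex.norm_real, Real.norm_eq_abs] at h2
  have h3 : δ * |a - b| ≤ 1 / 16 * |a - b| := by gcongr; exact hc.small
  linarith [Real.pi_lt_d2]

/-- Chords spanning at most half a period avoid the poles of the cotangent other than the origin, so
the Mittag-Leffler expansion holds for each of them. -/
theorem chord_dichotomy (hc : IsCurve ζ v δ) {a b : ℝ} (h : |a - b| ≤ π) :
    ζ a - ζ b = 0 ∨ Complex.sin ((ζ a - ζ b) / 2) ≠ 0 := by
  by_cases h0 : a = b
  · left; rw [h0, sub_self]
  · right
    exact hc.sin_chord_ne_zero fun h1 => h0 (sub_eq_zero.1 ((sin_half_eq_zero_iff h).1 h1))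

theorem continuousOn_quot (hc : IsCurve ζ v δ) {F : ℝ → ℂ} (hF : Continuous F) (α : ℝ) :
    ContinuousOn (fun x => F x / (ζ α - ζ x)) {α}ᶜ := by
  refine hF.continuousOn.div (continuous_const.sub hc.continuous_curve).continuousOn
    fun x hx h => ?_
  have := hc.le_norm_chord α x
  rw [h, norm_zero] at this
  have h2 : |α - x| ≤ 0 := by linarith
  exact hx (sub_eq_zero.1 (abs_nonpos_iff.1 h2)).symm

theorem intervalIntegrable_quot_left (hc : IsCurve ζ v δ) {F : ℝ → ℂ} (hF : Continuous F) (α : ℝ)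
    {a b : ℝ} (ha : 0 < a) (hb : 0 < b) :
    IntervalIntegrable (fun t => F (α - t) / (ζ α - ζ (α - t))) volume a b := by
  refine ContinuousOn.intervalIntegrable ((hc.continuousOn_quot hF α).comp
    (f := fun t => α - t) (by fun_prop) fun t ht => ?_)
  have : 0 < t := (lt_min ha hb).trans_le ht.1
  simp only [mem_compl_iff, mem_singleton_iff]
  linarith

theorem intervalIntegrable_quot_right (hc : IsCurve ζ v δ) {F : ℝ → ℂ} (hF : Continuous F) (α : ℝ)
    {a b : ℝ} (ha : 0 < a) (hb : 0 < b) :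
    IntervalIntegrable (fun t => F (α + t) / (ζ α - ζ (α + t))) volume a b := by
  refine ContinuousOn.intervalIntegrable ((hc.continuousOn_quot hF α).comp
    (f := fun t => α + t) (by fun_prop) fun t ht => ?_)
  have : 0 < t := (lt_min ha hb).trans_le ht.1
  simp only [mem_compl_iff, mem_singleton_iff]
  linarith

/-- The symmetrized Birkhoff-Rott integrand at distance `t` from the singularity. -/
def foldedQuot (ζ : ℝ → ℂ) (F : ℝ → ℂ) (α t : ℝ) : ℂ :=
  F (α - t) / (ζ α - ζ (α - t)) + F (α + t) / (ζ α - ζ (α + t))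

theorem intervalIntegrable_foldedQuot (hc : IsCurve ζ v δ) {F : ℝ → ℂ} (hF : Continuous F) (α : ℝ)
    {a b : ℝ} (ha : 0 < a) (hb : 0 < b) :
    IntervalIntegrable (foldedQuot ζ F α) volume a b :=
  (hc.intervalIntegrable_quot_left hF α ha hb).add (hc.intervalIntegrable_quot_right hF α ha hb)

/-- The `n`-th period on either side, translated back to the central one, contributes one term of
the Mittag-Leffler expansion. -/
theorem integral_foldedQuot_period (hc : IsCurve ζ v δ) {F : ℝ → ℂ} (hF : Continuous F)
    (hp : Function.Periodic F (2 * π)) (α : ℝ) (n : ℕ) :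
    ∫ t in ((2 * n + 1) * π)..((2 * (n + 1) + 1) * π), foldedQuot ζ F α t =
      ∫ x in (α - π)..(α + π), F x * cotPair (ζ α - ζ x) n := by
  have hpi := Real.pi_pos
  have p1 : 0 < (2 * (n : ℝ) + 1) * π := by positivity
  have p2 : 0 < (2 * ((n : ℝ) + 1) + 1) * π := by positivity
  have hperiod (x : ℝ) : F (x + 2 * π * (n + 1 : ℕ)) = F x := by
    have := hp.nat_mul (n + 1) x
    rwa [mul_comm] at this
  have hperiod' (x : ℝ) : F (x - 2 * π * (n + 1 : ℕ)) = F x := by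
    rw [← hperiod, sub_add_cancel]
  have hz (x : ℝ) : ζ (x - 2 * π * (n + 1 : ℕ)) = ζ x - 2 * π * (n + 1 : ℕ) := by
    have := hc.shift_nat (x - 2 * π * (n + 1 : ℕ)) (n + 1)
    rw [sub_add_cancel] at this
    rw [this]; ring
  have hne {x : ℝ} (hx : x ∈ uIcc (α - π) (α + π)) : ‖ζ α - ζ x‖ ≤ 4 := by
    rw [uIcc_of_le (by linarith)] at hx
    exact hc.norm_chord_le (abs_le.2 ⟨by linarith [hx.2], by linarith [hx.1]⟩)
  have hn : (0 : ℝ) < (n : ℝ) + 1 := by positivity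
  have i1 : IntervalIntegrable (fun x => F x * (1 / (ζ α - ζ x - 2 * π * (n + 1)))) volume
      (α - π) (α + π) := by
    refine ContinuousOn.intervalIntegrable (hF.continuousOn.mul (continuousOn_const.div
      (by have := hc.continuous_curve; fun_prop) fun x hx => norm_pos_iff.1 ?_))
    linarith [(le_norm_sub_period (hne hx) n).1]
  have i2 : IntervalIntegrable (fun x => F x * (1 / (ζ α - ζ x + 2 * π * (n + 1)))) volume
      (α - π) (α + π) := by
    refine ContinuousOn.intervalIntegrable (hF.continuousOn.mul (continuousOn_const.div
      (by have := hc.continuous_curve; fun_prop) fun x hx => norm_pos_iff.1 ?_))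
    linarith [(le_norm_sub_period (hne hx) n).2]
  have e1 : ∫ t in ((2 * n + 1) * π)..((2 * (n + 1) + 1) * π), F (α + t) / (ζ α - ζ (α + t)) =
      ∫ x in (α - π)..(α + π), F x * (1 / (ζ α - ζ x - 2 * π * (n + 1))) := by
    rw [intervalIntegral.integral_comp_add_left (fun x => F x / (ζ α - ζ x)) α]
    have h := intervalIntegral.integral_comp_add_right (a := α - π) (b := α + π)
      (fun x => F x / (ζ α - ζ x)) (2 * π * (n + 1 : ℕ))
    rw [show α - π + 2 * π * (n + 1 : ℕ) = α + (2 * n + 1) * π by push_cast; ring,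
      show α + π + 2 * π * (n + 1 : ℕ) = α + (2 * (n + 1) + 1) * π by push_cast; ring] at h
    rw [← h]
    refine intervalIntegral.integral_congr fun x _ => ?_
    simp only [hperiod, hc.shift_nat]
    push_cast
    rw [sub_sub, mul_one_div]
  have e2 : ∫ t in ((2 * n + 1) * π)..((2 * (n + 1) + 1) * π), F (α - t) / (ζ α - ζ (α - t)) =
      ∫ x in (α - π)..(α + π), F x * (1 / (ζ α - ζ x + 2 * π * (n + 1))) := by
    rw [intervalIntegral.integral_comp_sub_left (fun x => F x / (ζ α - ζ x)) α]
    have h := intervalIntegral.integral_comp_sub_right (a := α - π) (b := α + π)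
      (fun x => F x / (ζ α - ζ x)) (2 * π * (n + 1 : ℕ))
    rw [show α - π - 2 * π * (n + 1 : ℕ) = α - (2 * (n + 1) + 1) * π by push_cast; ring,
      show α + π - 2 * π * (n + 1 : ℕ) = α - (2 * n + 1) * π by push_cast; ring] at h
    rw [← h]
    refine intervalIntegral.integral_congr fun x _ => ?_
    simp only [hperiod', hz]
    push_cast
    rw [mul_one_div]
    congr 1
    ring
  unfold foldedQuot
  rw [intervalIntegral.integral_add (hc.intervalIntegrable_quot_left hF α p1 p2)
    (hc.intervalIntegrable_quot_right hF α p1 p2), e1, e2, add_comm,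
    ← intervalIntegral.integral_add i1 i2]
  refine intervalIntegral.integral_congr fun x _ => ?_
  simp only [cotPair]
  ring

theorem intervalIntegrable_mul_cotPair (hc : IsCurve ζ v δ) {F : ℝ → ℂ} (hF : Continuous F)
    (α : ℝ) (n : ℕ) :
    IntervalIntegrable (fun x => F x * cotPair (ζ α - ζ x) n) volume (α - π) (α + π) := by
  have hn : (0 : ℝ) < (n : ℝ) + 1 := by positivity
  refine ContinuousOn.intervalIntegrable (hF.continuousOn.mul ?_)
  have hcc := hc.continuous_curve
  unfold cotPair
  have hne {x : ℝ} (hx : x ∈ uIcc (α - π) (α + π)) : ‖ζ α - ζ x‖ ≤ 4 := by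
    rw [uIcc_of_le (by linarith [Real.pi_pos])] at hx
    exact hc.norm_chord_le (abs_le.2 ⟨by linarith [hx.2], by linarith [hx.1]⟩)
  refine (continuousOn_const.div (by fun_prop) fun x hx => norm_pos_iff.1 ?_).add
    (continuousOn_const.div (by fun_prop) fun x hx => norm_pos_iff.1 ?_)
  · linarith [(le_norm_sub_period (hne hx) n).1]
  · linarith [(le_norm_sub_period (hne hx) n).2]

theorem integral_foldedQuot_periods (hc : IsCurve ζ v δ) {F : ℝ → ℂ} (hF : Continuous F)
    (hp : Function.Periodic F (2 * π)) (α : ℝ) (N : ℕ) :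
    ∫ t in π..((2 * N + 1) * π), foldedQuot ζ F α t =
      ∫ x in (α - π)..(α + π), F x * ∑ n ∈ Finset.range N, cotPair (ζ α - ζ x) n := by
  have hpi := Real.pi_pos
  induction N with
  | zero => simp
  | succ N ih =>
    have h1 := hc.integral_foldedQuot_period hF hp α N
    push_cast
    rw [← intervalIntegral.integral_add_adjacent_intervals (b := (2 * N + 1) * π)
      (hc.intervalIntegrable_foldedQuot hF α hpi (by positivity))
      (hc.intervalIntegrable_foldedQuot hF α (by positivity) (by positivity)), ih, h1,
      ← intervalIntegral.integral_add]
    · refine intervalIntegral.integral_congr fun x _ => ?_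
      simp only [Finset.sum_range_succ]
      ring
    · simp only [Finset.mul_sum]
      have := IntervalIntegrable.sum (Finset.range N) fun n _ =>
        hc.intervalIntegrable_mul_cotPair hF α n
      rwa [Finset.sum_fn] at this
    · exact hc.intervalIntegrable_mul_cotPair hF α N

theorem norm_cotRem_le (hc : IsCurve ζ v δ) {α x : ℝ} (hx : |α - x| ≤ π) :
    ‖cotRem (ζ α - ζ x)‖ ≤ cotPairBound :=
  le_of_tendsto (tendsto_sum_cotPair (hc.norm_chord_le hx) (hc.chord_dichotomy hx)).norm
    (Eventually.of_forall fun N => norm_sum_cotPair_le (hc.norm_chord_le hx) N)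

theorem intervalIntegrable_mul_cotRem (hc : IsCurve ζ v δ) {F : ℝ → ℂ} (hF : Continuous F)
    (α : ℝ) : IntervalIntegrable (fun x => F x * cotRem (ζ α - ζ x)) volume (α - π) (α + π) := by
  have hpi := Real.pi_pos
  have h : IntervalIntegrable (fun x => cotRem (ζ α - ζ x)) volume (α - π) (α + π) := by
    refine (intervalIntegrable_const (c := cotPairBound)).mono_fun ?_ ?_
    · exact (measurable_cotRem.comp
        (measurable_const.sub hc.continuous_curve.measurable)).aestronglyMeasurable
    · filter_upwards [ae_restrict_mem measurableSet_uIoc] with x hx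
      rw [uIoc_of_le (by linarith)] at hx
      refine (hc.norm_cotRem_le (abs_le.2 ⟨?_, ?_⟩)).trans (Real.le_norm_self _) <;>
        linarith [hx.1, hx.2]
  exact h.continuousOn_mul hF.continuousOn

/-- The crude decay `1 / t` suffices for the incomplete last period. -/
theorem norm_foldedQuot_le (hc : IsCurve ζ v δ) {F : ℝ → ℂ} {C : ℝ} (hC : ∀ x, ‖F x‖ ≤ C)
    (α : ℝ) {t : ℝ} (ht : 0 < t) : ‖foldedQuot ζ F α t‖ ≤ 4 * C / t := by
  have hC0 : 0 ≤ C := (norm_nonneg _).trans (hC 0)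
  have h1 := hc.le_norm_chord α (α - t)
  have h2 := hc.le_norm_chord α (α + t)
  rw [show α - (α - t) = t by ring, abs_of_pos ht] at h1
  rw [show α - (α + t) = -t by ring, abs_neg, abs_of_pos ht] at h2
  calc ‖foldedQuot ζ F α t‖ ≤ ‖F (α - t) / (ζ α - ζ (α - t))‖ + ‖F (α + t) / (ζ α - ζ (α + t))‖ :=
        norm_add_le _ _
    _ ≤ C / (t / 2) + C / (t / 2) := by
        rw [norm_div, norm_div]
        gcongr
        · exact hC _
        · exact hC _
    _ = 4 * C / t := by field_simp; ring

/-- The tail of the Birkhoff-Rott integral, beyond the central period. -/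
theorem tendsto_tail (hc : IsCurve ζ v δ) {F : ℝ → ℂ} (hF : Continuous F)
    (hp : Function.Periodic F (2 * π)) (α : ℝ) :
    Tendsto (fun R => ∫ t in π..R, foldedQuot ζ F α t) atTop
      (𝓝 (∫ x in (α - π)..(α + π), F x * cotRem (ζ α - ζ x))) := by
  have hpi := Real.pi_pos
  obtain ⟨C, hC⟩ : ∃ C, ∀ x, ‖F x‖ ≤ C := by
    obtain ⟨C, hC⟩ := (isCompact_Icc (a := (0 : ℝ)) (b := 2 * π)).exists_bound_of_continuousOn
      hF.continuousOn
    refine ⟨C, fun x => ?_⟩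
    obtain ⟨y, hy, hxy⟩ := hp.exists_mem_Ico₀ Real.two_pi_pos x
    rw [hxy]
    exact hC y (Ico_subset_Icc_self hy)
  have hC0 : 0 ≤ C := (norm_nonneg _).trans (hC 0)
  -- convergence along whole numbers of periods
  have h1 : Tendsto (fun N : ℕ => ∫ t in π..((2 * N + 1) * π), foldedQuot ζ F α t) atTop
      (𝓝 (∫ x in (α - π)..(α + π), F x * cotRem (ζ α - ζ x))) := by
    simp only [hc.integral_foldedQuot_periods hF hp]
    have hx {x : ℝ} (h : x ∈ uIoc (α - π) (α + π)) : |α - x| ≤ π := by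
      rw [uIoc_of_le (by linarith)] at h
      exact abs_le.2 ⟨by linarith [h.2], by linarith [h.1]⟩
    refine intervalIntegral.tendsto_integral_filter_of_dominated_convergence
      (fun _ => C * cotPairBound) (Eventually.of_forall fun N => ?_)
      (Eventually.of_forall fun N => ae_of_all _ fun x h => ?_) intervalIntegrable_const
      (ae_of_all _ fun x h => ?_)
    · have h := IntervalIntegrable.sum (Finset.range N) fun n _ =>
        hc.intervalIntegrable_mul_cotPair hF α n
      rw [Finset.sum_fn] at h
      simp only [Finset.mul_sum]
      exact h.aestronglyMeasurable_restrict_uIoc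
    · rw [norm_mul]
      exact mul_le_mul (hC x) (norm_sum_cotPair_le (hc.norm_chord_le (hx h)) N) (norm_nonneg _) hC0
    · exact (tendsto_sum_cotPair (hc.norm_chord_le (hx h)) (hc.chord_dichotomy (hx h))).const_mul _
  -- the rest of an incomplete period is small
  have hfloor : Tendsto (fun R : ℝ => ⌊(R - π) / (2 * π)⌋₊) atTop atTop :=
    tendsto_nat_floor_atTop.comp
      ((tendsto_atTop_add_const_right atTop (-π) tendsto_id).atTop_div_const Real.two_pi_pos)
  have h2 := h1.comp hfloor
  have h3 : Tendsto (fun R : ℝ => 8 * C / (2 * (⌊(R - π) / (2 * π)⌋₊ : ℝ) + 1)) atTop (𝓝 0) := by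
    have : Tendsto (fun R : ℝ => 2 * (⌊(R - π) / (2 * π)⌋₊ : ℝ) + 1) atTop atTop :=
      tendsto_atTop_add_const_right _ _
        ((tendsto_natCast_atTop_atTop.comp hfloor).const_mul_atTop two_pos)
    exact this.const_div_atTop _
  have h4 : Tendsto (fun R : ℝ => (∫ t in π..R, foldedQuot ζ F α t) -
      ∫ t in π..((2 * (⌊(R - π) / (2 * π)⌋₊ : ℝ) + 1) * π), foldedQuot ζ F α t) atTop (𝓝 0) := by
    refine squeeze_zero_norm' ?_ h3
    filter_upwards [eventually_ge_atTop π] with R hR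
    set n : ℕ := ⌊(R - π) / (2 * π)⌋₊
    have hn1 : (n : ℝ) ≤ (R - π) / (2 * π) := Nat.floor_le (by
      have := sub_nonneg.2 hR
      positivity)
    have hn2 : (R - π) / (2 * π) < n + 1 := Nat.lt_floor_add_one _
    rw [le_div_iff₀ Real.two_pi_pos] at hn1
    rw [div_lt_iff₀ Real.two_pi_pos] at hn2
    have hpos : 0 < (2 * (n : ℝ) + 1) * π := by positivity
    have hle : (2 * (n : ℝ) + 1) * π ≤ R := by nlinarith
    rw [intervalIntegral.integral_interval_sub_left
      (hc.intervalIntegrable_foldedQuot hF α hpi (hpi.trans_le hR))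
      (hc.intervalIntegrable_foldedQuot hF α hpi hpos)]
    have h5 := intervalIntegral.norm_integral_le_of_norm_le_const
      (a := (2 * (n : ℝ) + 1) * π) (b := R) (f := foldedQuot ζ F α)
      (C := 4 * C / ((2 * (n : ℝ) + 1) * π)) fun t ht => by
        rw [uIoc_of_le hle] at ht
        refine (hc.norm_foldedQuot_le hC α (hpos.trans ht.1)).trans ?_
        gcongr
        exact ht.1.le
    refine h5.trans ?_
    rw [abs_of_nonneg (by linarith)]
    calc 4 * C / ((2 * (n : ℝ) + 1) * π) * (R - (2 * n + 1) * π) ≤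
          4 * C / ((2 * (n : ℝ) + 1) * π) * (2 * π) := by
            gcongr
            linarith
      _ = 8 * C / (2 * (n : ℝ) + 1) := by field_simp; ring
  have h5 := h4.add h2
  simpa using h5

/-- The principal value over the line equals the principal value of the cotangent kernel over one
period. -/
theorem tendsto_line_of_tendsto_cot (hc : IsCurve ζ v δ) {F : ℝ → ℂ} (hF : Continuous F)
    (hp : Function.Periodic F (2 * π)) {α : ℝ} {L : ℂ}
    (h : Tendsto (fun ε => ∫ x in {x | ε < |x - α| ∧ |x - α| < π},
      F x * Complex.cot ((ζ α - ζ x) / 2)) (𝓝[>] (0 : ℝ)) (𝓝 (2 * L))) :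
    Tendsto (fun p : ℝ × ℝ => ∫ x in {x | p.1 < |x - α| ∧ |x - α| < p.2}, F x / (ζ α - ζ x))
      (𝓝[>] (0 : ℝ) ×ˢ atTop) (𝓝 L) := by
  have hpi := Real.pi_pos
  set I : ℂ := ∫ x in (α - π)..(α + π), F x * cotRem (ζ α - ζ x)
  have hi := hc.intervalIntegrable_mul_cotRem hF α
  have h1 := (h.const_mul (1 / 2)).sub (tendsto_integral_annulus hpi hi)
  have h2 : Tendsto (fun ε => ∫ t in ε..π, foldedQuot ζ F α t) (𝓝[>] 0) (𝓝 (L - I)) := by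
    rw [show 1 / 2 * (2 * L) = L by ring] at h1
    refine h1.congr' ?_
    filter_upwards [Ioc_mem_nhdsGT hpi] with ε hε
    have h3 := integral_annulus (F := fun x => F x / (ζ α - ζ x)) (a := α) hε.1.le hε.2
      (hc.intervalIntegrable_quot_left hF α hε.1 hpi)
      (hc.intervalIntegrable_quot_right hF α hε.1 hpi)
    refine Eq.trans ?_ h3
    have hj : IntegrableOn (fun x => F x / (ζ α - ζ x)) {x | ε < |x - α| ∧ |x - α| < π} := by
      refine IntegrableOn.mono_set (t := {x : ℝ | ε ≤ |x - α| ∧ |x - α| ≤ π}) ?_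
        fun x hx => ⟨hx.1.le, hx.2.le⟩
      refine ContinuousOn.integrableOn_compact (isCompact_annulus _ _ _)
        ((hc.continuousOn_quot hF α).mono fun x hx h0 => ?_)
      rw [mem_singleton_iff] at h0
      have := hx.1
      rw [h0, sub_self, abs_zero] at this
      linarith [hε.1]
    rw [← integral_const_mul, sub_eq_iff_eq_add, ← integral_annulus_add hj
      (integrableOn_annulus_of_intervalIntegrable hi hpi)]
    refine integral_congr_ae (ae_of_all _ fun x => ?_)
    simp only [cotRem]
    ring
  have h3 := (h2.comp tendsto_fst).add ((hc.tendsto_tail hF hp α).comp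
    (tendsto_snd (f := 𝓝[>] (0 : ℝ)) (g := atTop)))
  rw [sub_add_cancel] at h3
  refine h3.congr' ?_
  filter_upwards [prod_mem_prod (Ioc_mem_nhdsGT hpi) (Ici_mem_atTop π)] with p hp'
  have p1 : 0 < p.1 := hp'.1.1
  have p2 : π ≤ p.2 := hp'.2
  have p3 : 0 < p.2 := hpi.trans_le p2
  simp only [Function.comp_apply]
  rw [intervalIntegral.integral_add_adjacent_intervals
    (hc.intervalIntegrable_foldedQuot hF α p1 hpi) (hc.intervalIntegrable_foldedQuot hF α hpi p3)]
  exact (integral_annulus (F := fun x => F x / (ζ α - ζ x)) (a := α) p1.le (hp'.1.2.trans p2)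
    (hc.intervalIntegrable_quot_left hF α p1 p3)
    (hc.intervalIntegrable_quot_right hF α p1 p3)).symm

/-- The Birkhoff-Rott principal value along a curve, for the density `v (f₁ + i f₂)`. -/
theorem tendsto_birkhoffRott (hc : IsCurve ζ v δ) {F : ℝ → ℂ} (f₁ f₂ : H1)
    (hF : ∀ x, F x = v x * (f₁ x + Complex.I * f₂ x)) (α : ℝ) :
    Tendsto (fun p : ℝ × ℝ => ∫ x in {x | p.1 < |x - α| ∧ |x - α| < p.2}, F x / (ζ α - ζ x))
      (𝓝[>] (0 : ℝ) ×ˢ atTop)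
      (𝓝 (π * ((hilbertL f₁ α + logPotential ζ v f₁ α) +
        Complex.I * (hilbertL f₂ α + logPotential ζ v f₂ α)))) := by
  have hFe : F = fun x => v x * (f₁ x + Complex.I * f₂ x) := funext hF
  have hcont : Continuous F := by
    rw [hFe]
    exact hc.continuous.mul ((Complex.continuous_ofReal.comp f₁.continuous).add
      (continuous_const.mul (Complex.continuous_ofReal.comp f₂.continuous)))
  have hper : Function.Periodic F (2 * π) := fun x => by
    have h1 := f₁.periodic x
    have h2 := f₂.periodic x
    rw [hF, hF, h1, h2, hc.v_periodic]
  refine hc.tendsto_line_of_tendsto_cot hcont hper ?_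
  have h := (hc.tendsto_cot_chord f₁ α).add ((hc.tendsto_cot_chord f₂ α).const_mul Complex.I)
  rw [show 2 * π * (hilbertL f₁ α + logPotential ζ v f₁ α) +
    Complex.I * (2 * π * (hilbertL f₂ α + logPotential ζ v f₂ α)) =
    2 * (π * ((hilbertL f₁ α + logPotential ζ v f₁ α) +
        Complex.I * (hilbertL f₂ α + logPotential ζ v f₂ α))) by ring] at h
  refine h.congr' ?_
  filter_upwards [self_mem_nhdsWithin] with ε hε
  have hε0 : 0 < ε := hε
  have hi (f : H1) : IntegrableOn (fun x => (f x : ℂ) * (v x * Complex.cot ((ζ α - ζ x) / 2)))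
      {x | ε < |x - α| ∧ |x - α| < π} := by
    have h1 : IntegrableOn (fun x => (f x : ℂ) * (Real.cot (1 / 2 * (α - x)) : ℝ))
        {x | ε < |x - α| ∧ |x - α| < π} := by
      refine IntegrableOn.mono_set (t := {x : ℝ | ε ≤ |x - α| ∧ |x - α| ≤ π}) ?_
        fun x hx => ⟨hx.1.le, hx.2.le⟩
      exact ContinuousOn.integrableOn_compact (isCompact_annulus _ _ _)
        ((Complex.continuous_ofReal.comp f.continuous).continuousOn.mul
          (Complex.continuous_ofReal.comp_continuousOn (continuousOn_cot_half α hε0)))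
    have h2 := integrableOn_annulus_of_intervalIntegrable (ε := ε)
      (hc.intervalIntegrable_mul_cotKernel f α (α - π) (α + π)).neg Real.pi_pos
    refine (h1.add h2).congr_fun_ae (ae_of_all _ fun x => ?_)
    simp only [cot_chord_eq, Pi.add_apply, Pi.neg_apply]
    ring
  rw [← integral_const_mul, ← integral_annulus_add (hi f₁) ((hi f₂).const_mul Complex.I)]
  refine integral_congr_ae (ae_of_all _ fun x => ?_)
  simp only [hF]
  ring

end IsCurve

/-! ### The renormalized curve of a small odd tangent angle -/

theorem mean_eq_zero_of_odd {f : ℝ → ℝ} (hp : Function.Periodic f (2 * π))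
    (h : ∀ x, f (-x) = -f x) : mean f = 0 := by
  have h1 := hp.intervalIntegral_add_eq (-(2 * π)) 0
  rw [neg_add_cancel, zero_add] at h1
  have h2 := intervalIntegral.integral_comp_neg (a := 0) (b := 2 * π) f
  simp only [h, intervalIntegral.integral_neg, neg_zero] at h2
  rw [h1] at h2
  rw [mean, show ∫ a in (0 : ℝ)..(2 * π), f a = 0 by linarith, mul_zero]

/-- The mean of `cos θ`. -/
def cosMean (θ : H1) : ℝ := mean (H1.cos θ)

/-- The renormalized curve, rescaled to have period `2π`. -/
def unitCurve (θ : H1) (α : ℝ) : ℂ :=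
  (1 / cosMean θ : ℝ) * ∫ β in (0 : ℝ)..α, Complex.exp (Complex.I * θ β)

/-- The derivative of `unitCurve`. -/
def unitVelocity (θ : H1) (α : ℝ) : ℂ := (1 / cosMean θ : ℝ) * Complex.exp (Complex.I * θ α)

theorem exp_I_mul (x : ℝ) : Complex.exp (Complex.I * x) = Real.cos x + Complex.I * Real.sin x := by
  rw [mul_comm, Complex.exp_mul_I, Complex.ofReal_cos, Complex.ofReal_sin]
  ring

theorem norm_exp_I_mul_sub_le (x y : ℝ) :
    ‖Complex.exp (Complex.I * x) - Complex.exp (Complex.I * y)‖ ≤ |x - y| := by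
  have e : Complex.exp (Complex.I * x) - Complex.exp (Complex.I * y) =
      Complex.exp (Complex.I * y) * (Complex.exp (Complex.I * ((x - y : ℝ) : ℂ)) - 1) := by
    rw [mul_sub, ← Complex.exp_add, mul_one]
    congr 2
    push_cast
    ring
  have h := Real.norm_exp_I_mul_ofReal_sub_one_le (x := x - y)
  rw [e, norm_mul, mul_comm Complex.I (y : ℂ), Complex.norm_exp_ofReal_mul_I, one_mul]
  exact h

theorem continuous_exp_I_mul (θ : H1) : Continuous fun β => Complex.exp (Complex.I * θ β) :=
  Complex.continuous_exp.comp
    (continuous_const.mul (Complex.continuous_ofReal.comp θ.continuous))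

theorem hasDerivAt_unitCurve (θ : H1) (x : ℝ) :
    HasDerivAt (unitCurve θ) (unitVelocity θ x) x :=
  ((continuous_exp_I_mul θ).integral_hasStrictDerivAt 0 x).hasDerivAt.const_mul _

theorem mean_sin_of_odd {θ : H1} (hθ : ∀ x, θ (-x) = -θ x) : mean (H1.sin θ) = 0 :=
  mean_eq_zero_of_odd (H1.sin θ).periodic fun x => by
    rw [H1.sin_apply, H1.sin_apply, hθ, Real.sin_neg]

/-- The mean of `cos θ` is critical at the flat sheet. -/
theorem abs_cosMean_sub_one_le (θ : H1) : |cosMean θ - 1| ≤ (4 * ‖θ‖) ^ 2 := by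
  have h1 : ‖∫ x in (0 : ℝ)..(2 * π), (Real.cos (θ x) - 1)‖ ≤ (4 * ‖θ‖) ^ 2 * |2 * π - 0| := by
    refine intervalIntegral.norm_integral_le_of_norm_le_const fun x _ => ?_
    refine (abs_one_sub_cos_le _).trans ?_
    rw [← sq_abs]
    gcongr
    exact θ.abs_apply_le x
  have h2 : ∫ x in (0 : ℝ)..(2 * π), (Real.cos (θ x) - 1) =
      (∫ x in (0 : ℝ)..(2 * π), Real.cos (θ x)) - 2 * π := by
    refine (intervalIntegral.integral_sub ((H1.cos θ).intervalIntegrable _ _)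
      intervalIntegrable_const).trans ?_
    simp
  have h3 : cosMean θ - 1 = 1 / (2 * π) * ∫ x in (0 : ℝ)..(2 * π), (Real.cos (θ x) - 1) := by
    rw [h2, mul_sub]
    change 1 / (2 * π) * (∫ x in (0 : ℝ)..(2 * π), Real.cos (θ x)) - 1 = _
    field_simp
  rw [h3, abs_mul, abs_of_pos (by positivity : 0 < 1 / (2 * π))]
  rw [Real.norm_eq_abs, sub_zero, abs_of_pos Real.two_pi_pos] at h1
  calc 1 / (2 * π) * |∫ x in (0 : ℝ)..(2 * π), (Real.cos (θ x) - 1)| ≤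
        1 / (2 * π) * ((4 * ‖θ‖) ^ 2 * (2 * π)) := by gcongr
    _ = (4 * ‖θ‖) ^ 2 := by field_simp

theorem half_le_cosMean {θ : H1} (h : ‖θ‖ ≤ 1 / 144) : 1 / 2 ≤ cosMean θ := by
  have h1 := (abs_le.1 (abs_cosMean_sub_one_le θ)).1
  have h2 : (4 * ‖θ‖) ^ 2 ≤ (4 * (1 / 144)) ^ 2 := by gcongr
  linarith

/-- The Hölder condition comes from the embedding of `H¹_per` into `C^{1/2}`; oddness of `θ` makes
the mean of `e^{iθ}` real, so that the curve is periodic. -/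
theorem isCurve_unitCurve {θ : H1} (hθ : ∀ x, θ (-x) = -θ x) (h : ‖θ‖ ≤ 1 / 144) :
    IsCurve (unitCurve θ) (unitVelocity θ) (9 * ‖θ‖) := by
  have hm := half_le_cosMean h
  have hm0 : 0 < cosMean θ := by linarith
  have hinv : 1 / cosMean θ ≤ 2 := by
    rw [div_le_iff₀ hm0]
    linarith
  have hn := norm_nonneg θ
  have hdiff (a b : ℝ) : ‖unitVelocity θ a - unitVelocity θ b‖ ≤ 2 * |θ a - θ b| := by
    rw [unitVelocity, unitVelocity, ← mul_sub, norm_mul, Complex.norm_real,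
      Real.norm_of_nonneg (by positivity)]
    exact mul_le_mul hinv (norm_exp_I_mul_sub_le _ _) (norm_nonneg _) two_pos.le
  -- `9 ‖θ‖` absorbs the factor `1 / cosMean θ ≤ 2` and the constant `4` of the Sobolev embedding
  refine ⟨by positivity, by linarith, hasDerivAt_unitCurve θ, fun x => ?_, fun x => ?_,
    fun a b hab => ?_, continuous_const.mul (continuous_exp_I_mul θ)⟩
  · have hi (a b : ℝ) := (continuous_exp_I_mul θ).intervalIntegrable (μ := volume) a b
    have hper : Function.Periodic (fun β => Complex.exp (Complex.I * θ β)) (2 * π) := fun y => by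
      have := θ.periodic y
      simp only [this]
    have h1 := hper.intervalIntegral_add_eq x 0
    have h2 : ∫ β in (0 : ℝ)..(2 * π), Complex.exp (Complex.I * θ β) = 2 * π * cosMean θ := by
      have hs : ∫ β in (0 : ℝ)..(2 * π), Real.sin (θ β) = 0 := by
        have hs := mean_sin_of_odd hθ
        have h2p : 1 / (2 * π) ≠ 0 := by positivity
        exact (mul_eq_zero.1 hs).resolve_left h2p
      have hc : 2 * π * cosMean θ = ∫ β in (0 : ℝ)..(2 * π), Real.cos (θ β) := by
        change 2 * π * (1 / (2 * π) * ∫ β in (0 : ℝ)..(2 * π), Real.cos (θ β)) = _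
        field_simp
      simp only [exp_I_mul]
      refine (intervalIntegral.integral_add
        (intervalIntegrable_ofReal ((H1.cos θ).intervalIntegrable _ _))
        ((intervalIntegrable_ofReal ((H1.sin θ).intervalIntegrable _ _)).const_mul _)).trans ?_
      rw [intervalIntegral.integral_const_mul]
      refine (congrArg₂ (fun a b => a + Complex.I * b) intervalIntegral.integral_ofReal
        intervalIntegral.integral_ofReal).trans
        (?_ : ((∫ β in (0 : ℝ)..(2 * π), Real.cos (θ β) : ℝ) : ℂ) +
          Complex.I * ((∫ β in (0 : ℝ)..(2 * π), Real.sin (θ β) : ℝ) : ℂ) = _)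
      rw [hs, ← hc]
      push_cast
      ring
    rw [zero_add, h2] at h1
    rw [unitCurve, unitCurve, ← intervalIntegral.integral_add_adjacent_intervals (hi 0 x) (hi x _),
      h1, mul_add]
    congr 1
    push_cast
    have : (cosMean θ : ℂ) ≠ 0 := by exact_mod_cast hm0.ne'
    field_simp
  · have e : unitVelocity θ x - 1 =
        (1 / cosMean θ : ℝ) * ((Complex.exp (Complex.I * θ x) - Complex.exp (Complex.I * (0 : ℝ))) +
          ((1 - cosMean θ : ℝ) : ℂ)) := by
      have : (cosMean θ : ℂ) ≠ 0 := by exact_mod_cast hm0.ne'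
      rw [unitVelocity]
      push_cast
      rw [mul_zero, Complex.exp_zero]
      field_simp
      ring
    rw [e, norm_mul, Complex.norm_real, Real.norm_of_nonneg (by positivity)]
    have h1 := norm_exp_I_mul_sub_le (θ x) 0
    have h2 := θ.abs_apply_le x
    have h3 := abs_cosMean_sub_one_le θ
    rw [sub_zero] at h1
    calc 1 / cosMean θ * _ ≤ 2 * (4 * ‖θ‖ + (4 * ‖θ‖) ^ 2) := by
          refine mul_le_mul hinv ((norm_add_le _ _).trans (add_le_add (h1.trans h2) ?_))
            (norm_nonneg _) two_pos.le
          rwa [Complex.norm_real, Real.norm_eq_abs, abs_sub_comm]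
      _ ≤ 9 * ‖θ‖ := by nlinarith
  · have h1 := θ.sq_sub_le (a := b) (b := a) hab
    have h2 : |θ a - θ b| ≤ ‖θ‖ * √|a - b| := by
      refine abs_le_of_sq_le_sq ?_ (by positivity)
      rw [mul_pow, Real.sq_sqrt (abs_nonneg _)]
      refine h1.trans ?_
      rw [mul_comm]
      gcongr
      exact θ.energy_le
    calc _ ≤ 2 * |θ a - θ b| := hdiff a b
      _ ≤ 2 * (‖θ‖ * √|a - b|) := by gcongr
      _ ≤ 9 * ‖θ‖ * √|a - b| := by nlinarith [mul_nonneg hn (Real.sqrt_nonneg |a - b|)]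

/-! #### Parity -/

theorem conj_unitVelocity {θ : H1} (hθ : ∀ x, θ (-x) = -θ x) (x : ℝ) :
    unitVelocity θ (-x) = (starRingEnd ℂ) (unitVelocity θ x) := by
  rw [unitVelocity, unitVelocity, hθ, map_mul, ← Complex.exp_conj, map_mul, Complex.conj_ofReal,
    Complex.conj_ofReal, Complex.conj_I]
  push_cast
  ring_nf

theorem conj_unitCurve {θ : H1} (hθ : ∀ x, θ (-x) = -θ x) (x : ℝ) :
    unitCurve θ (-x) = -(starRingEnd ℂ) (unitCurve θ x) := by
  have h := intervalIntegral.integral_comp_neg (a := 0) (b := x)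
    (fun β => Complex.exp (Complex.I * θ β))
  rw [neg_zero] at h
  rw [unitCurve, unitCurve, map_mul, Complex.conj_ofReal, intervalIntegral.integral_symm, ← h,
    ← intervalIntegral_conj, mul_neg]
  congr 3
  funext β
  rw [hθ, ← Complex.exp_conj, map_mul, Complex.conj_ofReal, Complex.conj_I]
  push_cast
  ring_nf

theorem conj_ratio {θ : H1} (hθ : ∀ x, θ (-x) = -θ x) (s x : ℝ) :
    ratio (unitCurve θ) (unitVelocity θ) (-s) (-x) =
    (starRingEnd ℂ) (ratio (unitCurve θ) (unitVelocity θ) s x) := by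
  have e : Real.sin ((-s - -x) / 2) = -Real.sin ((s - x) / 2) := by
    rw [← Real.sin_neg]
    congr 1
    ring
  unfold ratio
  rw [e]
  by_cases h : Real.sin ((s - x) / 2) = 0
  · rw [if_pos (by rw [h, neg_zero]), if_pos h, conj_unitVelocity hθ]
  · rw [if_neg (neg_ne_zero.2 h), if_neg h, map_div₀, Complex.conj_ofReal, ← Complex.sin_conj,
      conj_unitCurve hθ, conj_unitCurve hθ, map_div₀, map_sub, Complex.conj_ofNat]
    rw [show (-(starRingEnd ℂ) (unitCurve θ s) - -(starRingEnd ℂ) (unitCurve θ x)) / 2 =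
      -(((starRingEnd ℂ) (unitCurve θ s) - (starRingEnd ℂ) (unitCurve θ x)) / 2) by ring,
      Complex.sin_neg]
    push_cast
    rw [neg_div_neg_eq]

theorem conj_logRatio {θ : H1} (hθ : ∀ x, θ (-x) = -θ x) (hn : ‖θ‖ ≤ 1 / 144) (s x : ℝ) :
    logRatio (unitCurve θ) (unitVelocity θ) (-s) (-x) =
      (starRingEnd ℂ) (logRatio (unitCurve θ) (unitVelocity θ) s x) := by
  rw [logRatio, conj_ratio hθ, Complex.log_conj, logRatio]
  exact Complex.slitPlane_arg_ne_pi ((isCurve_unitCurve hθ hn).ratio_mem_slitPlane s x)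

/-- The logarithmic potential exchanges parities, up to conjugation. -/
theorem logPotential_neg {θ : H1} (hθ : ∀ x, θ (-x) = -θ x) (hn : ‖θ‖ ≤ 1 / 144) {f : H1} {σ : ℝ}
    (hf : ∀ x, f (-x) = σ * f x) (α : ℝ) :
    logPotential (unitCurve θ) (unitVelocity θ) f (-α) =
      -σ * (starRingEnd ℂ) (logPotential (unitCurve θ) (unitVelocity θ) f α) := by
  have hc := isCurve_unitCurve hθ hn
  have hd (x : ℝ) : deriv f (-x) = -σ * deriv f x := by
    have h1 : deriv (fun y => f (-y)) x = -deriv f (-x) := deriv_comp_neg f x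
    have h2 : (fun y => f (-y)) = fun y => σ * f y := funext hf
    rw [h2, deriv_const_mul_field] at h1
    linarith
  set G : ℝ → ℂ := fun x => ((deriv f x : ℝ) : ℂ) *
    logRatio (unitCurve θ) (unitVelocity θ) (-α) x with hG
  have hper : Function.Periodic G (2 * π) := fun x => by
    have h1 := f.deriv_periodic x
    have h2 := hc.logRatio_periodic' (-α) x
    simp only at h2
    simp only [hG, h1, h2]
  have h1 := hper.intervalIntegral_add_eq (-(2 * π)) 0
  rw [neg_add_cancel, zero_add] at h1
  have h2 := intervalIntegral.integral_comp_neg (a := 0) (b := 2 * π) G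
  rw [neg_zero, h1] at h2
  have h3 : ∫ x in (0 : ℝ)..(2 * π), G (-x) = -σ * (starRingEnd ℂ) (∫ x in (0 : ℝ)..(2 * π),
      ((deriv f x : ℝ) : ℂ) * logRatio (unitCurve θ) (unitVelocity θ) α x) := by
    rw [← intervalIntegral_conj, ← intervalIntegral.integral_const_mul]
    refine intervalIntegral.integral_congr fun x _ => ?_
    simp only [hG, hd, conj_logRatio hθ hn, map_mul, Complex.conj_ofReal]
    push_cast
    ring
  rw [logPotential, logPotential, ← h2, h3, map_mul, map_div₀, map_one, Complex.conj_ofReal]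
  ring

theorem hilbertL_odd_of_even {f : H1} (hf : ∀ x, f (-x) = f x) (x : ℝ) :
    hilbertL f (-x) = -hilbertL f x := by
  simp only [hilbertL_eq_folded, foldedHilbert, hilbertIntegrand]
  rw [← mul_neg, ← intervalIntegral.integral_neg]
  congr 2
  funext t
  rw [show -x - t = -(x + t) by ring, show -x + t = -(x - t) by ring, hf, hf]
  ring

/-- The normalized primitive of an odd or even function has the opposite parity. -/
theorem H1.primL_neg {f : H1} {σ : ℝ} (hf : ∀ x, f (-x) = σ * f x)
    (hσ : mean f = 0 ∨ σ = 1) (x : ℝ) : H1.primL f (-x) = -σ * H1.primL f x := by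
  have h := intervalIntegral.integral_comp_neg (a := 0) (b := x) f
  rw [neg_zero] at h
  have h2 : ∫ a in (0 : ℝ)..x, f (-a) = σ * ∫ a in (0 : ℝ)..x, f a := by
    rw [← intervalIntegral.integral_const_mul]
    exact intervalIntegral.integral_congr fun y _ => hf y
  rw [H1.primL_apply, H1.primL_apply, intervalIntegral.integral_symm]
  rw [show ∫ a in -x..(0 : ℝ), f a = σ * ∫ a in (0 : ℝ)..x, f a from h.symm.trans h2]
  rcases hσ with h0 | h0 <;> rw [h0] <;> ring

/-! ### The velocity, `Θ` and `Γ` as maps between Sobolev spaces -/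

open Classical in
/-- The element of `H¹_per` with underlying function `f` (and `0` when there is none). -/
def toH1 (f : ℝ → ℝ) : H1 := if h : f ∈ H1Functions then H1.mk f h else 0

theorem toH1_eq {f : ℝ → ℝ} {u : H1} (h : ∀ x, u x = f x) : toH1 f = u := by
  obtain rfl : (u : ℝ → ℝ) = f := funext h
  exact dif_pos u.2

/-- A real component (selected by `l`) of the logarithmic potential of `f` on the curve of `θ`. -/
def potential (l : ℂ →L[ℝ] ℝ) (θ f : H1) : H1 :=
  toH1 fun α => l (logPotential (unitCurve θ) (unitVelocity θ) f α)

section Potential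

variable {θ : H1} {l : ℂ →L[ℝ] ℝ}

theorem potential_apply (hθ : ∀ x, θ (-x) = -θ x) (hn : ‖θ‖ ≤ 1 / 144) (hl : ∀ z, |l z| ≤ ‖z‖)
    (f : H1) (α : ℝ) :
    potential l θ f α = l (logPotential (unitCurve θ) (unitVelocity θ) f α) := by
  obtain ⟨u, hu, -⟩ := (isCurve_unitCurve hθ hn).logPotential_mem f l hl
  rw [potential, toH1_eq hu]
  exact hu α

/-- The potential only sees `f` up to constants, and is small on nearly flat curves. -/
theorem norm_potential_le (hθ : ∀ x, θ (-x) = -θ x) (hn : ‖θ‖ ≤ 1 / 144)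
    (hl : ∀ z, |l z| ≤ ‖z‖) (f : H1) (a : ℝ) :
    ‖potential l θ f‖ ≤ potentialConst * (9 * ‖θ‖) * ‖f - H1.const a‖ := by
  obtain ⟨u, hu, hb⟩ := (isCurve_unitCurve hθ hn).logPotential_mem (f - H1.const a) l hl
  have h : potential l θ f = u := toH1_eq fun x => by
    rw [hu, logPotential, logPotential, H1.deriv_sub_const]
  rw [h]
  exact hb

theorem abs_reCLM_le (z : ℂ) : |Complex.reCLM z| ≤ ‖z‖ := Complex.abs_re_le_norm z

theorem abs_imCLM_le (z : ℂ) : |Complex.imCLM z| ≤ ‖z‖ := Complex.abs_im_le_norm z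

theorem potential_re_neg (hθ : ∀ x, θ (-x) = -θ x) (hn : ‖θ‖ ≤ 1 / 144) {f : H1} {σ : ℝ}
    (hf : ∀ x, f (-x) = σ * f x) (x : ℝ) :
    potential Complex.reCLM θ f (-x) = -σ * potential Complex.reCLM θ f x := by
  rw [potential_apply hθ hn abs_reCLM_le, potential_apply hθ hn abs_reCLM_le,
    logPotential_neg hθ hn hf, Complex.reCLM_apply, Complex.reCLM_apply, ← Complex.ofReal_neg,
    Complex.re_ofReal_mul, Complex.conj_re]

theorem potential_im_neg (hθ : ∀ x, θ (-x) = -θ x) (hn : ‖θ‖ ≤ 1 / 144) {f : H1} {σ : ℝ}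
    (hf : ∀ x, f (-x) = σ * f x) (x : ℝ) :
    potential Complex.imCLM θ f (-x) = σ * potential Complex.imCLM θ f x := by
  rw [potential_apply hθ hn abs_imCLM_le, potential_apply hθ hn abs_imCLM_le,
    logPotential_neg hθ hn hf, Complex.imCLM_apply, Complex.imCLM_apply, ← Complex.ofReal_neg,
    Complex.im_ofReal_mul, Complex.conj_im]
  ring

end Potential

/-- `γ cos θ`, the real part of `γ e^{-iθ}`. -/
def densityRe (θ γ : H1) : H1 := H1.mulL γ (H1.cos θ)

/-- `-γ sin θ`, the imaginary part of `γ e^{-iθ}`. -/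
def densityIm (θ γ : H1) : H1 := -H1.mulL γ (H1.sin θ)

/-- The real part of `(H + R)(γ e^{-iθ})`, with `R` the logarithmic potential. -/
def flatRe (θ γ : H1) : H1 :=
  hilbertL (densityRe θ γ) + potential Complex.reCLM θ (densityRe θ γ) -
    potential Complex.imCLM θ (densityIm θ γ)

/-- The imaginary part of `(H + R)(γ e^{-iθ})`, with `R` the logarithmic potential. -/
def flatIm (θ γ : H1) : H1 :=
  hilbertL (densityIm θ γ) + potential Complex.imCLM θ (densityRe θ γ) +
    potential Complex.reCLM θ (densityIm θ γ)

/-- The real part of `e^{iθ} (H + R)(γ e^{-iθ})`: the rescaled normal velocity. -/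
def velRe (θ γ : H1) : H1 :=
  H1.mulL (H1.cos θ) (flatRe θ γ) - H1.mulL (H1.sin θ) (flatIm θ γ)

/-- The imaginary part of `e^{iθ} (H + R)(γ e^{-iθ})`: the rescaled tangential velocity. -/
def velIm (θ γ : H1) : H1 :=
  H1.mulL (H1.sin θ) (flatRe θ γ) + H1.mulL (H1.cos θ) (flatIm θ γ)

section Formulas

variable {M : ℝ} {θ : H1}

theorem curve_eq (hθ : ∀ x, θ (-x) = -θ x) :
    curve M θ = fun α => ((M / (2 * π) : ℝ) : ℂ) * unitCurve θ α := by
  funext α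
  have h1 : mean (fun a => Real.sin (θ a)) = 0 := mean_sin_of_odd hθ
  have h2 : mean (fun a => Real.cos (θ a)) = cosMean θ := rfl
  rw [curve, h1, h2, unitCurve]
  push_cast
  rw [mul_zero, sub_zero, ← mul_assoc]
  congr 1
  field_simp

theorem deriv_curve (hθ : ∀ x, θ (-x) = -θ x) (α : ℝ) :
    deriv (curve M θ) α = ((M / (2 * π * cosMean θ) : ℝ) : ℂ) * Complex.exp (Complex.I * θ α) := by
  rw [curve_eq hθ, ((hasDerivAt_unitCurve θ α).const_mul _).deriv, unitVelocity]
  push_cast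
  field_simp

theorem norm_deriv_curve (hM : 0 < M) (hθ : ∀ x, θ (-x) = -θ x) (hm : 0 < cosMean θ) (α : ℝ) :
    ‖deriv (curve M θ) α‖ = M / (2 * π * cosMean θ) := by
  rw [deriv_curve hθ, norm_mul, mul_comm Complex.I, Complex.norm_exp_ofReal_mul_I, mul_one,
    Complex.norm_real, Real.norm_of_nonneg (by positivity)]

theorem tangent_eq (hM : 0 < M) (hθ : ∀ x, θ (-x) = -θ x) (hm : 0 < cosMean θ) (α : ℝ) :
    tangent M θ α = Complex.exp (Complex.I * θ α) := by
  have h : ((M / (2 * π * cosMean θ) : ℝ) : ℂ) ≠ 0 := by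
    rw [Complex.ofReal_ne_zero]
    positivity
  rw [tangent, norm_deriv_curve hM hθ hm, deriv_curve hθ, mul_div_cancel_left₀ _ h]

theorem normal_eq (hM : 0 < M) (hθ : ∀ x, θ (-x) = -θ x) (hm : 0 < cosMean θ) (α : ℝ) :
    normal M θ α = Complex.I * Complex.exp (Complex.I * θ α) := by
  rw [← tangent_eq hM hθ hm, tangent, normal, mul_div_assoc]

/-- The Birkhoff-Rott velocity in the frame of the curve. -/
theorem birkhoffRott_mul_exp (hM : 0 < M) (hθ : ∀ x, θ (-x) = -θ x) (hn : ‖θ‖ ≤ 1 / 144) (γ : H1)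
    (α : ℝ) : birkhoffRott (curve M θ) γ α * Complex.exp (Complex.I * θ α) =
      ((π * cosMean θ / M : ℝ) : ℂ) * (velIm θ γ α - Complex.I * velRe θ γ α) := by
  have hc := isCurve_unitCurve hθ hn
  have hm : 0 < cosMean θ := by linarith [half_le_cosMean hn]
  have hm' : (cosMean θ : ℂ) ≠ 0 := by exact_mod_cast hm.ne'
  have hM' : (M : ℂ) ≠ 0 := by exact_mod_cast hM.ne'
  have hpi : (π : ℂ) ≠ 0 := by exact_mod_cast Real.pi_ne_zero
  -- the density is the velocity `e^{iθ} / cosMean θ` times `γ e^{-iθ}`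
  have h1 := hc.tendsto_birkhoffRott (F := fun x => (γ x : ℂ) / cosMean θ) (densityRe θ γ)
    (densityIm θ γ) (fun x => by
      have e1 : densityRe θ γ x = γ x * Real.cos (θ x) := rfl
      have e2 : densityIm θ γ x = -(γ x * Real.sin (θ x)) := rfl
      have h := Complex.cos_sq_add_sin_sq (θ x)
      rw [e1, e2, unitVelocity, exp_I_mul]
      push_cast
      rw [div_eq_mul_inv, one_div]
      linear_combination (norm := (ring_nf; rw [Complex.I_sq]; ring))
        -(γ x : ℂ) * (cosMean θ : ℂ)⁻¹ * h) α
  have h2 : pvLine (fun x => (γ x : ℂ) / (curve M θ α - curve M θ x)) α =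
      (2 * π * cosMean θ / M) * (π * ((hilbertL (densityRe θ γ) α +
        logPotential (unitCurve θ) (unitVelocity θ) (densityRe θ γ) α) +
        Complex.I * (hilbertL (densityIm θ γ) α +
          logPotential (unitCurve θ) (unitVelocity θ) (densityIm θ γ) α))) := by
    refine Tendsto.limUnder_eq ?_
    refine (h1.const_mul (2 * π * cosMean θ / M : ℂ)).congr fun p => ?_
    rw [← integral_const_mul]
    refine integral_congr_ae (ae_of_all _ fun x => ?_)
    simp only [curve_eq hθ]
    push_cast
    rw [← mul_sub]
    by_cases h0 : unitCurve θ α - unitCurve θ x = 0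
    · simp [h0]
    · field_simp
  have a1 := potential_apply hθ hn abs_reCLM_le (densityRe θ γ) α
  have a2 := potential_apply hθ hn abs_imCLM_le (densityRe θ γ) α
  have a3 := potential_apply hθ hn abs_reCLM_le (densityIm θ γ) α
  have a4 := potential_apply hθ hn abs_imCLM_le (densityIm θ γ) α
  have b1 := Complex.re_add_im (logPotential (unitCurve θ) (unitVelocity θ) (densityRe θ γ) α)
  have b2 := Complex.re_add_im (logPotential (unitCurve θ) (unitVelocity θ) (densityIm θ γ) α)
  rw [Complex.reCLM_apply] at a1 a3
  rw [Complex.imCLM_apply] at a2 a4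
  rw [← a1, ← a2] at b1
  rw [← a3, ← a4] at b2
  have e1 : velRe θ γ α = Real.cos (θ α) * (hilbertL (densityRe θ γ) α +
      potential Complex.reCLM θ (densityRe θ γ) α - potential Complex.imCLM θ (densityIm θ γ) α) -
      Real.sin (θ α) * (hilbertL (densityIm θ γ) α +
      potential Complex.imCLM θ (densityRe θ γ) α +
      potential Complex.reCLM θ (densityIm θ γ) α) := rfl
  have e2 : velIm θ γ α = Real.sin (θ α) * (hilbertL (densityRe θ γ) α +
      potential Complex.reCLM θ (densityRe θ γ) α - potential Complex.imCLM θ (densityIm θ γ) α) +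
      Real.cos (θ α) * (hilbertL (densityIm θ γ) α +
      potential Complex.imCLM θ (densityRe θ γ) α +
      potential Complex.reCLM θ (densityIm θ γ) α) := rfl
  rw [birkhoffRott, h2, ← b1, ← b2, e1, e2, exp_I_mul]
  push_cast
  field_simp
  ring_nf
  simp only [Complex.I_sq, show Complex.I ^ 3 = -Complex.I by
    rw [pow_succ, Complex.I_sq]; ring]
  ring

/-- The relative tangential velocity. -/
def relVelocity (M c : ℝ) (θ γ : H1) : H1 :=
  c • H1.cos θ - (π / M * cosMean θ) • velIm θ γ

theorem relTangentialVelocity_eq (hM : 0 < M) (hθ : ∀ x, θ (-x) = -θ x) (hn : ‖θ‖ ≤ 1 / 144)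
    (γ : H1) (c : ℝ) : relTangentialVelocity M θ γ c = relVelocity M c θ γ := by
  have hm : 0 < cosMean θ := by linarith [half_le_cosMean hn]
  funext α
  rw [relTangentialVelocity, tangent_eq hM hθ hm, birkhoffRott_mul_exp hM hθ hn,
    Complex.re_ofReal_mul]
  have e : relVelocity M c θ γ α = c * Real.cos (θ α) - π / M * cosMean θ * velIm θ γ α := rfl
  rw [e]
  simp only [Complex.sub_re, Complex.ofReal_re, Complex.mul_re, Complex.I_re, Complex.I_im,
    Complex.ofReal_im]
  ring

/-- The primitive of `Φ̃`, up to an additive constant. -/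
def phiPrimitive (M τ A g c : ℝ) (θ γ : H1) : H1 :=
  (1 / τ) • H1.mulL (relVelocity M c θ γ) γ -
    (A / τ) • ((π * cosMean θ / (2 * M)) • H1.mulL γ γ +
      (g * M / (π * cosMean θ)) • H1.primL (H1.sin θ) +
      (M / (2 * π * cosMean θ)) • H1.mulL (relVelocity M c θ γ) (relVelocity M c θ γ))

/-- `Θ` as an element of `H¹_per`, in terms of `θ` and of the full vortex sheet strength `γ`. -/
def thetaMap (M τ A g c : ℝ) (θ γ : H1) : H1 := -H1.primL (phiPrimitive M τ A g c θ γ)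

/-- The operator `∂⁻²` applied to `f` is the normalized primitive of any primitive `E` of `f`. -/
theorem invSecondDeriv_eq_primL {f : ℝ → ℝ} (E : H1)
    (h : ∀ a, ∫ s in (0 : ℝ)..a, f s = E a - E 0) (α : ℝ) :
    invSecondDeriv f α = H1.primL E α := by
  have h1 (b : ℝ) : ∫ a in (0 : ℝ)..b, (E a - E 0) = (∫ a in (0 : ℝ)..b, E a) - b * E 0 := by
    refine (intervalIntegral.integral_sub (E.intervalIntegrable 0 b)
      intervalIntegrable_const).trans ?_
    simp
  have e : mean E = 1 / (2 * π) * ∫ a in (0 : ℝ)..(2 * π), E a := rfl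
  simp only [invSecondDeriv, h, h1]
  rw [H1.primL_apply, e]
  field_simp
  ring

/-- The principal values in `Θ` converge, and `Θ` is the map `thetaMap` on `H¹_per`. -/
theorem Theta_eq (hM : 0 < M) (hθ : ∀ x, θ (-x) = -θ x) (hn : ‖θ‖ ≤ 1 / 144) (τ A g γbar c : ℝ)
    (γ₁ : H1) :
    Theta M τ A g γbar θ γ₁ c = thetaMap M τ A g c θ (H1.const γbar + γ₁) := by
  set γ : H1 := H1.const γbar + γ₁ with hγ
  have hγ' : (fun a => γbar + γ₁ a) = (γ : ℝ → ℝ) := rfl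
  set V : H1 := relVelocity M c θ γ with hV
  funext α
  rw [Theta, hγ', thetaMap, H1.neg_apply]
  congr 1
  refine invSecondDeriv_eq_primL _ (fun a => ?_) α
  have hVe : relTangentialVelocity M θ γ c = V := relTangentialVelocity_eq hM hθ hn γ c
  have hcm : mean (fun a => Real.cos (θ a)) = cosMean θ := rfl
  have i1 := (H1.mulL V γ).intervalIntegrable_deriv 0 a
  have i2 := (H1.mulL γ γ).intervalIntegrable_deriv 0 a
  have i3 := (H1.sin θ).intervalIntegrable 0 a
  have i4 := (H1.mulL V V).intervalIntegrable_deriv 0 a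
  have j1 := (H1.mulL V γ).integral_deriv 0 a
  have j2 := (H1.mulL γ γ).integral_deriv 0 a
  have j4 := (H1.mulL V V).integral_deriv 0 a
  set D1 := deriv (H1.mulL V γ) with hD1
  set D2 := deriv (H1.mulL γ γ) with hD2
  set D4 := deriv (H1.mulL V V) with hD4
  have e : PhiTilde M τ A g θ γ c = fun s => 1 / τ * D1 s - A / τ *
      (π * cosMean θ / (2 * M) * D2 s + g * M / (π * cosMean θ) *
        (H1.sin θ s - mean (H1.sin θ)) + M / (2 * π * cosMean θ) * D4 s) := by
    funext s
    simp only [PhiTilde, hVe, hcm, sq]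
    rfl
  rw [e, intervalIntegral.integral_sub (i1.const_mul _) ((((i2.const_mul _).add
    ((i3.sub intervalIntegrable_const).const_mul _)).add (i4.const_mul _)).const_mul _),
    intervalIntegral.integral_const_mul, intervalIntegral.integral_const_mul,
    intervalIntegral.integral_add ((i2.const_mul _).add
    ((i3.sub intervalIntegrable_const).const_mul _)) (i4.const_mul _),
    intervalIntegral.integral_add (i2.const_mul _)
    ((i3.sub intervalIntegrable_const).const_mul _),
    intervalIntegral.integral_const_mul, intervalIntegral.integral_const_mul,
    intervalIntegral.integral_const_mul,
    intervalIntegral.integral_sub i3 intervalIntegrable_const, j1, j2, j4]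
  have f1 (x : ℝ) : phiPrimitive M τ A g c θ γ x = 1 / τ * H1.mulL V γ x -
      A / τ * (π * cosMean θ / (2 * M) * H1.mulL γ γ x +
      g * M / (π * cosMean θ) * ((∫ y in (0 : ℝ)..x, H1.sin θ y) - x * mean (H1.sin θ)) +
      M / (2 * π * cosMean θ) * H1.mulL V V x) := rfl
  rw [f1, f1]
  simp only [intervalIntegral.integral_const, sub_zero, smul_eq_mul, intervalIntegral.integral_same,
    zero_mul]
  ring

/-- `Γ` as an element of `H¹_per`, in terms of the new tangent angle `Θ` and the full vortex sheet
strength. -/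
def gammaMap (M c : ℝ) (Θ γ : H1) : H1 :=
  hilbertL (velRe Θ γ - hilbertL γ + (c * M / (π * cosMean Θ)) • H1.sin Θ)

/-- `Γ` depends on the state only through `Θ` and the vortex sheet strength. -/
theorem Gamma_eq (hM : 0 < M) {Th : H1} (hodd : ∀ x, Th (-x) = -Th x) (hn : ‖Th‖ ≤ 1 / 144)
    (τ A g γbar c : ℝ) (θ γ₁ : H1) (hTh : Theta M τ A g γbar θ γ₁ c = Th) :
    Gamma M τ A g γbar θ γ₁ c = gammaMap M c Th (H1.const γbar + γ₁) := by
  have hm : 0 < cosMean Th := by linarith [half_le_cosMean hn]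
  set γ : H1 := H1.const γbar + γ₁ with hγ
  have hγ' : (fun a => γbar + γ₁ a) = (γ : ℝ → ℝ) := rfl
  set u : H1 := velRe Th γ - hilbertL γ + (c * M / (π * cosMean Th)) • H1.sin Th with hu
  have key (a : ℝ) : ‖deriv (curve M Th) a‖ *
      (remainder (curve M Th) γ a * normal M Th a).re +
      c * ‖deriv (curve M Th) a‖ * Real.sin (Th a) = ((1 / 2 : ℝ) • u : H1) a := by
    have e1 : ((1 / 2 : ℝ) • u : H1) a = 1 / 2 * (velRe Th γ a - hilbertL γ a +
      c * M / (π * cosMean Th) * Real.sin (Th a)) := rfl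
    have hE : Complex.exp (Complex.I * Th a) ≠ 0 := Complex.exp_ne_zero _
    have hm' : (cosMean Th : ℂ) ≠ 0 := by exact_mod_cast hm.ne'
    have hM' : (M : ℂ) ≠ 0 := by exact_mod_cast hM.ne'
    have hpi : (π : ℂ) ≠ 0 := by exact_mod_cast Real.pi_ne_zero
    have h1 : remainder (curve M Th) γ a * normal M Th a =
        ((π * cosMean Th / M * (velRe Th γ a - hilbertL γ a) : ℝ) : ℂ) +
          ((π * cosMean Th / M * velIm Th γ a : ℝ) : ℂ) * Complex.I := by
      rw [remainder, normal_eq hM hodd hm, γ.hilbert_eq, sub_mul, mul_left_comm,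
        birkhoffRott_mul_exp hM hodd hn, deriv_curve hodd]
      push_cast
      field_simp
      ring_nf
      rw [Complex.I_sq]
      ring
    have h2 : (remainder (curve M Th) γ a * normal M Th a).re =
        π * cosMean Th / M * (velRe Th γ a - hilbertL γ a) := by
      rw [h1, Complex.add_re, Complex.ofReal_re, Complex.re_ofReal_mul, Complex.I_re, mul_zero,
        add_zero]
    rw [norm_deriv_curve hM hodd hm, h2, e1]
    field_simp
  funext α
  have h3 : Gamma M τ A g γbar θ γ₁ c α = 2 * hilbert ((1 / 2 : ℝ) • u : H1) α := by
    rw [Gamma]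
    simp only [hTh, hγ']
    congr 2
    exact funext key
  have h4 : hilbert ((1 / 2 : ℝ) • u : H1) α = hilbertL ((1 / 2 : ℝ) • u) α :=
    congrFun (H1.hilbert_eq _) α
  rw [h3, h4, map_smul, gammaMap, ← hu, H1.smul_apply]
  ring

end Formulas

/-! #### Parity of the maps -/

section Parity

variable {θ γ : H1}

theorem densityRe_neg (hθ : ∀ x, θ (-x) = -θ x) (hγ : ∀ x, γ (-x) = γ x) (x : ℝ) :
    densityRe θ γ (-x) = densityRe θ γ x := by
  simp only [densityRe, H1.mulL_apply, H1.cos_apply, hθ, hγ, Real.cos_neg]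

theorem densityIm_neg (hθ : ∀ x, θ (-x) = -θ x) (hγ : ∀ x, γ (-x) = γ x) (x : ℝ) :
    densityIm θ γ (-x) = -densityIm θ γ x := by
  simp only [densityIm, H1.neg_apply, H1.mulL_apply, H1.sin_apply, hθ, hγ, Real.sin_neg]
  ring

theorem flatRe_neg (hθ : ∀ x, θ (-x) = -θ x) (hn : ‖θ‖ ≤ 1 / 144) (hγ : ∀ x, γ (-x) = γ x)
    (x : ℝ) : flatRe θ γ (-x) = -flatRe θ γ x := by
  have h1 := densityRe_neg hθ hγ
  have h2 := densityIm_neg hθ hγ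
  have a := hilbertL_odd_of_even h1 x
  have b := potential_re_neg hθ hn (σ := 1) (fun x => by rw [h1, one_mul]) x
  have c := potential_im_neg hθ hn (σ := -1) (fun x => by rw [h2, neg_one_mul]) x
  simp only [flatRe, H1.sub_apply, H1.add_apply, a, b, c]
  ring

theorem flatIm_neg (hθ : ∀ x, θ (-x) = -θ x) (hn : ‖θ‖ ≤ 1 / 144) (hγ : ∀ x, γ (-x) = γ x)
    (x : ℝ) : flatIm θ γ (-x) = flatIm θ γ x := by
  have h1 := densityRe_neg hθ hγ
  have h2 := densityIm_neg hθ hγ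
  have a := hilbertL_even_of_odd h2 x
  have b := potential_im_neg hθ hn (σ := 1) (fun x => by rw [h1, one_mul]) x
  have c := potential_re_neg hθ hn (σ := -1) (fun x => by rw [h2, neg_one_mul]) x
  simp only [flatIm, H1.add_apply, a, b, c]
  ring

theorem velRe_neg (hθ : ∀ x, θ (-x) = -θ x) (hn : ‖θ‖ ≤ 1 / 144) (hγ : ∀ x, γ (-x) = γ x)
    (x : ℝ) : velRe θ γ (-x) = -velRe θ γ x := by
  simp only [velRe, H1.sub_apply, H1.mulL_apply, H1.cos_apply, H1.sin_apply, hθ, Real.cos_neg,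
    Real.sin_neg, flatRe_neg hθ hn hγ, flatIm_neg hθ hn hγ]
  ring

theorem velIm_neg (hθ : ∀ x, θ (-x) = -θ x) (hn : ‖θ‖ ≤ 1 / 144) (hγ : ∀ x, γ (-x) = γ x)
    (x : ℝ) : velIm θ γ (-x) = velIm θ γ x := by
  simp only [velIm, H1.add_apply, H1.mulL_apply, H1.cos_apply, H1.sin_apply, hθ, Real.cos_neg,
    Real.sin_neg, flatRe_neg hθ hn hγ, flatIm_neg hθ hn hγ]
  ring

theorem relVelocity_neg (M c : ℝ) (hθ : ∀ x, θ (-x) = -θ x) (hn : ‖θ‖ ≤ 1 / 144)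
    (hγ : ∀ x, γ (-x) = γ x) (x : ℝ) : relVelocity M c θ γ (-x) = relVelocity M c θ γ x := by
  simp only [relVelocity, H1.sub_apply, H1.smul_apply, H1.cos_apply, hθ, Real.cos_neg,
    velIm_neg hθ hn hγ]

theorem thetaMap_odd (M τ A g c : ℝ) (hθ : ∀ x, θ (-x) = -θ x) (hn : ‖θ‖ ≤ 1 / 144)
    (hγ : ∀ x, γ (-x) = γ x) (x : ℝ) :
    thetaMap M τ A g c θ γ (-x) = -thetaMap M τ A g c θ γ x := by
  have hV := relVelocity_neg M c hθ hn hγ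
  have hJ := H1.primL_neg (f := H1.sin θ) (σ := -1)
    (fun x => by rw [H1.sin_apply, H1.sin_apply, hθ, Real.sin_neg, neg_one_mul])
    (.inl (mean_sin_of_odd hθ))
  have hE (y : ℝ) : phiPrimitive M τ A g c θ γ (-y) = 1 * phiPrimitive M τ A g c θ γ y := by
    simp only [phiPrimitive, H1.sub_apply, H1.add_apply, H1.smul_apply, H1.mulL_apply, hV, hγ, hJ]
    ring
  rw [thetaMap, H1.neg_apply, H1.neg_apply, H1.primL_neg hE (.inr rfl)]
  ring

theorem gammaMap_even (M c : ℝ) (hθ : ∀ x, θ (-x) = -θ x) (hn : ‖θ‖ ≤ 1 / 144)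
    (hγ : ∀ x, γ (-x) = γ x) (x : ℝ) :
    gammaMap M c θ γ (-x) = gammaMap M c θ γ x := by
  refine hilbertL_even_of_odd (fun y => ?_) x
  simp only [H1.sub_apply, H1.add_apply, H1.smul_apply, H1.sin_apply, hθ, Real.sin_neg,
    velRe_neg hθ hn hγ, hilbertL_odd_of_even hγ]
  ring

end Parity

/-! ### Linearization at the flat sheet -/

theorem H1.mulL_const (f : H1) (a : ℝ) : H1.mulL f (H1.const a) = a • f := H1.ext fun x => by
  simp only [H1.mulL_apply, H1.const_apply, H1.smul_apply, mul_comm]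

theorem H1.const_mulL (f : H1) (a : ℝ) : H1.mulL (H1.const a) f = a • f := H1.ext fun x => by
  simp only [H1.mulL_apply, H1.const_apply, H1.smul_apply]

theorem H1.const_zero : H1.const 0 = 0 := H1.ext fun _ => rfl

theorem H1.smul_const (a b : ℝ) : a • H1.const b = H1.const (a * b) := H1.ext fun _ => rfl

theorem H1.const_sub_const (a b : ℝ) : H1.const a - H1.const b = H1.const (a - b) :=
  H1.ext fun _ => rfl

section Deriv

variable {E : Type*} [NormedAddCommGroup E] [NormedSpace ℝ E] {x₀ : E}

/-- The product rule at a point where both factors are constant functions. -/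
theorem hasFDerivAt_mulL {f f' : E → H1} {D D' : E →L[ℝ] H1} {a b : ℝ} (hf : HasFDerivAt f D x₀)
    (hf' : HasFDerivAt f' D' x₀) (h : f x₀ = H1.const a) (h' : f' x₀ = H1.const b) :
    HasFDerivAt (fun x => H1.mulL (f x) (f' x)) (a • D' + b • D) x₀ := by
  refine (H1.mulL.hasFDerivAt_of_bilinear hf hf').congr_fderiv ?_
  refine ContinuousLinearMap.ext fun x => ?_
  simp only [_root_.add_apply, ContinuousLinearMap.precompR_apply, ContinuousLinearMap.comp_apply,
    ContinuousLinearMap.compL_apply, ContinuousLinearMap.precompL_apply, h, h', H1.mulL_const,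
    H1.const_mulL, _root_.smul_apply]

/-- At a critical point of the scalar factor only the vector factor contributes. -/
theorem hasFDerivAt_smul_of_critical {F : Type*} [NormedAddCommGroup F] [NormedSpace ℝ F]
    {s : E → ℝ} {f : E → F} {D : E →L[ℝ] F} {a : ℝ}
    (hs : HasFDerivAt s (0 : E →L[ℝ] ℝ) x₀) (ha : s x₀ = a) (hf : HasFDerivAt f D x₀) :
    HasFDerivAt (fun x => s x • f x) (a • D) x₀ := by
  refine (hs.smul hf).congr_fderiv ?_
  rw [ha]
  ext x
  simp

theorem hasFDerivAt_comp_of_critical {s : E → ℝ} (hs : HasFDerivAt s (0 : E →L[ℝ] ℝ) x₀)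
    {φ : ℝ → ℝ} (hφ : DifferentiableAt ℝ φ (s x₀)) :
    HasFDerivAt (fun x => φ (s x)) (0 : E →L[ℝ] ℝ) x₀ := by
  refine (hφ.hasDerivAt.comp_hasFDerivAt x₀ hs).congr_fderiv ?_
  simp

variable {θ γ : E → H1} {Dθ Dγ : E →L[ℝ] H1} {b : ℝ}

theorem hasFDerivAt_cos_comp (hθ : HasFDerivAt θ Dθ x₀) (h0 : θ x₀ = 0) :
    HasFDerivAt (fun x => H1.cos (θ x)) (0 : E →L[ℝ] H1) x₀ := by
  have h : HasFDerivAt H1.cos (0 : H1 →L[ℝ] H1) (θ x₀) := h0 ▸ H1.hasFDerivAt_cos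
  exact (h.comp x₀ hθ).congr_fderiv (ContinuousLinearMap.zero_comp _)

theorem hasFDerivAt_sin_comp (hθ : HasFDerivAt θ Dθ x₀) (h0 : θ x₀ = 0) :
    HasFDerivAt (fun x => H1.sin (θ x)) Dθ x₀ := by
  have h : HasFDerivAt H1.sin (ContinuousLinearMap.id ℝ H1) (θ x₀) := h0 ▸ H1.hasFDerivAt_sin
  exact (h.comp x₀ hθ).congr_fderiv (ContinuousLinearMap.id_comp _)

theorem cos_of_eq_zero {f : H1} (h : f = 0) : H1.cos f = H1.const 1 := by rw [h, H1.cos_zero]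

theorem sin_of_eq_zero {f : H1} (h : f = 0) : H1.sin f = H1.const 0 := by
  rw [h, H1.sin_zero, H1.const_zero]

theorem cosMean_of_eq_zero {f : H1} (h : f = 0) : cosMean f = 1 := by
  rw [cosMean, cos_of_eq_zero h, H1.mean_const]

theorem hasFDerivAt_cosMean (hθ : HasFDerivAt θ Dθ x₀) (h0 : θ x₀ = 0) :
    HasFDerivAt (fun x => cosMean (θ x)) (0 : E →L[ℝ] ℝ) x₀ :=
  (H1.meanL.hasFDerivAt.comp x₀ (hasFDerivAt_cos_comp hθ h0)).congr_fderiv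
    (ContinuousLinearMap.comp_zero _)

theorem potential_of_eq_zero {l : ℂ →L[ℝ] ℝ} (hl : ∀ z, |l z| ≤ ‖z‖) {θ : H1} (h : θ = 0) (f : H1) :
    potential l θ f = 0 := by
  have h1 := norm_potential_le (θ := θ) (fun x => by rw [h]; simp) (by rw [h]; simp) hl f 0
  rw [h, norm_zero, mul_zero, mul_zero, zero_mul] at h1
  rw [h]
  exact norm_le_zero_iff.1 h1

/-- The logarithmic potential is of second order at the flat sheet: it is small with the angle, and
it vanishes on constant densities. -/
theorem hasFDerivAt_potential {l : ℂ →L[ℝ] ℝ} (hl : ∀ z, |l z| ≤ ‖z‖) (hθ : HasFDerivAt θ Dθ x₀)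
    (h0 : θ x₀ = 0) (hodd : ∀ᶠ x in 𝓝 x₀, ∀ y, θ x (-y) = -θ x y) {f : E → H1} {D : E →L[ℝ] H1}
    (hf : HasFDerivAt f D x₀) {a : ℝ} (ha : f x₀ = H1.const a) :
    HasFDerivAt (fun x => potential l (θ x) (f x)) (0 : E →L[ℝ] H1) x₀ := by
  refine .of_isLittleO ?_
  have h1 : (fun x => ‖θ x - θ x₀‖ * ‖f x - f x₀‖) =O[𝓝 x₀] fun x => ‖x - x₀‖ * ‖x - x₀‖ :=
    hθ.isBigO_sub.norm_norm.mul hf.isBigO_sub.norm_norm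
  have h2 : (fun x => ‖x - x₀‖ * ‖x - x₀‖) =o[𝓝 x₀] fun x => x - x₀ := by
    have h3 : (fun x => ‖x - x₀‖) =o[𝓝 x₀] fun _ => (1 : ℝ) := by
      rw [Asymptotics.isLittleO_one_iff]
      have : Tendsto (fun x => ‖x - x₀‖) (𝓝 x₀) (𝓝 ‖x₀ - x₀‖) := by
        apply Continuous.tendsto
        fun_prop
      simpa using this
    have h4 := h3.mul_isBigO (Asymptotics.isBigO_refl (fun x => ‖x - x₀‖) (𝓝 x₀))
    simp only [one_mul] at h4
    exact h4.of_norm_right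
  refine Asymptotics.IsBigO.trans_isLittleO (Asymptotics.IsBigO.of_bound (potentialConst * 9) ?_)
    (h1.trans_isLittleO h2)
  have hs : ∀ᶠ x in 𝓝 x₀, ‖θ x‖ ≤ 1 / 144 := by
    have := hθ.continuousAt.norm
    rw [ContinuousAt, h0, norm_zero] at this
    exact this.eventually_le_const (by norm_num)
  filter_upwards [hodd, hs] with x hx1 hx2
  have h5 := norm_potential_le hx1 hx2 hl (f x) a
  rw [potential_of_eq_zero hl h0, sub_zero, _root_.zero_apply, sub_zero, norm_mul,
    norm_norm, norm_norm, h0, sub_zero, ha]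
  linarith

theorem densityRe_flat {θ γ : H1} (h : θ = 0) : densityRe θ γ = γ := by
  rw [densityRe, cos_of_eq_zero h, H1.mulL_const, one_smul]

theorem densityIm_flat {θ γ : H1} (h : θ = 0) : densityIm θ γ = H1.const 0 := by
  rw [densityIm, sin_of_eq_zero h, H1.mulL_const, zero_smul, neg_zero, H1.const_zero]

theorem flatRe_flat {θ γ : H1} (h : θ = 0) : flatRe θ γ = hilbertL γ := by
  rw [flatRe, densityRe_flat h, potential_of_eq_zero abs_reCLM_le h,
    potential_of_eq_zero abs_imCLM_le h, add_zero, sub_zero]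

theorem flatIm_flat {θ γ : H1} (h : θ = 0) : flatIm θ γ = H1.const 0 := by
  rw [flatIm, densityIm_flat h, hilbertL_const, potential_of_eq_zero abs_reCLM_le h,
    potential_of_eq_zero abs_imCLM_le h, add_zero, add_zero, H1.const_zero]

theorem velIm_flat {θ γ : H1} (h : θ = 0) : velIm θ γ = H1.const 0 := by
  rw [velIm, sin_of_eq_zero h, flatIm_flat h, H1.mulL_const, H1.const_mulL, zero_smul, zero_smul,
    add_zero, H1.const_zero]

theorem relVelocity_flat (M c : ℝ) {θ γ : H1} (h : θ = 0) : relVelocity M c θ γ = H1.const c := by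
  rw [relVelocity, cos_of_eq_zero h, velIm_flat h, H1.smul_const, H1.smul_const,
    H1.const_sub_const, mul_one, mul_zero, sub_zero]

theorem hasFDerivAt_densityRe (hθ : HasFDerivAt θ Dθ x₀) (h0 : θ x₀ = 0)
    (hγ : HasFDerivAt γ Dγ x₀) (hb : γ x₀ = H1.const b) :
    HasFDerivAt (fun x => densityRe (θ x) (γ x)) Dγ x₀ := by
  refine (hasFDerivAt_mulL hγ (hasFDerivAt_cos_comp hθ h0) hb (cos_of_eq_zero h0)).congr_fderiv ?_
  simp

theorem hasFDerivAt_densityIm (hθ : HasFDerivAt θ Dθ x₀) (h0 : θ x₀ = 0)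
    (hγ : HasFDerivAt γ Dγ x₀) (hb : γ x₀ = H1.const b) :
    HasFDerivAt (fun x => densityIm (θ x) (γ x)) (-(b • Dθ)) x₀ := by
  refine (hasFDerivAt_mulL hγ (hasFDerivAt_sin_comp hθ h0) hb
    (sin_of_eq_zero h0)).neg.congr_fderiv ?_
  simp

theorem hasFDerivAt_flatRe (hθ : HasFDerivAt θ Dθ x₀) (h0 : θ x₀ = 0)
    (hγ : HasFDerivAt γ Dγ x₀) (hb : γ x₀ = H1.const b)
    (hodd : ∀ᶠ x in 𝓝 x₀, ∀ y, θ x (-y) = -θ x y) :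
    HasFDerivAt (fun x => flatRe (θ x) (γ x)) (hilbertL.comp Dγ) x₀ := by
  have h1 := hasFDerivAt_densityRe hθ h0 hγ hb
  have h2 := hasFDerivAt_densityIm hθ h0 hγ hb
  refine (((hilbertL.hasFDerivAt.comp x₀ h1).add (hasFDerivAt_potential abs_reCLM_le hθ h0 hodd h1
    ((densityRe_flat h0).trans hb))).sub (hasFDerivAt_potential abs_imCLM_le hθ h0 hodd h2
    (densityIm_flat h0))).congr_fderiv ?_
  simp

theorem hasFDerivAt_flatIm (hθ : HasFDerivAt θ Dθ x₀) (h0 : θ x₀ = 0)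
    (hγ : HasFDerivAt γ Dγ x₀) (hb : γ x₀ = H1.const b)
    (hodd : ∀ᶠ x in 𝓝 x₀, ∀ y, θ x (-y) = -θ x y) :
    HasFDerivAt (fun x => flatIm (θ x) (γ x)) (-(b • hilbertL.comp Dθ)) x₀ := by
  have h1 := hasFDerivAt_densityRe hθ h0 hγ hb
  have h2 := hasFDerivAt_densityIm hθ h0 hγ hb
  refine (((hilbertL.hasFDerivAt.comp x₀ h2).add (hasFDerivAt_potential abs_imCLM_le hθ h0 hodd h1
    ((densityRe_flat h0).trans hb))).add (hasFDerivAt_potential abs_reCLM_le hθ h0 hodd h2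
    (densityIm_flat h0))).congr_fderiv ?_
  simp

theorem hasFDerivAt_velRe (hθ : HasFDerivAt θ Dθ x₀) (h0 : θ x₀ = 0)
    (hγ : HasFDerivAt γ Dγ x₀) (hb : γ x₀ = H1.const b)
    (hodd : ∀ᶠ x in 𝓝 x₀, ∀ y, θ x (-y) = -θ x y) :
    HasFDerivAt (fun x => velRe (θ x) (γ x)) (hilbertL.comp Dγ) x₀ := by
  have h1 : flatRe (θ x₀) (γ x₀) = H1.const 0 := by
    rw [flatRe_flat h0, hb, hilbertL_const, H1.const_zero]
  refine ((hasFDerivAt_mulL (hasFDerivAt_cos_comp hθ h0) (hasFDerivAt_flatRe hθ h0 hγ hb hodd)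
    (cos_of_eq_zero h0) h1).sub (hasFDerivAt_mulL (hasFDerivAt_sin_comp hθ h0)
    (hasFDerivAt_flatIm hθ h0 hγ hb hodd) (sin_of_eq_zero h0) (flatIm_flat h0))).congr_fderiv ?_
  simp

theorem hasFDerivAt_velIm (hθ : HasFDerivAt θ Dθ x₀) (h0 : θ x₀ = 0)
    (hγ : HasFDerivAt γ Dγ x₀) (hb : γ x₀ = H1.const b)
    (hodd : ∀ᶠ x in 𝓝 x₀, ∀ y, θ x (-y) = -θ x y) :
    HasFDerivAt (fun x => velIm (θ x) (γ x)) (-(b • hilbertL.comp Dθ)) x₀ := by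
  have h1 : flatRe (θ x₀) (γ x₀) = H1.const 0 := by
    rw [flatRe_flat h0, hb, hilbertL_const, H1.const_zero]
  refine ((hasFDerivAt_mulL (hasFDerivAt_sin_comp hθ h0) (hasFDerivAt_flatRe hθ h0 hγ hb hodd)
    (sin_of_eq_zero h0) h1).add (hasFDerivAt_mulL (hasFDerivAt_cos_comp hθ h0)
    (hasFDerivAt_flatIm hθ h0 hγ hb hodd) (cos_of_eq_zero h0) (flatIm_flat h0))).congr_fderiv ?_
  simp

theorem hasFDerivAt_relVelocity (M c : ℝ) (hθ : HasFDerivAt θ Dθ x₀) (h0 : θ x₀ = 0)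
    (hγ : HasFDerivAt γ Dγ x₀) (hb : γ x₀ = H1.const b)
    (hodd : ∀ᶠ x in 𝓝 x₀, ∀ y, θ x (-y) = -θ x y) :
    HasFDerivAt (fun x => relVelocity M c (θ x) (γ x)) ((π * b / M) • hilbertL.comp Dθ) x₀ := by
  have h1 : HasFDerivAt (fun x => π / M * cosMean (θ x)) (0 : E →L[ℝ] ℝ) x₀ :=
    ((hasFDerivAt_cosMean hθ h0).const_mul (π / M)).congr_fderiv (smul_zero _)
  refine (((hasFDerivAt_cos_comp hθ h0).const_smul c).sub (hasFDerivAt_smul_of_critical h1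
    (a := π / M) (by rw [cosMean_of_eq_zero h0, mul_one])
    (hasFDerivAt_velIm hθ h0 hγ hb hodd))).congr_fderiv ?_
  rw [smul_zero, zero_sub, smul_neg, neg_neg, smul_smul]
  congr 1
  ring

/-- The linearization of `Θ` at the flat sheet. -/
theorem hasFDerivAt_thetaMap (M τ A g c : ℝ) (hM : 0 < M)
    (hθ : HasFDerivAt θ Dθ x₀) (h0 : θ x₀ = 0)
    (hγ : HasFDerivAt γ Dγ x₀) (hb : γ x₀ = H1.const b)
    (hodd : ∀ᶠ x in 𝓝 x₀, ∀ y, θ x (-y) = -θ x y) :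
    HasFDerivAt (fun x => thetaMap M τ A g c (θ x) (γ x))
      ((-(π * b ^ 2 / (τ * M)) + A * c * b / τ) • H1.primL.comp (hilbertL.comp Dθ) +
        (-(c / τ) + A * π * b / (τ * M)) • H1.primL.comp Dγ +
        (A * g * M / (π * τ)) • H1.primL.comp (H1.primL.comp Dθ)) x₀ := by
  have hm := hasFDerivAt_cosMean hθ h0
  have hm1 := cosMean_of_eq_zero h0
  have hV := hasFDerivAt_relVelocity M c hθ h0 hγ hb hodd
  have hV0 : relVelocity M c (θ x₀) (γ x₀) = H1.const c := relVelocity_flat M c h0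
  have c1 := hasFDerivAt_comp_of_critical hm (φ := fun m => π * m / (2 * M)) (by fun_prop)
  have c2 := hasFDerivAt_comp_of_critical hm (φ := fun m => g * M / (π * m))
    (by rw [hm1]; exact (differentiableAt_const _).div (by fun_prop) (by positivity))
  have c3 := hasFDerivAt_comp_of_critical hm (φ := fun m => M / (2 * π * m))
    (by rw [hm1]; exact (differentiableAt_const _).div (by fun_prop) (by positivity))
  have d1 := (hasFDerivAt_mulL hV hγ hV0 hb).const_smul (1 / τ)
  have d2 := hasFDerivAt_smul_of_critical c1 (a := π / (2 * M)) (by simp only [hm1, mul_one])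
    (hasFDerivAt_mulL hγ hγ hb hb)
  have d3 := hasFDerivAt_smul_of_critical c2 (a := g * M / π) (by simp only [hm1, mul_one])
    (H1.primL.hasFDerivAt.comp x₀ (hasFDerivAt_sin_comp hθ h0))
  have d4 := hasFDerivAt_smul_of_critical c3 (a := M / (2 * π)) (by simp only [hm1, mul_one])
    (hasFDerivAt_mulL hV hV hV0 hV0)
  have d := (H1.primL.hasFDerivAt.comp x₀ (d1.sub (((d2.add d3).add d4).const_smul (A / τ)))).neg
  refine d.congr_fderiv (ContinuousLinearMap.ext fun x => ?_)
  simp only [_root_.neg_apply, ContinuousLinearMap.comp_apply,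
    _root_.add_apply, _root_.sub_apply, _root_.smul_apply,
    map_add, map_sub, map_smul]
  match_scalars
  · field_simp
    ring
  · field_simp
    ring
  · field_simp

/-- The flat sheets with constant vortex sheet strength are equilibria. -/
theorem thetaMap_flat (M τ A g c : ℝ) {θ γ : H1} (h : θ = 0) (hb : γ = H1.const b) :
    thetaMap M τ A g c θ γ = 0 := by
  have h1 : H1.primL (H1.const 0) = 0 := H1.primL_const 0
  rw [thetaMap, phiPrimitive, relVelocity_flat M c h, hb, sin_of_eq_zero h, h1]
  simp only [H1.mulL_const, map_sub, map_add, map_smul, H1.primL_const, smul_zero, add_zero,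
    sub_zero, neg_zero]

/-- The linearization of `Γ` at the flat sheet: the terms in `γ` cancel. -/
theorem hasFDerivAt_gammaMap (M c : ℝ) (hθ : HasFDerivAt θ Dθ x₀) (h0 : θ x₀ = 0)
    (hγ : HasFDerivAt γ Dγ x₀) (hb : γ x₀ = H1.const b)
    (hodd : ∀ᶠ x in 𝓝 x₀, ∀ y, θ x (-y) = -θ x y) :
    HasFDerivAt (fun x => gammaMap M c (θ x) (γ x)) ((c * M / π) • hilbertL.comp Dθ) x₀ := by
  have hm := hasFDerivAt_cosMean hθ h0
  have hm1 := cosMean_of_eq_zero h0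
  have c1 := hasFDerivAt_comp_of_critical hm (φ := fun m => c * M / (π * m))
    (by rw [hm1]; exact (differentiableAt_const _).div (by fun_prop) (by positivity))
  have d1 := hasFDerivAt_smul_of_critical c1 (a := c * M / π) (by simp only [hm1, mul_one])
    (hasFDerivAt_sin_comp hθ h0)
  refine (hilbertL.hasFDerivAt.comp x₀ (((hasFDerivAt_velRe hθ h0 hγ hb hodd).sub
    (hilbertL.hasFDerivAt.comp x₀ hγ)).add d1)).congr_fderiv ?_
  -- the velocity contributes `H γ`, which is the part subtracted in the remainder `K`
  rw [sub_self, zero_add, ContinuousLinearMap.comp_smul]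

end Deriv

/-! ### The linearization on the state space -/

/-- The Hilbert transform `H¹_{per,odd} → H¹_{per,0,even}`. -/
def hilbertOdd : H1Odd →L[ℝ] H1ZeroEven :=
  (hilbertL.comp H1Odd.subtypeL).codRestrict H1ZeroEven fun f =>
    ⟨mean_hilbertL f.1, hilbertL_even_of_odd f.2⟩

/-- The primitive `H¹_{per,0,even} → H¹_{per,odd}`. -/
def primEven : H1ZeroEven →L[ℝ] H1Odd :=
  (H1.primL.comp H1ZeroEven.subtypeL).codRestrict H1Odd fun f x => by
    have h := H1.primL_neg (f := f.1) (σ := 1) (fun x => by rw [f.2.2, one_mul]) (.inr rfl) x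
    rwa [neg_one_mul] at h

/-- The inverse second derivative `H¹_{per,odd} → H¹_{per,odd}`. -/
def primPrimOdd : H1Odd →L[ℝ] H1Odd :=
  (H1.primL.comp (H1.primL.comp H1Odd.subtypeL)).codRestrict H1Odd fun f x => by
    have h1 := H1.primL_neg (f := f.1) (σ := -1) (fun x => by rw [f.2, neg_one_mul])
      (.inl (mean_eq_zero_of_odd f.1.periodic f.2))
    have h2 := H1.primL_neg (f := H1.primL f.1) (σ := 1) (fun x => by rw [h1, neg_neg])
      (.inr rfl) x
    rwa [neg_one_mul] at h2

/-- `p ∂⁻¹ H θ + q ∂⁻¹ γ₁ + r ∂⁻² θ`, the shape of the linearization of `Θ`. -/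
def linTheta (p q r : ℝ) : StateSpace →L[ℝ] H1Odd :=
  p • primEven.comp (hilbertOdd.comp (.fst ℝ H1Odd H1ZeroEven)) +
    q • primEven.comp (.snd ℝ H1Odd H1ZeroEven) +
    r • primPrimOdd.comp (.fst ℝ H1Odd H1ZeroEven)

theorem linTheta_apply (p q r : ℝ) (ξ : StateSpace) : linTheta p q r ξ =
    p • primEven (hilbertOdd ξ.1) + q • primEven ξ.2 + r • primPrimOdd ξ.1 := rfl

theorem coe_linTheta (p q r : ℝ) (ξ : StateSpace) : (linTheta p q r ξ : H1) =
    p • H1.primL (hilbertL ξ.1) + q • H1.primL ξ.2 + r • H1.primL (H1.primL ξ.1) := by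
  rw [linTheta_apply, Submodule.coe_add, Submodule.coe_add, Submodule.coe_smul, Submodule.coe_smul,
    Submodule.coe_smul]
  rfl

/-- `θ ↦ (θ, s H θ)`: the linearization of the passage from `Θ` to `(Θ, Γ)`. -/
def graphHilbert (s : ℝ) : H1Odd →L[ℝ] StateSpace :=
  (ContinuousLinearMap.id ℝ H1Odd).prod (s • hilbertOdd)

/-- The linearization of the traveling wave map. -/
def linearization (p q r s : ℝ) : StateSpace →L[ℝ] StateSpace :=
  ContinuousLinearMap.id ℝ StateSpace - (graphHilbert s).comp (linTheta p q r)

/-- Passing to `V` does not change a function that belongs to `V`. -/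
theorem toSubspace_eq {V : Submodule ℝ H1} (u : V) {f : ℝ → ℝ} (h : (u.1 : ℝ → ℝ) = f) :
    toSubspace V f = u := by
  have hin : IsIn V f := ⟨u, h⟩
  rw [toSubspace, dif_pos hin]
  exact Subtype.ext (H1.ext fun x => congrFun (hin.choose_spec.trans h.symm) x)

/-- Differentiability into a subspace can be tested in the ambient space. -/
theorem hasFDerivAt_of_coe {E : Type*} [NormedAddCommGroup E] [NormedSpace ℝ E] {x₀ : E}
    {V : Submodule ℝ H1} {f : E → V} {D : E →L[ℝ] V}
    (h : HasFDerivAt (fun x => (f x : H1)) (V.subtypeL.comp D) x₀) : HasFDerivAt f D x₀ := by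
  rw [hasFDerivAt_iff_isLittleO] at h ⊢
  exact Asymptotics.IsLittleO.of_norm_left (h.norm_left)

section Linearization

variable (M τ A g γbar c : ℝ)

/-- `Θ` on the state space. -/
def thetaState (ξ : StateSpace) : H1 := thetaMap M τ A g c ξ.1.1 (H1.const γbar + ξ.2.1)

/-- `Γ` on the state space. -/
def gammaState (ξ : StateSpace) : H1 :=
  gammaMap M c (thetaState M τ A g γbar c ξ) (H1.const γbar + ξ.2.1)

/-- The coefficient of `∂⁻¹ H θ` in the linearization of `Θ`. -/
def coefAngle : ℝ := -(π * γbar ^ 2 / (τ * M)) + A * c * γbar / τ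

/-- The coefficient of `∂⁻¹ γ₁` in the linearization of `Θ`. -/
def coefStrength : ℝ := -(c / τ) + A * π * γbar / (τ * M)

/-- The coefficient of `∂⁻² θ` in the linearization of `Θ`. -/
def coefGravity : ℝ := A * g * M / (π * τ)

variable {M}

theorem even_strength (ξ : StateSpace) (x : ℝ) :
    (H1.const γbar + ξ.2.1) (-x) = (H1.const γbar + ξ.2.1) x := by
  rw [H1.add_apply, H1.add_apply, ξ.2.2.2]
  rfl

theorem eventually_small_angle : ∀ᶠ ξ : StateSpace in 𝓝 0, ‖ξ.1.1‖ ≤ 1 / 144 := by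
  have h : Tendsto (fun ξ : StateSpace => ‖ξ.1.1‖) (𝓝 0) (𝓝 ‖(0 : StateSpace).1.1‖) := by
    apply Continuous.tendsto
    fun_prop
  refine h.eventually_le_const ?_
  change ‖(0 : H1)‖ < 1 / 144
  rw [norm_zero]
  norm_num

theorem hasFDerivAt_angle : HasFDerivAt (fun ξ : StateSpace => ξ.1.1)
    (H1Odd.subtypeL.comp (.fst ℝ H1Odd H1ZeroEven)) 0 :=
  (H1Odd.subtypeL.comp (.fst ℝ H1Odd H1ZeroEven)).hasFDerivAt

theorem hasFDerivAt_strength : HasFDerivAt (fun ξ : StateSpace => H1.const γbar + ξ.2.1)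
    (H1ZeroEven.subtypeL.comp (.snd ℝ H1Odd H1ZeroEven)) 0 :=
  (H1ZeroEven.subtypeL.comp (.snd ℝ H1Odd H1ZeroEven)).hasFDerivAt.const_add _

theorem strength_zero : H1.const γbar + (0 : StateSpace).2.1 = H1.const γbar := add_zero _

theorem hasFDerivAt_thetaState (hM : 0 < M) :
    HasFDerivAt (thetaState M τ A g γbar c) (H1Odd.subtypeL.comp
      (linTheta (coefAngle M τ A γbar c) (coefStrength M τ A γbar c) (coefGravity M τ A g))) 0 := by
  refine (hasFDerivAt_thetaMap M τ A g c hM hasFDerivAt_angle rfl (hasFDerivAt_strength γbar)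
    (strength_zero γbar) (Eventually.of_forall fun ξ => ξ.1.2)).congr_fderiv
    (ContinuousLinearMap.ext fun ξ => ?_)
  exact (coe_linTheta _ _ _ ξ).symm

theorem thetaState_zero : thetaState M τ A g γbar c 0 = 0 :=
  thetaMap_flat M τ A g c rfl (strength_zero γbar)

theorem eventually_thetaState_odd :
    ∀ᶠ ξ in 𝓝 0, ∀ y, thetaState M τ A g γbar c ξ (-y) = -thetaState M τ A g γbar c ξ y := by
  filter_upwards [eventually_small_angle] with ξ hξ
  exact thetaMap_odd M τ A g c ξ.1.2 hξ (even_strength γbar ξ)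

theorem hasFDerivAt_gammaState (hM : 0 < M) :
    HasFDerivAt (gammaState M τ A g γbar c) (H1ZeroEven.subtypeL.comp
      (((c * M / π) • hilbertOdd).comp (linTheta (coefAngle M τ A γbar c)
        (coefStrength M τ A γbar c) (coefGravity M τ A g)))) 0 := by
  refine (hasFDerivAt_gammaMap M c (hasFDerivAt_thetaState τ A g γbar c hM)
    (thetaState_zero τ A g γbar c) (hasFDerivAt_strength γbar) (strength_zero γbar)
    (eventually_thetaState_odd τ A g γbar c)).congr_fderiv
    (ContinuousLinearMap.ext fun ξ => ?_)
  rfl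

/-- Near the origin `Θ` and `Γ` are given by elements of the state space. -/
theorem eventually_exists_state (hM : 0 < M) : ∀ᶠ ξ : StateSpace in 𝓝 0,
    (∃ u : H1Odd, u.1 = thetaState M τ A g γbar c ξ ∧
      (u.1 : ℝ → ℝ) = Theta M τ A g γbar ξ.1.1 ξ.2.1 c) ∧
    ∃ u : H1ZeroEven, u.1 = gammaState M τ A g γbar c ξ ∧
      (u.1 : ℝ → ℝ) = Gamma M τ A g γbar ξ.1.1 ξ.2.1 c := by
  -- `Γ` is evaluated on the curve of `Θ`, which has to be nearly flat as well
  have hsmall : ∀ᶠ ξ in 𝓝 0, ‖thetaState M τ A g γbar c ξ‖ ≤ 1 / 144 := by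
    have := (hasFDerivAt_thetaState τ A g γbar c hM).continuousAt.norm
    rw [ContinuousAt, thetaState_zero, norm_zero] at this
    exact this.eventually_le_const (by norm_num)
  filter_upwards [eventually_small_angle, hsmall, eventually_thetaState_odd τ A g γbar c]
    with ξ h1 h2 h3
  have h4 := Theta_eq hM ξ.1.2 h1 τ A g γbar c ξ.2.1
  refine ⟨⟨⟨_, h3⟩, rfl, h4.symm⟩, ⟨⟨_, mean_hilbertL _, ?_⟩, rfl,
    (Gamma_eq hM h3 h2 τ A g γbar c ξ.1.1 ξ.2.1 h4).symm⟩⟩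
  exact gammaMap_even M c h3 h2 (even_strength γbar ξ)

/-- The linearization is `1 - S T`, with `T` the derivative of `Θ` and `S φ = (φ, (cM/π) H φ)`. -/
theorem hasFDerivAt_travelingWaveMap (hM : 0 < M) :
    HasFDerivAt (travelingWaveMap M τ A g γbar c) (linearization (coefAngle M τ A γbar c)
      (coefStrength M τ A γbar c) (coefGravity M τ A g) (c * M / π)) 0 := by
  have hex := eventually_exists_state τ A g γbar c hM
  have key {f₁ : StateSpace → H1Odd} {f₂ : StateSpace → H1ZeroEven}
      {T : StateSpace →L[ℝ] H1Odd} (h₁ : HasFDerivAt f₁ T 0)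
      (h₂ : HasFDerivAt f₂ (((c * M / π) • hilbertOdd).comp T) 0) :
      HasFDerivAt (fun ξ => ξ - (f₁ ξ, f₂ ξ))
        (ContinuousLinearMap.id ℝ StateSpace - (graphHilbert (c * M / π)).comp T) 0 :=
    (hasFDerivAt_id (0 : StateSpace)).sub
      ((h₁.prodMk h₂).congr_fderiv (ContinuousLinearMap.ext fun ξ => rfl))
  refine key ?_ ?_
  · refine hasFDerivAt_of_coe ((hasFDerivAt_thetaState τ A g γbar c hM).congr_of_eventuallyEq ?_)
    filter_upwards [hex] with ξ hξ
    obtain ⟨⟨u, hu, hu'⟩, -⟩ := hξ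
    rw [toSubspace_eq u hu', hu]
  · refine hasFDerivAt_of_coe ((hasFDerivAt_gammaState τ A g γbar c hM).congr_of_eventuallyEq ?_)
    filter_upwards [hex] with ξ hξ
    obtain ⟨-, ⟨u, hu, hu'⟩⟩ := hξ
    rw [toSubspace_eq u hu', hu]

end Linearization

/-! ### The linearization on Fourier modes -/

theorem coef_const {n : ℤ} (hn : n ≠ 0) (a : ℝ) : coef (H1.const a) n = 0 := by
  have h := (H1.const a).coef_deriv n
  have h0 : deriv (H1.const a) = fun x => 0 * (0 : H1) x := by
    have : (H1.const a : ℝ → ℝ) = fun _ => a := rfl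
    rw [this]
    funext x
    simp
  rw [h0, coef_smul, Complex.ofReal_zero, zero_mul] at h
  have hn' : (n : ℂ) * Complex.I ≠ 0 := mul_ne_zero (by exact_mod_cast hn) Complex.I_ne_zero
  exact (mul_eq_zero.1 h.symm).resolve_left hn'

/-- The normalized primitive divides the coefficients of nonzero index by `i n`. -/
theorem coef_primL (f : H1) {n : ℤ} (hn : n ≠ 0) :
    n * Complex.I * coef (H1.primL f) n = coef f n := by
  have h := (H1.primL f).coef_deriv n
  have h1 : deriv (H1.primL f) = ((f - H1.const (mean f) : H1) : ℝ → ℝ) := f.primitive_mem.2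
  rw [← h, h1, H1.coef_sub, coef_const hn, sub_zero]

/-- The coefficient of `sin kα`, up to normalization. -/
def sinCoef (k : ℕ+) : H1Odd →ₗ[ℝ] ℝ where
  toFun φ := (coef φ.1 (k : ℤ)).im
  map_add' φ ψ := by
    rw [← Complex.add_im, ← H1.coef_add]
    rfl
  map_smul' a φ := by
    rw [RingHom.id_apply, smul_eq_mul, ← Complex.im_ofReal_mul, ← H1.coef_smul]
    rfl

theorem sinCoef_apply (k : ℕ+) (φ : H1Odd) : sinCoef k φ = (coef φ.1 (k : ℤ)).im := rfl

theorem coef_reflect (f : H1) (n : ℤ) : coef (fun x => f (-x)) n = coef f (-n) := by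
  have h := intervalIntegral.integral_comp_neg (a := 0) (b := 2 * π)
    fun x : ℝ => Complex.exp (-(((-n : ℤ) : ℂ) * x * Complex.I)) * f x
  have hper : Function.Periodic
      (fun x : ℝ => Complex.exp (-(((-n : ℤ) : ℂ) * x * Complex.I)) * f x) (2 * π) := fun x => by
    have h1 := f.periodic x
    have e : Complex.exp (-(((-n : ℤ) : ℂ) * ((x + 2 * π : ℝ) : ℂ) * Complex.I)) =
        Complex.exp (-(((-n : ℤ) : ℂ) * x * Complex.I)) := by
      push_cast
      rw [show -(-(n : ℂ) * (x + 2 * π) * Complex.I) =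
        -(-(n : ℂ) * x * Complex.I) + -(((-n : ℤ) : ℂ) * (2 * π) * Complex.I) by push_cast; ring,
        Complex.exp_add, exp_int_mul_two_pi, mul_one]
    simp only [h1, e]
  have h2 := hper.intervalIntegral_add_eq (-(2 * π)) 0
  rw [neg_add_cancel, zero_add] at h2
  rw [neg_zero, h2] at h
  rw [coef, coef, ← h]
  congr 2
  funext x
  congr 2
  push_cast
  ring

theorem coef_neg_of_odd {f : H1} (hf : ∀ x, f (-x) = -f x) (n : ℤ) :
    coef f (-n) = -coef f n := by
  rw [← coef_reflect, show (fun x => f (-x)) = fun x => -1 * f x from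
    funext fun x => by rw [hf, neg_one_mul], coef_smul]
  push_cast
  ring

theorem odd_of_coef {f : H1} (hf : ∀ n, coef f (-n) = -coef f n) (x : ℝ) : f (-x) = -f x := by
  have h := eq_of_coef_of_continuous (f := fun x => f (-x)) (f' := fun x => -1 * f x)
    (f.continuous.comp continuous_neg) (continuous_const.mul f.continuous)
    (fun x => by
      have h1 := f.periodic (-x - 2 * π)
      rw [sub_add_cancel] at h1
      exact (congrArg f (by ring)).trans h1.symm)
    (fun x => by
      have h1 := f.periodic x
      simp only [h1])
    (fun n => by
      rw [coef_reflect, coef_smul, hf]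
      push_cast
      ring)
  have h2 := congrFun h x
  simp only [neg_one_mul] at h2
  exact h2

/-- An odd function is determined by its sine coefficients. -/
theorem eq_zero_of_sinCoef {φ : H1Odd} (h : ∀ k, sinCoef k φ = 0) : φ = 0 := by
  have hodd := coef_neg_of_odd φ.2
  have hpos (k : ℕ+) : coef φ.1 (k : ℤ) = 0 := by
    refine Complex.ext ?_ (h k)
    have h1 := hodd k
    rw [coef_neg_index] at h1
    have h2 := congrArg Complex.re h1
    rw [Complex.conj_re, Complex.neg_re] at h2
    rw [Complex.zero_re]
    linarith
  refine Subtype.ext (H1.eq_of_coef fun n => ?_)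
  have hz : coef ((0 : H1Odd) : H1) n = 0 := by
    have : (((0 : H1Odd) : H1) : ℝ → ℝ) = fun x => 0 * (0 : H1) x := by
      funext x
      simp
    rw [this, coef_smul, Complex.ofReal_zero, zero_mul]
  rw [hz]
  rcases lt_trichotomy n 0 with hn | rfl | hn
  · have h1 := hodd n
    have h2 := hpos ⟨n.natAbs, Int.natAbs_pos.2 hn.ne⟩
    have h3 : ((n.natAbs : ℕ) : ℤ) = -n := by omega
    rw [PNat.mk_coe, h3, h1, neg_eq_zero] at h2
    exact h2
  · rw [coef_zero_eq_mean, mean_eq_zero_of_odd φ.1.periodic φ.2, Complex.ofReal_zero]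
  · have h2 := hpos ⟨n.natAbs, Int.natAbs_pos.2 hn.ne'⟩
    have h3 : ((n.natAbs : ℕ) : ℤ) = n := by omega
    rwa [PNat.mk_coe, h3] at h2

theorem pnat_mul_I_ne_zero (k : ℕ+) : (((k : ℕ) : ℤ) : ℂ) * Complex.I ≠ 0 :=
  mul_ne_zero (by exact_mod_cast k.ne_zero) Complex.I_ne_zero

theorem sinCoef_primEven_hilbertOdd (k : ℕ+) (φ : H1Odd) :
    sinCoef k (primEven (hilbertOdd φ)) = -(k : ℝ)⁻¹ * sinCoef k φ := by
  have hk : ((k : ℕ) : ℤ) ≠ 0 := by exact_mod_cast k.ne_zero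
  have h1 : _ = coef (hilbertL φ.1) (k : ℤ) := coef_primL (hilbertL φ.1) hk
  rw [coef_hilbertL, Int.sign_eq_one_of_pos (by exact_mod_cast k.pos)] at h1
  have h2 : coef (H1.primL (hilbertL φ.1)) (k : ℤ) = ((-(k : ℝ)⁻¹ : ℝ) : ℂ) * coef φ.1 (k : ℤ) := by
    apply mul_left_cancel₀ (pnat_mul_I_ne_zero k)
    rw [h1]
    have : ((k : ℕ) : ℂ) ≠ 0 := by exact_mod_cast k.ne_zero
    push_cast
    field_simp
  rw [sinCoef_apply, sinCoef_apply, ← Complex.im_ofReal_mul, ← h2]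
  rfl

theorem sinCoef_primPrimOdd (k : ℕ+) (φ : H1Odd) :
    sinCoef k (primPrimOdd φ) = -((k : ℝ) ^ 2)⁻¹ * sinCoef k φ := by
  have hk : ((k : ℕ) : ℤ) ≠ 0 := by exact_mod_cast k.ne_zero
  have h1 := coef_primL (H1.primL φ.1) hk
  have h2 := coef_primL φ.1 hk
  have h3 : coef (H1.primL (H1.primL φ.1)) (k : ℤ) =
      ((-((k : ℝ) ^ 2)⁻¹ : ℝ) : ℂ) * coef φ.1 (k : ℤ) := by
    rw [← h2, ← h1]
    have : ((k : ℕ) : ℂ) ≠ 0 := by exact_mod_cast k.ne_zero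
    push_cast
    field_simp
    rw [Complex.I_sq]
    ring
  rw [sinCoef_apply, sinCoef_apply, ← Complex.im_ofReal_mul, ← h3]
  rfl

/-- The symbol of `∂⁻¹ (p + q s) H + r ∂⁻²` on sine modes, with `a = p + q s`. -/
def modeSymbol (a r : ℝ) (k : ℕ) : ℝ := -(a * (k : ℝ)⁻¹ + r * ((k : ℝ) ^ 2)⁻¹)

/-- The reduced operator acts on sine coefficients by multiplication with `modeSymbol`. -/
theorem sinCoef_linTheta_graphHilbert (p q r s : ℝ) (k : ℕ+) (φ : H1Odd) :
    sinCoef k (linTheta p q r (graphHilbert s φ)) = modeSymbol (p + q * s) r k * sinCoef k φ := by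
  have h : linTheta p q r (graphHilbert s φ) =
      p • primEven (hilbertOdd φ) + q • s • primEven (hilbertOdd φ) + r • primPrimOdd φ := by
    rw [← map_smul primEven s]
    rfl
  rw [h, map_add, map_add, map_smul, map_smul, map_smul, map_smul, sinCoef_primEven_hilbertOdd,
    sinCoef_primPrimOdd, modeSymbol]
  simp only [smul_eq_mul]
  ring

theorem tendsto_modeSymbol (a r : ℝ) : Tendsto (modeSymbol a r) atTop (𝓝 0) := by
  have h1 : Tendsto (fun k : ℕ => (k : ℝ)⁻¹) atTop (𝓝 0) := tendsto_inv_atTop_nhds_zero_nat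
  have h2 := (h1.const_mul a).add ((h1.mul h1).const_mul r)
  have h3 := h2.neg
  simp only [mul_zero, add_zero, neg_zero] at h3
  refine h3.congr fun k => ?_
  rw [modeSymbol, sq, mul_inv]

/-- Bounded real diagonal operators on sine modes. -/
theorem exists_diagonal {m : ℕ → ℝ} {B : ℝ} (hm : ∀ n, |m n| ≤ B) :
    ∃ D : H1Odd →ₗ[ℝ] H1Odd, ∀ k φ, sinCoef k (D φ) = m k * sinCoef k φ := by
  have hs : IsSymbol (fun n : ℤ => (m n.natAbs : ℂ)) B :=
    ⟨fun n => by rw [Int.natAbs_neg, Complex.conj_ofReal], fun n => by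
      rw [Complex.norm_real]
      exact hm _⟩
  refine ⟨((multiplier hs : H1 →ₗ[ℝ] H1).comp H1Odd.subtype).codRestrict H1Odd fun φ => ?_,
    fun k φ => ?_⟩
  · refine odd_of_coef fun n => ?_
    have h (n : ℤ) : coef (multiplier hs φ.1) n = m n.natAbs * coef φ.1 n := coef_multiplier hs _ n
    refine (h (-n)).trans ?_
    rw [Int.natAbs_neg, coef_neg_of_odd φ.2, mul_neg, ← h n]
    rfl
  · rw [sinCoef_apply, sinCoef_apply, ← Complex.im_ofReal_mul]
    exact congrArg Complex.im (coef_multiplier hs φ.1 (k : ℤ))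

/-! #### The modes themselves -/

theorem sinMode_one_apply (k : ℕ+) (x : ℝ) : (sinMode 1 k).1 x = Real.sin (k * x) := one_mul _

theorem sinMode_one_ne_zero (k : ℕ+) : sinMode 1 k ≠ 0 := by
  intro h
  have h1 := sinMode_one_apply k (π / (2 * k))
  have hk : ((k : ℕ) : ℝ) ≠ 0 := by exact_mod_cast k.ne_zero
  rw [h, show (k : ℝ) * (π / (2 * k)) = π / 2 by field_simp, Real.sin_pi_div_two] at h1
  exact zero_ne_one h1

theorem hilbertOdd_sinMode (k : ℕ+) : hilbertOdd (sinMode 1 k) = -cosMode k := by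
  refine Subtype.ext (H1.ext fun x => ?_)
  have h1 : ((hilbertOdd (sinMode 1 k)).1 : ℝ → ℝ) = foldedHilbert (sinMode 1 k).1 :=
    hilbertL_eq_folded _
  have h2 : (-cosMode k).1 x = -Real.cos (k * x) := rfl
  rw [congrFun h1 x, h2, foldedHilbert]
  have h3 : ∫ t in (0 : ℝ)..π, hilbertIntegrand (sinMode 1 k).1 x t =
      ∫ t in (0 : ℝ)..π, -2 * Real.cos (k * x) * (Real.sin ((k : ℕ) * t) * Real.cot (t / 2)) := by
    congr 1
    funext t
    rw [hilbertIntegrand, sinMode_one_apply, sinMode_one_apply, mul_sub, mul_add, Real.sin_sub,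
      Real.sin_add]
    ring
  rw [h3, intervalIntegral.integral_const_mul, (integral_sin_mul_cot k).2, if_neg k.ne_zero]
  field_simp

theorem primEven_cosMode (k : ℕ+) : primEven (cosMode k) = (k : ℝ)⁻¹ • sinMode 1 k := by
  refine Subtype.ext (H1.ext fun x => ?_)
  have hk : ((k : ℕ) : ℝ) ≠ 0 := by exact_mod_cast k.ne_zero
  have h1 : (primEven (cosMode k)).1 x =
      (∫ a in (0 : ℝ)..x, Real.cos (k * a)) - x * mean (cosMode k).1 := rfl
  have h2 : ((k : ℝ)⁻¹ • sinMode 1 k).1 x = (k : ℝ)⁻¹ * (sinMode 1 k).1 x := rfl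
  rw [h1, h2, sinMode_one_apply, (cosMode k).2.1,
    intervalIntegral.integral_comp_mul_left (fun a => Real.cos a) hk, integral_cos]
  simp

theorem primPrimOdd_sinMode (k : ℕ+) :
    primPrimOdd (sinMode 1 k) = -((k : ℝ) ^ 2)⁻¹ • sinMode 1 k := by
  have hk : ((k : ℕ) : ℝ) ≠ 0 := by exact_mod_cast k.ne_zero
  have h1 : H1.primL (sinMode 1 k).1 = H1.const (k : ℝ)⁻¹ - (k : ℝ)⁻¹ • (cosMode k).1 := by
    refine H1.ext fun x => ?_
    have h2 : (H1.const (k : ℝ)⁻¹ - (k : ℝ)⁻¹ • (cosMode k).1) x =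
      (k : ℝ)⁻¹ - (k : ℝ)⁻¹ * Real.cos (k * x) := rfl
    rw [h2, H1.primL_apply, mean_eq_zero_of_odd (sinMode 1 k).1.periodic (sinMode 1 k).2]
    simp only [sinMode_one_apply]
    rw [intervalIntegral.integral_comp_mul_left (fun a => Real.sin a) hk, integral_sin]
    simp
    ring
  refine Subtype.ext ?_
  have h3 : H1.primL (cosMode k).1 = (k : ℝ)⁻¹ • (sinMode 1 k).1 :=
    congrArg Subtype.val (primEven_cosMode k)
  have h4 : (primPrimOdd (sinMode 1 k)).1 = H1.primL (H1.primL (sinMode 1 k).1) := rfl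
  rw [h4, h1, map_sub, H1.primL_const, map_smul, h3, Submodule.coe_smul, zero_sub, smul_smul,
    neg_smul, sq, mul_inv]

theorem sinCoef_sinMode_of_ne {j k : ℕ+} (h : j ≠ k) : sinCoef k (sinMode 1 j) = 0 := by
  have h1 := sinCoef_primPrimOdd k (sinMode 1 j)
  rw [primPrimOdd_sinMode, map_smul, smul_eq_mul] at h1
  have hj : (0 : ℝ) < (j : ℕ) := by exact_mod_cast j.pos
  have hk : (0 : ℝ) < (k : ℕ) := by exact_mod_cast k.pos
  by_contra h0
  have h2 := mul_right_cancel₀ h0 h1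
  rw [neg_inj, inv_inj, sq_eq_sq₀ hj.le hk.le] at h2
  exact h (PNat.coe_injective (by exact_mod_cast h2))

theorem sinCoef_sinMode_self (k : ℕ+) : sinCoef k (sinMode 1 k) ≠ 0 := fun h =>
  sinMode_one_ne_zero k (eq_zero_of_sinCoef fun j => by
    by_cases hj : k = j
    · rw [← hj, h]
    · exact sinCoef_sinMode_of_ne hj)

/-! ### Spectral theory of `1 - S T` when `T S` is diagonal -/

/-- `N` is diagonal with eigenvalues `ν k` accumulating only at `0`: it is diagonalized by the
separating functionals `e k`, with dual vectors `w k` (up to normalization), and diagonal equations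
with bounded inverse can be solved. -/
structure IsDiagonal {Y ι : Type*} [AddCommGroup Y] [Module ℂ Y] (N : Module.End ℂ Y)
    (e : ι → Y →ₗ[ℂ] ℂ) (w : ι → Y) (ν : ι → ℂ) : Prop where
  sep : ∀ y, (∀ k, e k y = 0) → y = 0
  eig : ∀ k y, e k (N y) = ν k * e k y
  off : ∀ j k, j ≠ k → e k (w j) = 0
  diag : ∀ k, e k (w k) ≠ 0
  finite : ∀ z, z ≠ 0 → {k | ν k = z}.Finite
  solve : ∀ z, z ≠ 0 → (∀ k, ν k ≠ z) → ∀ y, ∃ u, ∀ k, (ν k - z) * e k u = e k y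

namespace IsDiagonal

variable {X Y ι : Type*} [AddCommGroup Y] [Module ℂ Y] [AddCommGroup X] [Module ℂ X]
  {N : Module.End ℂ Y} {e : ι → Y →ₗ[ℂ] ℂ} {w : ι → Y} {ν : ι → ℂ}

theorem ext (h : IsDiagonal N e w ν) {y y' : Y} (hy : ∀ k, e k y = e k y') : y = y' :=
  sub_eq_zero.1 (h.sep _ fun k => by rw [map_sub, hy, sub_self])

theorem apply_w (h : IsDiagonal N e w ν) (k : ι) : N (w k) = ν k • w k := h.ext fun j => by
  rw [h.eig, map_smul, smul_eq_mul]
  by_cases hj : k = j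
  · rw [hj]
  · rw [h.off k j hj, mul_zero, mul_zero]

/-- The eigenvectors of `N` are finite combinations of the dual vectors. -/
theorem mem_span_of_eigen (h : IsDiagonal N e w ν) {z : ℂ} (hz : z ≠ 0) {y : Y}
    (hy : N y = z • y) : y ∈ Submodule.span ℂ (w '' {k | ν k = z}) := by
  classical
  have h0 (k : ι) (hk : ν k ≠ z) : e k y = 0 := by
    have h1 := h.eig k y
    rw [hy, map_smul, smul_eq_mul] at h1
    have h2 : (ν k - z) * e k y = 0 := by rw [sub_mul, h1, sub_self]
    exact (mul_eq_zero.1 h2).resolve_left (sub_ne_zero.2 hk)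
  have hF := h.finite z hz
  have h1 : y = ∑ k ∈ hF.toFinset, (e k y / e k (w k)) • w k := h.ext fun j => by
    rw [map_sum]
    by_cases hj : ν j = z
    · rw [Finset.sum_eq_single_of_mem j (hF.mem_toFinset.2 hj) fun k _ hk => by
        rw [map_smul, h.off k j hk, smul_zero], map_smul, smul_eq_mul, div_mul_cancel₀ _ (h.diag j)]
    · rw [h0 j hj]
      refine (Finset.sum_eq_zero fun k hk => ?_).symm
      have hkj : k ≠ j := fun hkj => hj (hkj ▸ hF.mem_toFinset.1 hk)
      rw [map_smul, h.off k j hkj, smul_zero]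
  rw [h1]
  exact Submodule.sum_mem _ fun k hk => Submodule.smul_mem _ _
    (Submodule.subset_span ⟨k, hF.mem_toFinset.1 hk, rfl⟩)

theorem linearIndependent (h : IsDiagonal N e w ν) : LinearIndependent ℂ w := by
  rw [linearIndependent_iff']
  intro s g hg k hk
  have h1 := congrArg (e k) hg
  rw [map_zero, map_sum, Finset.sum_eq_single_of_mem k hk fun j _ hj => by
    rw [map_smul, h.off j k hj, smul_zero], map_smul, smul_eq_mul] at h1
  exact (mul_eq_zero.1 h1).resolve_right (h.diag k)

variable {S : Y →ₗ[ℂ] X} {T : X →ₗ[ℂ] Y} {L : Module.End ℂ X}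

theorem sub_smul_apply (hL : ∀ x, L x = x - S (T x)) (μ : ℂ) (x : X) :
    (L - μ • (1 : Module.End ℂ X)) x = (1 - μ) • x - S (T x) := by
  rw [LinearMap.sub_apply, LinearMap.smul_apply, Module.End.one_apply, hL, sub_smul, one_smul]
  abel

theorem mem_eigenspace (hL : ∀ x, L x = x - S (T x)) {μ : ℂ} {x : X} :
    x ∈ Module.End.eigenspace L μ ↔ S (T x) = (1 - μ) • x := by
  rw [Module.End.mem_eigenspace_iff, hL, sub_smul, one_smul]
  constructor <;> intro h
  · rw [← h]; abel
  · rw [h]; abel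

/-- `S` maps the eigenvectors of `T S` to eigenvectors of `1 - S T`. -/
theorem S_w_mem (h : IsDiagonal (T ∘ₗ S) e w ν) (hL : ∀ x, L x = x - S (T x)) {μ : ℂ} {k : ι}
    (hk : ν k = 1 - μ) : S (w k) ∈ Module.End.eigenspace L μ := by
  have h1 : T (S (w k)) = ν k • w k := h.apply_w k
  rw [mem_eigenspace hL, h1, map_smul, hk]

/-- Away from `1`, the operators `S` and `T` identify the eigenspaces of `1 - S T` and of `1 - T S`.
-/
theorem eigenspace_eq (h : IsDiagonal (T ∘ₗ S) e w ν) (hL : ∀ x, L x = x - S (T x)) {μ : ℂ}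
    (hμ : μ ≠ 1) : Module.End.eigenspace L μ =
      Submodule.span ℂ (range fun k : {k // ν k = 1 - μ} => S (w k)) := by
  have hz : 1 - μ ≠ 0 := sub_ne_zero.2 hμ.symm
  apply le_antisymm
  · intro x hx
    rw [mem_eigenspace hL] at hx
    have h1 : (T ∘ₗ S) (T x) = (1 - μ) • T x := by
      rw [LinearMap.comp_apply, hx, map_smul]
    have h2 := h.mem_span_of_eigen hz h1
    have h3 : x = (1 - μ)⁻¹ • S (T x) := by rw [hx, inv_smul_smul₀ hz]
    rw [h3]
    refine Submodule.smul_mem _ _ ?_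
    have h4 := Submodule.mem_map_of_mem (f := S) h2
    rw [Submodule.map_span] at h4
    refine Submodule.span_mono ?_ h4
    rintro _ ⟨_, ⟨k, hk, rfl⟩, rfl⟩
    exact ⟨⟨k, hk⟩, rfl⟩
  · rw [Submodule.span_le]
    rintro _ ⟨k, rfl⟩
    exact h.S_w_mem hL k.2

theorem rank_eigenspace {X : Type} {ι : Type} [AddCommGroup X] [Module ℂ X]
    {e : ι → Y →ₗ[ℂ] ℂ} {w : ι → Y} {ν : ι → ℂ} {S : Y →ₗ[ℂ] X} {T : X →ₗ[ℂ] Y}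
    {L : Module.End ℂ X} (h : IsDiagonal (T ∘ₗ S) e w ν) (hL : ∀ x, L x = x - S (T x))
    (hS : Function.Injective S) {μ : ℂ} (hμ : μ ≠ 1) :
    Module.rank ℂ (Module.End.eigenspace L μ) = Cardinal.mk {k // ν k = 1 - μ} := by
  have hli : LinearIndependent ℂ fun k : {k // ν k = 1 - μ} => S (w k) :=
    (h.linearIndependent.map' S (LinearMap.ker_eq_bot.2 hS)).comp _ Subtype.val_injective
  rw [h.eigenspace_eq hL hμ, rank_span hli, Cardinal.mk_range_eq _ hli.injective]

/-- There are no generalized eigenvectors besides the eigenvectors. -/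
theorem maxGenEigenspace_eq (h : IsDiagonal (T ∘ₗ S) e w ν) (hL : ∀ x, L x = x - S (T x)) {μ : ℂ}
    (hμ : μ ≠ 1) : Module.End.maxGenEigenspace L μ = Module.End.eigenspace L μ := by
  have hz : 1 - μ ≠ 0 := sub_ne_zero.2 hμ.symm
  refine le_antisymm (fun x hx => ?_) (Module.End.genEigenspace_le_maximal L μ 1)
  obtain ⟨n, hn⟩ := (Module.End.mem_maxGenEigenspace _ _ _).1 hx
  set P := L - μ • (1 : Module.End ℂ X) with hP
  have hPx (x : X) : P x = (1 - μ) • x - S (T x) := sub_smul_apply hL μ x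
  have he (k : ι) (x : X) : e k (T (P x)) = (1 - μ - ν k) * e k (T x) := by
    have h1 : e k (T (S (T x))) = ν k * e k (T x) := h.eig k (T x)
    rw [hPx, map_sub, map_smul, map_sub, map_smul, h1, smul_eq_mul]
    ring
  have hen (k : ι) (n : ℕ) (x : X) : e k (T ((P ^ n) x)) = (1 - μ - ν k) ^ n * e k (T x) := by
    induction n with
    | zero => simp
    | succ n ih =>
      rw [pow_succ', Module.End.mul_apply, he, ih]
      ring
  -- `e k ∘ T` intertwines `P` with a scalar, which is nilpotent only if it is zero
  have hT : T (P x) = 0 := h.sep _ fun k => by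
    have h1 := hen k n x
    rw [hn, map_zero, map_zero] at h1
    rw [he]
    rcases mul_eq_zero.1 h1.symm with h2 | h2
    · have h3 : 1 - μ - ν k = 0 := by
        by_contra h0
        exact pow_ne_zero n h0 h2
      rw [h3, zero_mul]
    · rw [h2, mul_zero]
  -- on the kernel of `T` the operator `P` is the invertible scalar `1 - μ`
  have hPn (m : ℕ) : (P ^ m) (P x) = (1 - μ) ^ m • P x := by
    induction m with
    | zero => simp
    | succ m ih =>
      rw [pow_succ', Module.End.mul_apply, ih, map_smul, hPx (P x), hT, map_zero, sub_zero,
        smul_smul, pow_succ]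
  have h2 := hPn n
  rw [← Module.End.mul_apply, ← pow_succ, pow_succ', Module.End.mul_apply, hn, map_zero] at h2
  have h3 : P x = 0 := (smul_eq_zero.1 h2.symm).resolve_left (pow_ne_zero n hz)
  rw [hPx, sub_eq_zero] at h3
  exact (mem_eigenspace hL).2 h3.symm

/-- The resolvent of `1 - S T` at `μ` is obtained from a solution `u` of the diagonal equation `(T S
- (1 - μ)) u = T y`. -/
theorem notMem_spectrum (h : IsDiagonal (T ∘ₗ S) e w ν) (hL : ∀ x, L x = x - S (T x)) {μ : ℂ}
    (hμ : μ ≠ 1) (hν : ∀ k, ν k ≠ 1 - μ) : μ ∉ spectrum ℂ L := by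
  have hz : 1 - μ ≠ 0 := sub_ne_zero.2 hμ.symm
  rw [spectrum.mem_iff, not_not, Module.End.isUnit_iff]
  have hPx (x : X) : (algebraMap ℂ (Module.End ℂ X) μ - L) x = S (T x) - (1 - μ) • x := by
    rw [LinearMap.sub_apply, Module.algebraMap_end_apply, hL, sub_smul, one_smul]
    abel
  constructor
  · refine (injective_iff_map_eq_zero _).2 fun x hx => ?_
    rw [hPx, sub_eq_zero] at hx
    have h1 : T x = 0 := h.sep _ fun k => by
      have h2 : e k (T (S (T x))) = ν k * e k (T x) := h.eig k (T x)
      rw [hx, map_smul, map_smul, smul_eq_mul] at h2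
      have h3 : (ν k - (1 - μ)) * e k (T x) = 0 := by rw [sub_mul, ← h2, sub_self]
      exact (mul_eq_zero.1 h3).resolve_left (sub_ne_zero.2 (hν k))
    rw [h1, map_zero] at hx
    exact (smul_eq_zero.1 hx.symm).resolve_left hz
  · intro y
    obtain ⟨u, hu⟩ := h.solve _ hz hν (T y)
    have h1 : T (S u) = (1 - μ) • u + T y := h.ext fun k => by
      have h2 : e k (T (S u)) = ν k * e k u := h.eig k u
      rw [h2, map_add, map_smul, smul_eq_mul, ← hu k]
      ring
    refine ⟨(1 - μ)⁻¹ • (S u - y), ?_⟩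
    rw [hPx, map_smul, map_sub, h1, add_sub_cancel_right, inv_smul_smul₀ hz, smul_inv_smul₀ hz]
    abel

end IsDiagonal

/-! ### Complexification -/

section Complexification

variable {V W : Type*} [AddCommGroup V] [Module ℝ V] [AddCommGroup W] [Module ℝ W]

theorem exists_re_im (y : ℂ ⊗[ℝ] V) :
    ∃ a b : V, y = (1 : ℂ) ⊗ₜ[ℝ] a + Complex.I ⊗ₜ[ℝ] b := by
  induction y using TensorProduct.induction_on with
  | zero => exact ⟨0, 0, by simp⟩
  | tmul z v =>
    refine ⟨z.re • v, z.im • v, ?_⟩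
    rw [← TensorProduct.smul_tmul, ← TensorProduct.smul_tmul, ← TensorProduct.add_tmul]
    congr 1
    rw [Complex.real_smul, Complex.real_smul, mul_one, Complex.re_add_im]
  | add y y' hy hy' =>
    obtain ⟨a, b, rfl⟩ := hy
    obtain ⟨a', b', rfl⟩ := hy'
    exact ⟨a + a', b + b', by rw [TensorProduct.tmul_add, TensorProduct.tmul_add]; abel⟩

/-- The complex-linear extension of a real functional. -/
def complexFunctional (f : V →ₗ[ℝ] ℝ) : ℂ ⊗[ℝ] V →ₗ[ℂ] ℂ :=
  (TensorProduct.AlgebraTensorModule.rid ℝ ℂ ℂ).toLinearMap ∘ₗ f.baseChange ℂ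

theorem complexFunctional_tmul (f : V →ₗ[ℝ] ℝ) (z : ℂ) (v : V) :
    complexFunctional f (z ⊗ₜ[ℝ] v) = f v * z := by
  simp [complexFunctional]

/-- Diagonal relations are inherited by complexifications. -/
theorem complexFunctional_baseChange {f : V →ₗ[ℝ] ℝ} {D : W →ₗ[ℝ] V} {f' : W →ₗ[ℝ] ℝ} {m : ℝ}
    (h : ∀ v, f (D v) = m * f' v) (y : ℂ ⊗[ℝ] W) :
    complexFunctional f (D.baseChange ℂ y) = m * complexFunctional f' y := by
  obtain ⟨a, b, rfl⟩ := exists_re_im y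
  simp only [map_add, LinearMap.baseChange_tmul, complexFunctional_tmul, h, Complex.ofReal_mul]
  ring

/-- Separating families of functionals remain separating after complexification. -/
theorem eq_zero_of_complexFunctional {ι : Type*} {f : ι → V →ₗ[ℝ] ℝ}
    (hf : ∀ v, (∀ k, f k v = 0) → v = 0) {y : ℂ ⊗[ℝ] V}
    (h : ∀ k, complexFunctional (f k) y = 0) : y = 0 := by
  obtain ⟨a, b, rfl⟩ := exists_re_im y
  have h1 (k : ι) : f k a = 0 ∧ f k b = 0 := by
    have h2 := h k
    rw [map_add, complexFunctional_tmul, complexFunctional_tmul, mul_one] at h2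
    have h3 := congrArg Complex.re h2
    have h4 := congrArg Complex.im h2
    simp at h3 h4
    exact ⟨h3, h4⟩
  rw [hf a fun k => (h1 k).1, hf b fun k => (h1 k).2]
  simp

end Complexification

/-! ### The spectrum of the linearization -/

/-- Each nonzero value is taken finitely often, because the symbol tends to `0`. -/
theorem finite_modeSymbol_eq (a r : ℝ) {z : ℂ} (hz : z ≠ 0) :
    {k : ℕ+ | (modeSymbol a r k : ℂ) = z}.Finite := by
  have h := (tendsto_modeSymbol a r).norm
  rw [norm_zero] at h
  obtain ⟨K, hK⟩ := eventually_atTop.1 (h.eventually_lt_const (norm_pos_iff.2 hz))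
  refine ((finite_Iio K).preimage PNat.coe_injective.injOn).subset fun k hk => ?_
  by_contra h1
  have h2 := hK k (not_lt.1 h1)
  rw [← hk, Complex.norm_real] at h2
  exact lt_irrefl _ h2

/-- Off the spectrum the resolvent symbol is bounded, because the eigenvalues only accumulate at
`0`. -/
theorem exists_bound_resolvent (a r : ℝ) {z : ℂ} (hz : z ≠ 0) :
    ∃ B, ∀ n : ℕ, ‖((modeSymbol a r n : ℂ) - z)⁻¹‖ ≤ B := by
  have h1 : Tendsto (fun n : ℕ => ((modeSymbol a r n : ℂ) - z)⁻¹) atTop (𝓝 (((0 : ℝ) : ℂ) - z)⁻¹) :=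
    (((Complex.continuous_ofReal.tendsto 0).comp (tendsto_modeSymbol a r)).sub_const z).inv₀
      (by simpa using hz)
  obtain ⟨B, hB⟩ := (Metric.isBounded_range_of_tendsto _ h1).exists_norm_le
  exact ⟨B, fun n => hB _ ⟨n, rfl⟩⟩

/-- The complexification of `linTheta`. -/
def linThetaC (p q r : ℝ) : ℂ ⊗[ℝ] StateSpace →ₗ[ℂ] ℂ ⊗[ℝ] H1Odd :=
  (linTheta p q r : StateSpace →ₗ[ℝ] H1Odd).baseChange ℂ

/-- The complexification of `graphHilbert`. -/
def graphHilbertC (s : ℝ) : ℂ ⊗[ℝ] H1Odd →ₗ[ℂ] ℂ ⊗[ℝ] StateSpace :=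
  (graphHilbert s : H1Odd →ₗ[ℝ] StateSpace).baseChange ℂ

theorem complexify_linearization (p q r s : ℝ) (x : ℂ ⊗[ℝ] StateSpace) :
    complexify (linearization p q r s) x = x - graphHilbertC s (linThetaC p q r x) := by
  have h : (linearization p q r s : StateSpace →ₗ[ℝ] StateSpace) = LinearMap.id -
      (graphHilbert s : H1Odd →ₗ[ℝ] StateSpace) ∘ₗ (linTheta p q r : StateSpace →ₗ[ℝ] H1Odd) := rfl
  rw [complexify, h, LinearMap.baseChange_sub, LinearMap.baseChange_id, LinearMap.baseChange_comp]
  rfl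

theorem graphHilbertC_injective (s : ℝ) : Function.Injective (graphHilbertC s) := by
  have h : (LinearMap.fst ℝ H1Odd H1ZeroEven).baseChange ℂ ∘ₗ graphHilbertC s = LinearMap.id := by
    rw [graphHilbertC, ← LinearMap.baseChange_comp, ← LinearMap.baseChange_id]
    rfl
  exact Function.LeftInverse.injective (LinearMap.congr_fun h)

/-- On sine modes, the reduced operator is diagonal. -/
theorem isDiagonal_reduced (p q r s : ℝ) :
    IsDiagonal (linThetaC p q r ∘ₗ graphHilbertC s) (fun k => complexFunctional (sinCoef k))
      (fun k => (1 : ℂ) ⊗ₜ[ℝ] sinMode 1 k)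
      fun k : ℕ+ => (modeSymbol (p + q * s) r k : ℂ) where
  sep _ h := eq_zero_of_complexFunctional (fun _ => eq_zero_of_sinCoef) h
  eig k y := by
    rw [linThetaC, graphHilbertC, ← LinearMap.baseChange_comp]
    exact complexFunctional_baseChange (fun φ => sinCoef_linTheta_graphHilbert p q r s k φ) y
  off j k h := by
    rw [complexFunctional_tmul, sinCoef_sinMode_of_ne h, Complex.ofReal_zero, zero_mul]
  diag k := by
    rw [complexFunctional_tmul, mul_one]
    exact_mod_cast sinCoef_sinMode_self k
  finite z hz := finite_modeSymbol_eq _ _ hz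
  solve z hz hne y := by
    obtain ⟨B, hB⟩ := exists_bound_resolvent (p + q * s) r hz
    set R : ℕ → ℂ := fun n => ((modeSymbol (p + q * s) r n : ℂ) - z)⁻¹ with hR
    obtain ⟨D₁, hD₁⟩ := exists_diagonal (m := fun n => (R n).re)
      fun n => (Complex.abs_re_le_norm _).trans (hB n)
    obtain ⟨D₂, hD₂⟩ := exists_diagonal (m := fun n => (R n).im)
      fun n => (Complex.abs_im_le_norm _).trans (hB n)
    -- the resolvent, assembled from the real and imaginary parts of its symbol
    refine ⟨D₁.baseChange ℂ y + Complex.I • D₂.baseChange ℂ y, fun k => ?_⟩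
    rw [map_add, map_smul, complexFunctional_baseChange (hD₁ k),
      complexFunctional_baseChange (hD₂ k), smul_eq_mul, ← mul_assoc, ← add_mul,
      mul_comm Complex.I, Complex.re_add_im, ← mul_assoc, hR,
      mul_inv_cancel₀ (sub_ne_zero.2 (hne k)), one_mul]

/-- The kernel of `linTheta` is nontrivial already on the first mode. -/
theorem exists_linTheta_eq_zero (p q r : ℝ) :
    ∃ (ξ : StateSpace) (f : StateSpace →ₗ[ℝ] ℝ), linTheta p q r ξ = 0 ∧ f ξ ≠ 0 := by
  have key (x y : ℝ) : linTheta p q r (x • sinMode 1 1, y • cosMode 1) =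
      (-(p * x) + q * y - r * x) • sinMode 1 1 := by
    rw [linTheta_apply, map_smul, map_smul, map_smul, map_smul, hilbertOdd_sinMode, map_neg,
      primEven_cosMode, primPrimOdd_sinMode]
    simp only [PNat.one_coe, Nat.cast_one, one_pow, inv_one, one_smul, neg_smul]
    module
  -- `θ = q sin α`, `γ₁ = (p + r) cos α` solves the equation, but may vanish
  by_cases hq : q = 0
  · by_cases hpr : p + r = 0
    · refine ⟨((1 : ℝ) • sinMode 1 1, (0 : ℝ) • cosMode 1), sinCoef 1 ∘ₗ LinearMap.fst ℝ _ _,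
        ?_, ?_⟩
      · rw [key, show -(p * 1) + q * 0 - r * 1 = -(p + r) by ring, hpr, neg_zero, zero_smul]
      · rw [one_smul]
        exact sinCoef_sinMode_self 1
    · refine ⟨((0 : ℝ) • sinMode 1 1, (1 : ℝ) • cosMode 1),
        sinCoef 1 ∘ₗ (primEven : H1ZeroEven →ₗ[ℝ] H1Odd) ∘ₗ LinearMap.snd ℝ _ _, ?_, ?_⟩
      · rw [key, hq, show -(p * 0) + 0 * 1 - r * 0 = 0 by ring, zero_smul]
      · have h : sinCoef 1 (primEven ((1 : ℝ) • cosMode 1)) ≠ 0 := by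
          rw [one_smul, primEven_cosMode, map_smul]
          simpa using sinCoef_sinMode_self 1
        exact h
  · refine ⟨(q • sinMode 1 1, (p + r) • cosMode 1), sinCoef 1 ∘ₗ LinearMap.fst ℝ _ _, ?_, ?_⟩
    · rw [key, show -(p * q) + q * (p + r) - r * q = 0 by ring, zero_smul]
    · have h : sinCoef 1 (q • sinMode 1 1) ≠ 0 := by
        rw [map_smul]
        exact mul_ne_zero hq (sinCoef_sinMode_self 1)
      exact h

/-- Vectors in the kernel of `linTheta` are fixed by `1 - S T`. -/
theorem hasEigenvalue_one (p q r s : ℝ) :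
    Module.End.HasEigenvalue (complexify (linearization p q r s)) 1 := by
  obtain ⟨ξ, f, h0, hf⟩ := exists_linTheta_eq_zero p q r
  refine Module.End.hasEigenvalue_of_hasEigenvector (x := (1 : ℂ) ⊗ₜ[ℝ] ξ) ⟨?_, fun h => ?_⟩
  · rw [IsDiagonal.mem_eigenspace (complexify_linearization p q r s), linThetaC,
      LinearMap.baseChange_tmul]
    have h1 : (linTheta p q r : StateSpace →ₗ[ℝ] H1Odd) ξ = 0 := h0
    rw [h1, TensorProduct.tmul_zero, map_zero, sub_self, zero_smul]
  · have h1 := complexFunctional_tmul f 1 ξ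
    rw [h, map_zero, mul_one] at h1
    exact hf (by exact_mod_cast h1.symm)

theorem graphHilbertC_sinMode_ne_zero (s : ℝ) (k : ℕ+) :
    graphHilbertC s ((1 : ℂ) ⊗ₜ[ℝ] sinMode 1 k) ≠ 0 := fun h => by
  have h1 := graphHilbertC_injective s (h.trans (map_zero _).symm)
  have h2 := complexFunctional_tmul (sinCoef k) 1 (sinMode 1 k)
  rw [h1, map_zero, mul_one] at h2
  exact sinCoef_sinMode_self k (by exact_mod_cast h2.symm)

theorem hasEigenvalue_mode (p q r s : ℝ) {μ : ℂ} {k : ℕ+}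
    (h : (modeSymbol (p + q * s) r k : ℂ) = 1 - μ) :
    Module.End.HasEigenvalue (complexify (linearization p q r s)) μ :=
  Module.End.hasEigenvalue_of_hasEigenvector
    ⟨(isDiagonal_reduced p q r s).S_w_mem (complexify_linearization p q r s) h,
      graphHilbertC_sinMode_ne_zero s k⟩

/-- The eigenvalues are one minus the symbol of the reduced operator. -/
theorem lam_eq {M : ℝ} (hM : 0 < M) (τ A g γbar c : ℝ) (k : ℕ+) :
    lam M τ A g γbar c k = 1 - modeSymbol (coefAngle M τ A γbar c +
      coefStrength M τ A γbar c * (c * M / π)) (coefGravity M τ A g) k := by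
  rw [lam, modeSymbol, coefAngle, coefStrength, coefGravity]
  have hM' := hM.ne'
  have hpi := Real.pi_ne_zero
  by_cases hτ : τ = 0
  · simp [hτ]
  · field_simp
    ring

/-- The eigenvectors in the theorem are multiples of the images of the sine modes; the multiple has
`c` in its denominator. -/
theorem graphHilbert_sinMode {M c : ℝ} (hM : 0 < M) (hc : c ≠ 0) (k : ℕ+) :
    eigenvector M c k = (-(π / (c * M))) • graphHilbert (c * M / π) (sinMode 1 k) := by
  have hpi := Real.pi_ne_zero
  have h1 : sinMode (-(π / (c * M))) k = (-(π / (c * M))) • sinMode 1 k :=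
    Subtype.ext (H1.ext fun x => by
      have e : ((-(π / (c * M))) • sinMode 1 k).1 x = -(π / (c * M)) * (sinMode 1 k).1 x := rfl
      rw [e, sinMode_one_apply]
      rfl)
  have h2 : graphHilbert (c * M / π) (sinMode 1 k) =
      (sinMode 1 k, (c * M / π) • hilbertOdd (sinMode 1 k)) := rfl
  rw [h2, hilbertOdd_sinMode, eigenvector, h1, Prod.smul_mk, smul_smul, smul_neg, ← neg_smul]
  have h3 : -(-(π / (c * M)) * (c * M / π)) = 1 := by
    have := hM.ne'
    field_simp
  rw [h3, one_smul]

end VortexSheet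

end

theorem mainTheorem4 (M τ A g γbar c : ℝ) (hM : 0 < M) (hτ : 0 < τ) :
    -- near the origin the map takes its values in the state space
    (∀ᶠ ξ : VortexSheet.StateSpace in 𝓝 0,
      VortexSheet.IsIn VortexSheet.H1Odd (VortexSheet.Theta M τ A g γbar ξ.1.1 ξ.2.1 c) ∧
      VortexSheet.IsIn VortexSheet.H1ZeroEven (VortexSheet.Gamma M τ A g γbar ξ.1.1 ξ.2.1 c)) ∧
    -- it has a linearization at the origin
    ∃ L : VortexSheet.StateSpace →L[ℝ] VortexSheet.StateSpace,
      HasFDerivAt (VortexSheet.travelingWaveMap M τ A g γbar c) L 0 ∧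
      -- spectrum and eigenvalues
      spectrum ℂ (VortexSheet.complexify L) =
        {1} ∪ Set.range (fun k : ℕ+ => (VortexSheet.lam M τ A g γbar c k : ℂ)) ∧
      (∀ k : ℕ+, Module.End.HasEigenvalue (VortexSheet.complexify L)
        (VortexSheet.lam M τ A g γbar c k : ℂ)) ∧
      ∀ μ : ℂ, μ ≠ 1 →
        -- geometric multiplicity
        Module.rank ℂ (Module.End.eigenspace (VortexSheet.complexify L) μ) =
          Cardinal.mk {k : ℕ+ // (VortexSheet.lam M τ A g γbar c k : ℂ) = μ} ∧
        -- algebraic multiplicity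
        Module.rank ℂ (Module.End.maxGenEigenspace (VortexSheet.complexify L) μ) =
          Cardinal.mk {k : ℕ+ // (VortexSheet.lam M τ A g γbar c k : ℂ) = μ} ∧
        -- eigenspace
        (c ≠ 0 →
          Module.End.eigenspace (VortexSheet.complexify L) μ =
            Submodule.span ℂ {v | ∃ k : ℕ+, (VortexSheet.lam M τ A g γbar c k : ℂ) = μ ∧
              v = (1 : ℂ) ⊗ₜ[ℝ] VortexSheet.eigenvector M c k}) := by
  open VortexSheet in
  set p := coefAngle M τ A γbar c
  set q := coefStrength M τ A γbar c
  set r := coefGravity M τ A g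
  set s := c * M / π with hs
  have hD := isDiagonal_reduced p q r s
  have hL := complexify_linearization p q r s
  have hlam (k : ℕ+) : (lam M τ A g γbar c k : ℂ) = 1 - (modeSymbol (p + q * s) r k : ℂ) := by
    rw [lam_eq hM τ A g γbar c k]
    push_cast
    rfl
  have hiff (μ : ℂ) (k : ℕ+) : (lam M τ A g γbar c k : ℂ) = μ ↔
      (modeSymbol (p + q * s) r k : ℂ) = 1 - μ := by
    rw [hlam]
    constructor <;> intro h
    · rw [← h]; ring
    · rw [h]; ring
  have heig (k : ℕ+) : Module.End.HasEigenvalue (complexify (linearization p q r s))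
      (lam M τ A g γbar c k : ℂ) := hasEigenvalue_mode p q r s ((hiff _ k).1 rfl)
  refine ⟨?_, linearization p q r s, hasFDerivAt_travelingWaveMap τ A g γbar c hM, ?_, heig,
    fun μ hμ => ?_⟩
  · filter_upwards [eventually_exists_state τ A g γbar c hM] with ξ hξ
    obtain ⟨⟨u, -, hu⟩, ⟨u', -, hu'⟩⟩ := hξ
    exact ⟨⟨u, hu⟩, ⟨u', hu'⟩⟩
  · apply Subset.antisymm
    · intro μ hμ
      by_contra h
      rw [mem_union, mem_singleton_iff, not_or] at h
      exact hD.notMem_spectrum hL h.1 (fun k hk => h.2 ⟨k, (hiff μ k).2 hk⟩) hμ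
    · rintro _ (rfl | ⟨k, rfl⟩)
      · exact (hasEigenvalue_one p q r s).mem_spectrum
      · exact (heig k).mem_spectrum
  · have hcard : Cardinal.mk {k : ℕ+ // (lam M τ A g γbar c k : ℂ) = μ} =
        Cardinal.mk {k : ℕ+ // (modeSymbol (p + q * s) r k : ℂ) = 1 - μ} :=
      Cardinal.mk_congr (Equiv.subtypeEquivRight (hiff μ))
    have hrank := hD.rank_eigenspace hL (graphHilbertC_injective s) hμ
    refine ⟨hrank.trans hcard.symm, ?_, fun hc => ?_⟩
    · rw [hD.maxGenEigenspace_eq hL hμ, hrank, hcard]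
    · -- the vectors `S (sin kα)` are nonzero multiples of the given eigenvectors
      have hr : -(π / (c * M)) ≠ 0 :=
        neg_ne_zero.2 (div_ne_zero Real.pi_ne_zero (mul_ne_zero hc hM.ne'))
      have hvec (k : ℕ+) : (1 : ℂ) ⊗ₜ[ℝ] eigenvector M c k =
          ((-(π / (c * M)) : ℝ) : ℂ) • graphHilbertC s ((1 : ℂ) ⊗ₜ[ℝ] sinMode 1 k) := by
        rw [graphHilbert_sinMode hM hc, graphHilbertC, LinearMap.baseChange_tmul,
          ← TensorProduct.smul_tmul, TensorProduct.smul_tmul', Complex.real_smul, smul_eq_mul]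
        rfl
      have hr' : ((-(π / (c * M)) : ℝ) : ℂ) ≠ 0 := by exact_mod_cast hr
      rw [hD.eigenspace_eq hL hμ]
      apply le_antisymm
      · rw [Submodule.span_le]
        rintro _ ⟨⟨k, hk⟩, rfl⟩
        have h1 : graphHilbertC s ((1 : ℂ) ⊗ₜ[ℝ] sinMode 1 k) =
            ((-(π / (c * M)) : ℝ) : ℂ)⁻¹ • (1 : ℂ) ⊗ₜ[ℝ] eigenvector M c k := by
          rw [hvec, inv_smul_smul₀ hr']
        simp only [SetLike.mem_coe]
        rw [h1]
        exact Submodule.smul_mem _ _ (Submodule.subset_span ⟨k, (hiff μ k).2 hk, rfl⟩)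
      · rw [Submodule.span_le]
        rintro _ ⟨k, hk, rfl⟩
        simp only [SetLike.mem_coe]
        rw [hvec]
        exact Submodule.smul_mem _ _ (Submodule.subset_span ⟨⟨k, (hiff μ k).1 hk⟩, rfl⟩)
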